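/- Let $\tau\in\mathbb R$ and $H>1/2$. Let $\widetilde{PSL}_2(\mathbb R,\tau)=\mathbb D^2\times\mathbb R$, $\mathbb D^2=\{x^2+y^2<1\}$, with the metric $$ds^2=\lambda^2(dx^2+dy^2)+\Bigl(2\tau\bigl(\tfrac{\lambda_y}{\lambda}dx-\tfrac{\lambda_x}{\lambda}dy\bigr)+dt\Bigr)^2,\qquad \lambda=\frac{2}{1-(x^2+y^2)},$$ and let $\rho$ be the hyperbolic distance of $(x,y)$ from the origin of $\mathbb D^2$, i.e. $\sqrt{x^2+y^2}=\tanh(\rho/2)$. An $H$-surface is a smooth immersed surface with a smooth unit normal for which the mean curvature (half the trace of the shape operator) is the constant $H$; it is rotational if it is invariant under all rotations about the axis $\{(0,0)\}\times\mathbb R$, and complete if its induced metric is complete. For $d\le-\sqrt{4H^2-1}$ define $\rho_1=\rho_1(d)$ and $\rho_2=\rho_2(d)$, $0\le\rho_1\le\rho_2$, by $$\cosh\rho_1=\frac{2dH+\sqrt{1-4H^2+d^2}}{1-4H^2},\qquad \cosh\rho_2=\frac{2dH-\sqrt{1-4H^2+d^2}}{1-4H^2},$$ and for $d<-\sqrt{4H^2-1}$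 let $u$ be a continuous function on $[\rho_1,\rho_2]$ with $$u'(\rho)=\frac{(2H\cosh\rho+d)\sqrt{1+4\tau^2\tanh^2(\rho/2)}}{\sqrt{\sinh^2\rho-(2H\cosh\rho+d)^2}}\qquad(\rho_1<\rho<\rho_2).$$ Then there is a one-parameter family $\mathfrak D_d$, $d\le-\sqrt{4H^2-1}$, of complete rotational $H$-surfaces such that: 1. For $d<-2H$, $0<\rho_1<\rho_2$ and $\mathfrak D_d$ is an immersed annulus, not embedded (it has a transversal self-intersection), contained in the closed region $\rho_1\le\rho\le\rho_2$ between two vertical cylinders. It is invariant under the vertical translation by $T=2(u(\rho_2)-u(\rho_1))>0$, and its image is the union of the translates by $kT$, $k\in\mathbb Z$, of the rotated curves $t=\pm(u(\rho)-u(\rho_2))$, $\rho_1\le\rho\le\rho_2$ (nodoid type). Moreover $\rho_1\to+\infty$ and $\rho_2\to+\infty$ as $d\to-\infty$, and $\rho_1\to0$ and $\rho_2\to\operatorname{arcosh}\frac{4H^2+1}{4H^2-1}$ as $d\to-2H$, $d<-2H$. 2. For $d=-2H$, $\rho_1=0$, $\rho_2=\operatorname{arcosh}\frac{4H^2+1}{4H^2-1}$,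 and $\mathfrak D_{-2H}$ is an embedded sphere, the union of the two rotated curves $t=\pm(u(\rho)-u(\rho_2))$, $0\le\rho\le\rho_2$. The maximal distance $\rho$ of its points from the rotational axis is $\operatorname{arcosh}\frac{4H^2+1}{4H^2-1}$. 3. For $-2H<d<-\sqrt{4H^2-1}$, $\mathfrak D_d$ is an embedded annulus contained in the closed region $\rho_1\le\rho\le\rho_2$, where $0<\rho_1<\operatorname{arcosh}\frac{2H}{\sqrt{4H^2-1}}<\rho_2$. It is invariant under the vertical translation by $T=2(u(\rho_2)-u(\rho_1))>0$, and its image is described by $u$ and $T$ as in 1 (unduloid type). Moreover $\rho_1\to0$ and $\rho_2\to\operatorname{arcosh}\frac{4H^2+1}{4H^2-1}$ as $d\to-2H$, $d>-2H$, and both $\rho_1,\rho_2\to\operatorname{arcosh}\frac{2H}{\sqrt{4H^2-1}}$ as $d\to-\sqrt{4H^2-1}$, $d<-\sqrt{4H^2-1}$. 4. For $d=-\sqrt{4H^2-1}$, $\mathfrak D_d$ is the (embedded) vertical cylinder over the circle of hyperbolic radius $\operatorname{arcosh}\frac{2H}{\sqrt{4H^2-1}}$ centred at the origin. -/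

import Mathlib

open Set Filter Topology MeasureTheory Manifold
open scoped ContDiff ENNReal

noncomputable section

namespace PSLTilde

/-- Coordinate space `ℝ³`, with coordinates `(x, y, t) = (p 0, p 1, p 2)`. -/
abbrev E3 : Type := EuclideanSpace ℝ (Fin 3)

/-! ### The ambient space `PSL₂~(ℝ, τ)` in the disk model -/

/-- The underlying set `𝔻² × ℝ`. -/
def space : Set E3 := {p | p 0 ^ 2 + p 1 ^ 2 < 1}

/-- The conformal factor `λ = 2 / (1 - (x² + y²))` of the hyperbolic metric on the disk. -/
def lam (p : E3) : ℝ := 2 / (1 - (p 0 ^ 2 + p 1 ^ 2))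

/-- The one-form `2τ((λ_y/λ) dx - (λ_x/λ) dy) + dt`; here `λ_x = x λ²` and `λ_y = y λ²`. -/
def conn (τ : ℝ) (p v : E3) : ℝ := 2 * τ * lam p * (p 1 * v 0 - p 0 * v 1) + v 2

/-- The metric `λ²(dx² + dy²) + (2τ((λ_y/λ) dx - (λ_x/λ) dy) + dt)²` at the point `p`. -/
def metric (τ : ℝ) (p v w : E3) : ℝ :=
  lam p ^ 2 * (v 0 * w 0 + v 1 * w 1) + conn τ p v * conn τ p w

/-- Christoffel symbols of the first kind of the Levi-Civita connection, contracted with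
coordinate vectors: `∑ Γ_{ij,l} vⁱ nʲ wˡ`, with
`Γ_{ij,l} = (∂_i g_{jl} + ∂_j g_{il} - ∂_l g_{ij}) / 2`. -/
def christoffel (τ : ℝ) (p v n w : E3) : ℝ :=
  (fderiv ℝ (fun q => metric τ q n w) p v + fderiv ℝ (fun q => metric τ q v w) p n
    - fderiv ℝ (fun q => metric τ q v n) p w) / 2

/-- Rotation of angle `φ` about the axis `{(0, 0)} × ℝ`. -/
def rot (φ : ℝ) (p : E3) : E3 :=
  !₂[Real.cos φ * p 0 - Real.sin φ * p 1, Real.sin φ * p 0 + Real.cos φ * p 1, p 2]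

/-- Vertical translation by `c`. -/
def vert (c : ℝ) (p : E3) : E3 := !₂[p 0, p 1, p 2 + c]

/-- The coordinate `ρ`: the hyperbolic distance from the origin of the disk to `(x, y)`, so that
`√(x² + y²) = tanh (ρ / 2)`. -/
def rho (p : E3) : ℝ := 2 * Real.artanh (√(p 0 ^ 2 + p 1 ^ 2))

/-! ### Immersed surfaces in `PSL₂~(ℝ, τ)` -/

section Surfaces

variable {E : Type*} [NormedAddCommGroup E] [NormedSpace ℝ E]
  {A : Type*} [TopologicalSpace A] (I : ModelWithCorners ℝ E A)
  {M : Type*} [TopologicalSpace M] [ChartedSpace A M]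

/-- The differential of `f : M → ℝ³` at `m`, with values in `ℝ³`. -/
def push (f : M → E3) (m : M) (v : TangentSpace I m) : E3 := mfderiv I 𝓘(ℝ, E3) f m v

/-- The (directional) tangent plane of `f` at `m`. -/
def tangentPlane (f : M → E3) (m : M) : Set E3 := Set.range (push I f m)

/-- `g(∇_v N, w)`, for a vector field `N` along `f`, a tangent vector `v` of `M` at `m` and an
ambient vector `w` at `f m`. -/
def covDeriv (τ : ℝ) (f N : M → E3) (m : M) (v : TangentSpace I m) (w : E3) : ℝ :=
  metric τ (f m) (push I N m v) w + christoffel τ (f m) (push I f m v) (N m) w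

/-- `N` is a smooth unit normal field along `f`. -/
def IsUnitNormal (τ : ℝ) (f N : M → E3) : Prop :=
  ContMDiff I 𝓘(ℝ, E3) ∞ N ∧
    ∀ m, metric τ (f m) (N m) (N m) = 1 ∧ ∀ v, metric τ (f m) (N m) (push I f m v) = 0

/-- `S` is the shape operator at `m` with respect to the normal field `N`: the endomorphism of the
tangent plane that represents the second fundamental form `-g(∇_v N, df w)` through the first
fundamental form `g(df v, df w)`. -/
def IsShapeOperator (τ : ℝ) (f N : M → E3) (m : M)
    (S : TangentSpace I m →ₗ[ℝ] TangentSpace I m) : Prop :=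
  ∀ v w, metric τ (f m) (push I f m (S v)) (push I f m w)
    = - covDeriv I τ f N m v (push I f m w)

/-- `f` is a smooth immersion into `PSL₂~(ℝ, τ)` of constant mean curvature `H` (half the trace of
the shape operator) with respect to some global smooth unit normal field. -/
structure IsHSurface (τ H : ℝ) (f : M → E3) : Prop where
  mem_space : ∀ m, f m ∈ space
  smooth : ContMDiff I 𝓘(ℝ, E3) ∞ f
  immersion : ∀ m, Function.Injective (push I f m)
  meanCurvature : ∃ N : M → E3, IsUnitNormal I τ f N ∧
    ∀ m, ∃ S : TangentSpace I m →ₗ[ℝ] TangentSpace I m,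
      IsShapeOperator I τ f N m S ∧ LinearMap.trace ℝ (TangentSpace I m) S = 2 * H

/-- Length of the restriction to `[0, 1]` of the curve `c` in `M`, for the metric induced by `f`. -/
def curveLength (τ : ℝ) (f : M → E3) (c : ℝ → M) : ℝ≥0∞ :=
  ∫⁻ s in Icc (0 : ℝ) 1,
    ENNReal.ofReal √(metric τ (f (c s)) (deriv (f ∘ c) s) (deriv (f ∘ c) s))

/-- Riemannian distance on `M` for the metric induced by `f`: the infimum of the lengths of the
`C¹` curves that join two points (`⊤` when there is none). -/
def inducedDist (τ : ℝ) (f : M → E3) (p q : M) : ℝ≥0∞ :=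
  ⨅ (c : ℝ → M) (_ : ContMDiff 𝓘(ℝ, ℝ) I 1 c ∧ c 0 = p ∧ c 1 = q), curveLength τ f c

/-- Completeness of the metric induced by `f`: Cauchy sequences for the induced distance
converge in `M`. -/
def IsCompleteSurface (τ : ℝ) (f : M → E3) : Prop :=
  ∀ p : ℕ → M,
    (∀ ε : ℝ≥0∞, 0 < ε → ∃ n₀ : ℕ, ∀ m ≥ n₀, ∀ n ≥ n₀, inducedDist I τ f (p m) (p n) < ε) →
    ∃ q : M, Tendsto p atTop (𝓝 q)

/-- The immersed surface `f` is invariant under the ambient map `F`: up to a reparametrization of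
`M`, composing with `F` does not change `f`. -/
def IsInvariant (f : M → E3) (F : E3 → E3) : Prop :=
  ∃ ψ : M ≃ₜ M, ∀ m, f (ψ m) = F (f m)

/-- Complete rotational `H`-surfaces. -/
structure IsCompleteRotationalHSurface (τ H : ℝ) (f : M → E3) : Prop where
  hSurface : IsHSurface I τ H f
  complete : IsCompleteSurface I τ f
  rotational : ∀ φ : ℝ, IsInvariant f (rot φ)

/-- `f` has a double point at which its two tangent planes differ. Then the image of `f` is not an
embedded surface, whatever the parametrization. -/
def HasTransversalSelfIntersection (f : M → E3) : Prop :=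
  ∃ m m' : M, m ≠ m' ∧ f m = f m' ∧ tangentPlane I f m ≠ tangentPlane I f m'

end Surfaces

/-- The annulus. -/
abbrev Annulus : Type := Circle × ℝ

/-- The model with corners of the annulus. -/
abbrev annulusModel : ModelWithCorners ℝ (EuclideanSpace ℝ (Fin 1) × ℝ)
    (ModelProd (EuclideanSpace ℝ (Fin 1)) ℝ) := (𝓡 1).prod 𝓘(ℝ, ℝ)

/-- The two-sphere. -/
abbrev Sphere2 : Type := Metric.sphere (0 : EuclideanSpace ℝ (Fin 3)) 1

/-! ### The generating curve -/

/-- The function under the square root, `f(ρ) = sinh² ρ - (d + 2H cosh ρ)²`. -/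
def radicand (H d r : ℝ) : ℝ := Real.sinh r ^ 2 - (d + 2 * H * Real.cosh r) ^ 2

/-- The derivative of the height `u` of the generating curve `t = u(ρ)`. -/
def slope (τ H d r : ℝ) : ℝ :=
  (2 * H * Real.cosh r + d) * √(1 + 4 * τ ^ 2 * Real.tanh (r / 2) ^ 2) / √(radicand H d r)

/-- The inner radius: `cosh ρ₁ = (2dH + √(1 - 4H² + d²)) / (1 - 4H²)`. -/
def rho₁ (H d : ℝ) : ℝ :=
  Real.arcosh ((2 * d * H + √(1 - 4 * H ^ 2 + d ^ 2)) / (1 - 4 * H ^ 2))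

/-- The outer radius: `cosh ρ₂ = (2dH - √(1 - 4H² + d²)) / (1 - 4H²)`. -/
def rho₂ (H d : ℝ) : ℝ :=
  Real.arcosh ((2 * d * H - √(1 - 4 * H ^ 2 + d ^ 2)) / (1 - 4 * H ^ 2))

/-- `u` is a primitive of `slope` on `[ρ₁, ρ₂]` (an improper one at the end points). -/
def IsGeneratingFunction (τ H d : ℝ) (u : ℝ → ℝ) : Prop :=
  ContinuousOn u (Icc (rho₁ H d) (rho₂ H d)) ∧
    ∀ r ∈ Ioo (rho₁ H d) (rho₂ H d), HasDerivAt u (slope τ H d r) r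

/-- The vertical period: twice the height of the graph of `u`. -/
def period (H d : ℝ) (u : ℝ → ℝ) : ℝ := 2 * (u (rho₂ H d) - u (rho₁ H d))

/-- The set swept out by rotating the graph of `u` over `[ρ₁, ρ₂]`, moved vertically so that its
outer end lies in `t = 0`, together with its mirror image in `t = 0`. -/
def doubledGraph (H d : ℝ) (u : ℝ → ℝ) : Set E3 :=
  {p | p ∈ space ∧ rho p ∈ Icc (rho₁ H d) (rho₂ H d) ∧
    (p 2 = u (rho p) - u (rho₂ H d) ∨ p 2 = - (u (rho p) - u (rho₂ H d)))}

/-- The union of the vertical translates of the doubled graph by the multiples of the period. -/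
def periodicSurface (H d : ℝ) (u : ℝ → ℝ) : Set E3 :=
  {p | ∃ k : ℤ, vert (k * period H d u) p ∈ doubledGraph H d u}

/-- The closed region between the vertical cylinders `ρ = r₁` and `ρ = r₂`. -/
def regionBetween (r₁ r₂ : ℝ) : Set E3 := {p | p ∈ space ∧ r₁ ≤ rho p ∧ rho p ≤ r₂}

/-- The vertical cylinder over the hyperbolic circle of radius `r` centred at the origin. -/
def verticalCylinder (r : ℝ) : Set E3 := {p | p ∈ space ∧ rho p = r}

end PSLTilde

end

open PSLTilde

noncomputable section

namespace PSLTilde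

/-! ### The Levi-Civita connection in coordinates -/

/-! The equation for u is singular at both ends only because ρ is a bad parameter. As a function of
x = cosh ρ the radicand is a quadratic with leading coefficient −(4H² − 1) and roots cosh ρ₁, cosh
ρ₂. With x = `center` + `radius` · cos s it equals (4H² − 1) x'² (`radicand_coshP`), and the factor
x' cancels from du/ds. The profile is then smooth wherever x > 1: its radius is even and 2π-periodic
in s, and its height, the integral of `speedP`, is odd and gains a constant over each period. The
half −π ≤ s ≤ 0 is the graph of u (`isGeneratingFunction_graphOf`), oddness gives the mirror image,
and periodicity gives the vertical translates.

For the mean curvature it is enough to know the normal curvatures along two orthogonal directions.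
One direction is the parallel. The meridian is in general not orthogonal to it when τ ≠ 0, so the
second curve also rotates, at speed `driftP`. `profile_curvature` shows that the two normal
curvatures add up to 2H, and `hasTestFrame_of_profile` packages this for any surface that follows
the profile. The same frames give completeness: if a closed embedding Φ of the surface into a
complete normed space stretches both frame vectors by a bounded factor, then Cauchy sequences for
the induced distance are Cauchy for Φ, hence converge.

The global shape depends on the sign of the force 2H cosh ρ + d, which is the sign of the derivative
of the height. The period is positive (`heightP_pi_pos`), because a positive multiple of the height
plus a multiple of the vertical component of the normal is nondecreasing in s, and that component
vanishes at s = 0 and s = π. If d > −2H the force is positive, the height is a homeomorphism of ℝ,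
and the annulus is embedded (`isEmbedding_annulusMap`). If d < −2H the force is negative at the
inner radius, so the height overshoots its value at π and the profile crosses its own mirror image
(`hasTransversalSelfIntersection_annulusMap`). If `radius` = 0 the profile is a vertical line.

For d = −2H the profile reaches the axis at s = ±π and the formulas in s degenerate there. In the
variable z = sin (s/2), the height on a round parameter sphere, every coefficient extends smoothly
across the poles z = ±1. The poles are umbilic, and their frames are computed by hand
(`isTestCurve_pole`). -/

/-- Derivative of `conn τ · v` in the direction `h`. -/
def dconn (τ : ℝ) (p h v : E3) : ℝ :=
  2 * τ * lam p ^ 2 * (p 0 * h 0 + p 1 * h 1) * (p 1 * v 0 - p 0 * v 1)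
    + 2 * τ * lam p * (h 1 * v 0 - h 0 * v 1)

/-- Derivative of `metric τ · v w` in the direction `h`. -/
def dmetric (τ : ℝ) (p v w h : E3) : ℝ :=
  2 * lam p ^ 3 * (p 0 * h 0 + p 1 * h 1) * (v 0 * w 0 + v 1 * w 1)
    + dconn τ p h v * conn τ p w + conn τ p v * dconn τ p h w

lemma hasDerivAt_lam_line {p : E3} (hp : p ∈ space) (h : E3) :
    HasDerivAt (fun t : ℝ => lam (p + t • h)) (lam p ^ 2 * (p 0 * h 0 + p 1 * h 1)) 0 := by
  have hp' : 1 - (p 0 ^ 2 + p 1 ^ 2) ≠ 0 := by have : p 0 ^ 2 + p 1 ^ 2 < 1 := hp; linarith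
  have h0 : HasDerivAt (fun t : ℝ => p 0 + t * h 0) (h 0) 0 := by
    simpa using ((hasDerivAt_id (0 : ℝ)).mul_const (h 0)).const_add (p 0)
  have h1 : HasDerivAt (fun t : ℝ => p 1 + t * h 1) (h 1) 0 := by
    simpa using ((hasDerivAt_id (0 : ℝ)).mul_const (h 1)).const_add (p 1)
  have := (hasDerivAt_const (0 : ℝ) (2 : ℝ)).div (((h0.pow 2).add (h1.pow 2)).const_sub 1)
    (by simpa using hp')
  refine (this.congr_deriv ?_).congr_of_eventuallyEq (.of_forall fun t => ?_)
  · simp [lam]; field_simp; ring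
  · simp [lam]

lemma hasDerivAt_conn_line (τ : ℝ) {p : E3} (hp : p ∈ space) (h v : E3) :
    HasDerivAt (fun t : ℝ => conn τ (p + t • h) v) (dconn τ p h v) 0 := by
  have h0 : HasDerivAt (fun t : ℝ => p 0 + t * h 0) (h 0) 0 := by
    simpa using ((hasDerivAt_id (0 : ℝ)).mul_const (h 0)).const_add (p 0)
  have h1 : HasDerivAt (fun t : ℝ => p 1 + t * h 1) (h 1) 0 := by
    simpa using ((hasDerivAt_id (0 : ℝ)).mul_const (h 1)).const_add (p 1)
  have := (((hasDerivAt_lam_line hp h).const_mul (2 * τ)).mul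
    ((h1.mul_const (v 0)).sub (h0.mul_const (v 1)))).add_const (v 2)
  refine (this.congr_deriv ?_).congr_of_eventuallyEq (.of_forall fun t => ?_)
  · simp only [dconn, Pi.sub_apply, zero_mul, zero_smul, add_zero]; ring
  · simp [conn]

lemma hasDerivAt_metric_line (τ : ℝ) {p : E3} (hp : p ∈ space) (v w h : E3) :
    HasDerivAt (fun t : ℝ => metric τ (p + t • h) v w) (dmetric τ p v w h) 0 := by
  have := (((hasDerivAt_lam_line hp h).pow 2).mul_const (v 0 * w 0 + v 1 * w 1)).add
    ((hasDerivAt_conn_line τ hp h v).mul (hasDerivAt_conn_line τ hp h w))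
  refine (this.congr_deriv ?_).congr_of_eventuallyEq (.of_forall fun t => ?_)
  · simp [dmetric]; ring
  · simp [metric]

lemma differentiableAt_metric (τ : ℝ) {p : E3} (hp : p ∈ space) (v w : E3) :
    DifferentiableAt ℝ (fun q => metric τ q v w) p := by
  have hp' : 1 - (p 0 ^ 2 + p 1 ^ 2) ≠ 0 := by have : p 0 ^ 2 + p 1 ^ 2 < 1 := hp; linarith
  unfold metric conn lam
  fun_prop (disch := assumption)

/-- Differentiability is known separately, so the Fréchet derivative can be read off along a line,
where only one-variable calculus is needed. -/
lemma fderiv_metric (τ : ℝ) {p : E3} (hp : p ∈ space) (v w h : E3) :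
    fderiv ℝ (fun q => metric τ q v w) p h = dmetric τ p v w h := by
  rw [← (differentiableAt_metric τ hp v w).lineDeriv_eq_fderiv]
  exact (hasDerivAt_metric_line τ hp v w h).deriv

lemma christoffel_eq (τ : ℝ) {p : E3} (hp : p ∈ space) (v n w : E3) :
    christoffel τ p v n w
      = (dmetric τ p n w v + dmetric τ p v w n - dmetric τ p v n w) / 2 := by
  simp only [christoffel, fderiv_metric τ hp]

lemma dmetric_comm (τ : ℝ) (p v w h : E3) : dmetric τ p v w h = dmetric τ p w v h := by
  simp only [dmetric]; ring

/-- On the diagonal two of the three terms cancel by symmetry of the metric. This is why the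
curvature clause of `IsTestCurve` involves only the derivative of the metric in the normal
direction. -/
lemma christoffel_self (τ : ℝ) {p : E3} (hp : p ∈ space) (v n : E3) :
    christoffel τ p v n v = dmetric τ p v v n / 2 := by
  rw [christoffel_eq τ hp, dmetric_comm τ p n v v]; ring

lemma metric_comm (τ : ℝ) (p v w : E3) : metric τ p v w = metric τ p w v := by
  simp only [metric]; ring

/-- The metric at `p` as a bilinear form. -/
def metricForm (τ : ℝ) (p : E3) : E3 →ₗ[ℝ] E3 →ₗ[ℝ] ℝ :=
  LinearMap.mk₂ ℝ (metric τ p)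
    (fun _ _ _ => by simp [metric, conn]; ring) (fun _ _ _ => by simp [metric, conn]; ring)
    (fun _ _ _ => by simp [metric, conn]; ring) (fun _ _ _ => by simp [metric, conn]; ring)

@[simp] lemma metricForm_apply (τ : ℝ) (p v w : E3) : metricForm τ p v w = metric τ p v w := rfl

/-- `(v, w) ↦ (D_n g(v, w) + D_v g(n, w) - D_w g(v, n)) / 2` as a bilinear form. -/
def christoffelForm (τ : ℝ) (p n : E3) : E3 →ₗ[ℝ] E3 →ₗ[ℝ] ℝ :=
  LinearMap.mk₂ ℝ
    (fun v w => (dmetric τ p n w v + dmetric τ p v w n - dmetric τ p v n w) / 2)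
    (fun _ _ _ => by simp [dmetric, dconn, conn]; ring)
    (fun _ _ _ => by simp [dmetric, dconn, conn]; ring)
    (fun _ _ _ => by simp [dmetric, dconn, conn]; ring)
    (fun _ _ _ => by simp [dmetric, dconn, conn]; ring)

lemma christoffelForm_apply (τ : ℝ) {p : E3} (hp : p ∈ space) (n v w : E3) :
    christoffelForm τ p n v w = christoffel τ p v n w := by
  rw [christoffel_eq τ hp]; rfl

/-! ### Linear algebra of shape operators -/

section LinearAlgebra

variable {V : Type*} [AddCommGroup V] [Module ℝ V]

/-- Pairing a linear relation with each vector shows that the two are independent, and two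
independent vectors span a plane. Positivity of g is needed only on these two vectors. -/
lemma exists_eq_add_smul_of_orthogonal (hV : Module.finrank ℝ V = 2) (g : V →ₗ[ℝ] V →ₗ[ℝ] ℝ)
    {e₁ e₂ : V} (h12 : g e₁ e₂ = 0) (h21 : g e₂ e₁ = 0) (h11 : 0 < g e₁ e₁) (h22 : 0 < g e₂ e₂)
    (v : V) : ∃ a b : ℝ, v = a • e₁ + b • e₂ := by
  have hli : LinearIndependent ℝ ![e₁, e₂] := by
    rw [LinearIndependent.pair_iff]
    intro s t hst
    have h1 := congrArg (fun v => g v e₁) hst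
    have h2 := congrArg (fun v => g v e₂) hst
    simp [h12, h21] at h1 h2
    exact ⟨h1.resolve_right h11.ne', h2.resolve_right h22.ne'⟩
  have hspan := hli.span_eq_top_of_card_eq_finrank (by simp [hV])
  have hv : v ∈ Submodule.span ℝ (Set.range ![e₁, e₂]) := hspan ▸ Submodule.mem_top
  rw [Matrix.range_cons, Matrix.range_cons, Matrix.range_empty, Set.union_empty,
    Set.singleton_union, Submodule.mem_span_pair] at hv
  obtain ⟨a, b, h⟩ := hv
  exact ⟨a, b, h.symm⟩

/-- S v = (h(v, e₁)/g(e₁, e₁)) e₁ + (h(v, e₂)/g(e₂, e₂)) e₂ works. It is a sum of two rank-one maps,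
so its trace involves only the diagonal values of h, and neither symmetry nor off-diagonal values of
h are required. -/
lemma exists_endomorphism_of_orthogonal (hV : Module.finrank ℝ V = 2) (g h : V →ₗ[ℝ] V →ₗ[ℝ] ℝ)
    {e₁ e₂ : V} (h12 : g e₁ e₂ = 0) (h21 : g e₂ e₁ = 0) (h11 : 0 < g e₁ e₁) (h22 : 0 < g e₂ e₂) :
    ∃ S : V →ₗ[ℝ] V, (∀ v w, g (S v) w = h v w) ∧
      LinearMap.trace ℝ V S = h e₁ e₁ / g e₁ e₁ + h e₂ e₂ / g e₂ e₂ := by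
  have : Module.Finite ℝ V := Module.finite_of_finrank_pos (by omega)
  refine ⟨((g e₁ e₁)⁻¹ • h.flip e₁).smulRight e₁ + ((g e₂ e₂)⁻¹ • h.flip e₂).smulRight e₂,
    fun v w => ?_, ?_⟩
  · obtain ⟨a, b, rfl⟩ := exists_eq_add_smul_of_orthogonal hV g h12 h21 h11 h22 w
    simp [h12, h21]
    field_simp
  · rw [map_add, LinearMap.trace_smulRight, LinearMap.trace_smulRight]
    simp
    field_simp

end LinearAlgebra

/-! ### Surfaces described by orthogonal pairs of curves -/

section Surfaces

variable {E : Type*} [NormedAddCommGroup E] [NormedSpace ℝ E]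
  {A : Type*} [TopologicalSpace A] (I : ModelWithCorners ℝ E A)
  {M : Type*} [TopologicalSpace M] [ChartedSpace A M]
  {E' : Type*} [NormedAddCommGroup E'] [NormedSpace ℝ E']

/-- `γ` is a curve in `M` whose image under `f` has velocity `F` and normal curvature `κ` at time
`0`, and whose image under `Φ` has velocity at most `C` times the length of `F`. -/
structure IsTestCurve (τ : ℝ) (f N : M → E3) (Φ : M → E') (C : ℝ) (m : M) (γ : ℝ → M) (F : E3)
    (κ : ℝ) : Prop where
  mdiff : MDifferentiableAt 𝓘(ℝ, ℝ) I γ 0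
  base : γ 0 = m
  vel : HasDerivAt (f ∘ γ) F 0
  pos : 0 < metric τ (f m) F F
  normal : metric τ (f m) (N m) F = 0
  curv : ∃ N', HasDerivAt (N ∘ γ) N' 0 ∧
    -(metric τ (f m) N' F + dmetric τ (f m) F F (N m) / 2) = κ * metric τ (f m) F F
  bound : ∃ Φ', HasDerivAt (Φ ∘ γ) Φ' 0 ∧ ‖Φ'‖ ≤ C * √(metric τ (f m) F F)

/-- Two orthogonal test curves through `m` whose normal curvatures have mean `H`. -/
def HasTestFrame (τ H : ℝ) (f N : M → E3) (Φ : M → E') (C : ℝ) (m : M) : Prop :=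
  ∃ γ₁ γ₂ F₁ F₂ κ₁ κ₂, IsTestCurve I τ f N Φ C m γ₁ F₁ κ₁ ∧ IsTestCurve I τ f N Φ C m γ₂ F₂ κ₂ ∧
    metric τ (f m) F₁ F₂ = 0 ∧ κ₁ + κ₂ = 2 * H

/-- The differential of a map into a normed space, with values in that space. -/
def differential (Φ : M → E') (m : M) : TangentSpace I m →L[ℝ] E' := mfderiv I 𝓘(ℝ, E') Φ m

lemma hasDerivAt_comp_differential {f : M → E'} {γ : ℝ → M} {t : ℝ}
    (hf : MDifferentiableAt I 𝓘(ℝ, E') f (γ t)) (hγ : MDifferentiableAt 𝓘(ℝ, ℝ) I γ t) :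
    HasDerivAt (f ∘ γ) (differential I f (γ t) (mfderiv 𝓘(ℝ, ℝ) I γ t (1 : ℝ))) t := by
  have h : HasFDerivAt (f ∘ γ) ((differential I f (γ t)).comp
      (mfderiv 𝓘(ℝ, ℝ) I γ t : ℝ →L[ℝ] TangentSpace I (γ t))) t :=
    hasMFDerivAt_iff_hasFDerivAt.1 (hf.hasMFDerivAt.comp t hγ.hasMFDerivAt)
  exact h.hasDerivAt

/-- The velocity of a curve through `m`, as a tangent vector at `m`. -/
lemma exists_tangent_of_curve {γ : ℝ → M} {m : M} (h0 : γ 0 = m)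
    (hγ : MDifferentiableAt 𝓘(ℝ, ℝ) I γ 0) : ∃ e : TangentSpace I m,
      (∀ (f : M → E3) (F : E3), MDifferentiableAt I 𝓘(ℝ, E3) f m → HasDerivAt (f ∘ γ) F 0 →
        push I f m e = F) ∧
      ∀ (Φ : M → E') (F : E'), MDifferentiableAt I 𝓘(ℝ, E') Φ m → HasDerivAt (Φ ∘ γ) F 0 →
        differential I Φ m e = F := by
  subst h0
  exact ⟨mfderiv 𝓘(ℝ, ℝ) I γ 0 (1 : ℝ),
    fun f F hf h => (hasDerivAt_comp_differential I hf hγ).unique h,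
    fun f F hf h => (hasDerivAt_comp_differential I hf hγ).unique h⟩

/-- The differential `push I f m` as a linear map. -/
def pushLin (f : M → E3) (m : M) : TangentSpace I m →ₗ[ℝ] E3 :=
  (differential I f m).toLinearMap

lemma pushLin_apply (f : M → E3) (m : M) (v : TangentSpace I m) :
    pushLin I f m v = push I f m v := rfl

variable {I} {τ H C : ℝ} {f N : M → E3} {Φ : M → E'} {m : M}

/-- The tangent vectors of a test frame. -/
lemma HasTestFrame.exists_tangent (hfr : HasTestFrame I τ H f N Φ C m)
    (hf : MDifferentiableAt I 𝓘(ℝ, E3) f m) (hN : MDifferentiableAt I 𝓘(ℝ, E3) N m)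
    (hΦ : MDifferentiableAt I 𝓘(ℝ, E') Φ m) (hp : f m ∈ space) :
    ∃ e₁ e₂ : TangentSpace I m, ∃ κ₁ κ₂ : ℝ,
      metric τ (f m) (push I f m e₁) (push I f m e₂) = 0 ∧ κ₁ + κ₂ = 2 * H ∧
      ∀ e κ, (e = e₁ ∧ κ = κ₁ ∨ e = e₂ ∧ κ = κ₂) →
        0 < metric τ (f m) (push I f m e) (push I f m e) ∧
        metric τ (f m) (N m) (push I f m e) = 0 ∧
        -covDeriv I τ f N m e (push I f m e)
          = κ * metric τ (f m) (push I f m e) (push I f m e) ∧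
        ‖differential I Φ m e‖
          ≤ C * √(metric τ (f m) (push I f m e) (push I f m e)) := by
  obtain ⟨γ₁, γ₂, F₁, F₂, κ₁, κ₂, h₁, h₂, h12, hκ⟩ := hfr
  have key : ∀ γ F κ, IsTestCurve I τ f N Φ C m γ F κ → ∃ e : TangentSpace I m,
      push I f m e = F ∧ 0 < metric τ (f m) (push I f m e) (push I f m e) ∧
        metric τ (f m) (N m) (push I f m e) = 0 ∧
        -covDeriv I τ f N m e (push I f m e)
          = κ * metric τ (f m) (push I f m e) (push I f m e) ∧
        ‖differential I Φ m e‖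
          ≤ C * √(metric τ (f m) (push I f m e) (push I f m e)) := by
    intro γ F κ h
    obtain ⟨e, he, he'⟩ := exists_tangent_of_curve (E' := E') I h.base h.mdiff
    obtain ⟨N', hN', hc⟩ := h.curv
    obtain ⟨Φ', hΦ', hb⟩ := h.bound
    have hF := he f F hf h.vel
    refine ⟨e, hF, ?_⟩
    rw [hF, he' Φ Φ' hΦ hΦ', covDeriv, he N N' hN hN', hF, christoffel_self τ hp]
    exact ⟨h.pos, h.normal, hc, hb⟩
  obtain ⟨e₁, hF₁, k₁⟩ := key γ₁ F₁ κ₁ h₁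
  obtain ⟨e₂, hF₂, k₂⟩ := key γ₂ F₂ κ₂ h₂
  refine ⟨e₁, e₂, κ₁, κ₂, by rw [hF₁, hF₂, h12], hκ, ?_⟩
  rintro e κ (⟨rfl, rfl⟩ | ⟨rfl, rfl⟩)
  exacts [k₁, k₂]

section Frames

variable (hE : Module.finrank ℝ E = 2)
include hE

lemma exists_tangent_coords
    {e₁ e₂ : TangentSpace I m} (h12 : metric τ (f m) (push I f m e₁) (push I f m e₂) = 0)
    (h1 : 0 < metric τ (f m) (push I f m e₁) (push I f m e₁))
    (h2 : 0 < metric τ (f m) (push I f m e₂) (push I f m e₂)) (v : TangentSpace I m) :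
    ∃ a b : ℝ, v = a • e₁ + b • e₂ :=
  exists_eq_add_smul_of_orthogonal (V := TangentSpace I m) hE
    ((metricForm τ (f m)).compl₁₂ (pushLin I f m) (pushLin I f m)) h12
    ((metric_comm _ _ _ _).trans h12) h1 h2 v

end Frames

end Surfaces

/-! ### Complete surfaces from test frames -/

section Surfaces

variable {E : Type*} [NormedAddCommGroup E] [NormedSpace ℝ E]
  {A : Type*} [TopologicalSpace A] {I : ModelWithCorners ℝ E A}
  {M : Type*} [TopologicalSpace M] [ChartedSpace A M]
  {E' : Type*} [NormedAddCommGroup E'] [NormedSpace ℝ E']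
  {τ H C : ℝ} {f N : M → E3} {Φ : M → E'} {m : M}

lemma metric_push_push_of_coords {e₁ e₂ : TangentSpace I m} (a b : ℝ)
    (h12 : metric τ (f m) (push I f m e₁) (push I f m e₂) = 0) :
    metric τ (f m) (push I f m (a • e₁ + b • e₂)) (push I f m (a • e₁ + b • e₂))
      = a ^ 2 * metric τ (f m) (push I f m e₁) (push I f m e₁)
        + b ^ 2 * metric τ (f m) (push I f m e₂) (push I f m e₂) := by
  simp only [← metricForm_apply, ← pushLin_apply, map_add, map_smul, LinearMap.add_apply,
    LinearMap.smul_apply, smul_eq_mul] at *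
  have h21 : metricForm τ (f m) (pushLin I f m e₂) (pushLin I f m e₁) = 0 := by
    rw [metricForm_apply, metric_comm]; exact h12
  rw [h12, h21]; ring

section Frames

variable (hE : Module.finrank ℝ E = 2)

include hE in
lemma injective_push_of_orthogonal {e₁ e₂ : TangentSpace I m}
    (h12 : metric τ (f m) (push I f m e₁) (push I f m e₂) = 0)
    (h1 : 0 < metric τ (f m) (push I f m e₁) (push I f m e₁))
    (h2 : 0 < metric τ (f m) (push I f m e₂) (push I f m e₂)) :
    Function.Injective (push I f m) := by
  suffices h : Function.Injective (pushLin I f m) from h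
  rw [← LinearMap.ker_eq_bot, LinearMap.ker_eq_bot']
  intro v hv
  obtain ⟨a, b, rfl⟩ := exists_tangent_coords hE h12 h1 h2 v
  have h := metric_push_push_of_coords a b h12
  rw [← pushLin_apply I f m (a • e₁ + b • e₂), hv, ← metricForm_apply, map_zero] at h
  have ha : a ^ 2 * metric τ (f m) (push I f m e₁) (push I f m e₁) = 0 := by
    have := mul_nonneg (sq_nonneg a) h1.le
    have := mul_nonneg (sq_nonneg b) h2.le
    linarith
  have hb : b ^ 2 * metric τ (f m) (push I f m e₂) (push I f m e₂) = 0 := by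
    linarith
  have ha' : a = 0 := by simpa [h1.ne'] using ha
  have hb' : b = 0 := by simpa [h2.ne'] using hb
  simp [ha', hb']

include hE in
-- Both fundamental forms are bilinear on the tangent space, so `exists_endomorphism_of_orthogonal`
-- applies; the trace is then the sum of the two normal curvatures.
lemma exists_isShapeOperator {e₁ e₂ : TangentSpace I m} (hp : f m ∈ space)
    (h12 : metric τ (f m) (push I f m e₁) (push I f m e₂) = 0)
    (h1 : 0 < metric τ (f m) (push I f m e₁) (push I f m e₁))
    (h2 : 0 < metric τ (f m) (push I f m e₂) (push I f m e₂)) {κ₁ κ₂ : ℝ}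
    (hκ₁ : -covDeriv I τ f N m e₁ (push I f m e₁)
      = κ₁ * metric τ (f m) (push I f m e₁) (push I f m e₁))
    (hκ₂ : -covDeriv I τ f N m e₂ (push I f m e₂)
      = κ₂ * metric τ (f m) (push I f m e₂) (push I f m e₂)) :
    ∃ S : TangentSpace I m →ₗ[ℝ] TangentSpace I m,
      IsShapeOperator I τ f N m S ∧ LinearMap.trace ℝ (TangentSpace I m) S = κ₁ + κ₂ := by
  obtain ⟨S, hS, htr⟩ := exists_endomorphism_of_orthogonal (V := TangentSpace I m) hE
    ((metricForm τ (f m)).compl₁₂ (pushLin I f m) (pushLin I f m))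
    (-((metricForm τ (f m)).compl₁₂ (pushLin I N m) (pushLin I f m)
      + (christoffelForm τ (f m) (N m)).compl₁₂ (pushLin I f m) (pushLin I f m)))
    h12 ((metric_comm _ _ _ _).trans h12) h1 h2
  have hcov : ∀ v w : TangentSpace I m,
      (-((metricForm τ (f m)).compl₁₂ (pushLin I N m) (pushLin I f m)
        + (christoffelForm τ (f m) (N m)).compl₁₂ (pushLin I f m) (pushLin I f m))) v w
        = -covDeriv I τ f N m v (push I f m w) := by
    intro v w
    simp [christoffelForm_apply τ hp, covDeriv, pushLin_apply]
  refine ⟨S, fun v w => (hS v w).trans (hcov v w), htr.trans ?_⟩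
  refine (congrArg₂ (fun x y : ℝ => x / _ + y / _) ((hcov e₁ e₁).trans hκ₁)
    ((hcov e₂ e₂).trans hκ₂)).trans ?_
  exact congrArg₂ (· + ·) (mul_div_cancel_right₀ _ h1.ne') (mul_div_cancel_right₀ _ h2.ne')

include hE in
theorem isUnitNormal_of_hasTestFrame (hf : ContMDiff I 𝓘(ℝ, E3) ∞ f)
    (hN : ContMDiff I 𝓘(ℝ, E3) ∞ N) (hΦ : ContMDiff I 𝓘(ℝ, E') ∞ Φ)
    (hspace : ∀ m, f m ∈ space) (hunit : ∀ m, metric τ (f m) (N m) (N m) = 1)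
    (hframe : ∀ m, HasTestFrame I τ H f N Φ C m) : IsUnitNormal I τ f N := by
  refine ⟨hN, fun m => ⟨hunit m, fun v => ?_⟩⟩
  obtain ⟨e₁, e₂, κ₁, κ₂, h12, -, h⟩ := (hframe m).exists_tangent
    (hf.mdifferentiable (by simp) m) (hN.mdifferentiable (by simp) m)
    (hΦ.mdifferentiable (by simp) m) (hspace m)
  obtain ⟨p1, n1, -, -⟩ := h e₁ κ₁ (.inl ⟨rfl, rfl⟩)
  obtain ⟨p2, n2, -, -⟩ := h e₂ κ₂ (.inr ⟨rfl, rfl⟩)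
  obtain ⟨a, b, rfl⟩ := exists_tangent_coords hE h12 p1 p2 v
  rw [← metricForm_apply, ← pushLin_apply] at n1 n2 ⊢
  rw [map_add, map_smul, map_smul, map_add, map_smul, map_smul, n1, n2]
  simp

include hE in
theorem isHSurface_of_hasTestFrame (hf : ContMDiff I 𝓘(ℝ, E3) ∞ f)
    (hN : ContMDiff I 𝓘(ℝ, E3) ∞ N) (hΦ : ContMDiff I 𝓘(ℝ, E') ∞ Φ)
    (hspace : ∀ m, f m ∈ space) (hunit : ∀ m, metric τ (f m) (N m) (N m) = 1)
    (hframe : ∀ m, HasTestFrame I τ H f N Φ C m) : IsHSurface I τ H f := by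
  refine ⟨hspace, hf, fun m => ?_, N,
    isUnitNormal_of_hasTestFrame hE hf hN hΦ hspace hunit hframe, fun m => ?_⟩
  all_goals
    obtain ⟨e₁, e₂, κ₁, κ₂, h12, hκ, h⟩ := (hframe m).exists_tangent
      (hf.mdifferentiable (by simp) m) (hN.mdifferentiable (by simp) m)
      (hΦ.mdifferentiable (by simp) m) (hspace m)
    obtain ⟨p1, -, c1, -⟩ := h e₁ κ₁ (.inl ⟨rfl, rfl⟩)
    obtain ⟨p2, -, c2, -⟩ := h e₂ κ₂ (.inr ⟨rfl, rfl⟩)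
  · exact injective_push_of_orthogonal hE h12 p1 p2
  · obtain ⟨S, hS, htr⟩ := exists_isShapeOperator hE (hspace m) h12 p1 p2 c1 c2
    exact ⟨S, hS, htr.trans hκ⟩

include hE in
-- By orthogonality each component of v in the frame is no longer than v, so each contributes at
-- most C times the length of v. The triangle inequality yields the factor 2.
lemma norm_differential_le_of_hasTestFrame (hC : 0 ≤ C) (hf : ContMDiff I 𝓘(ℝ, E3) ∞ f)
    (hN : ContMDiff I 𝓘(ℝ, E3) ∞ N) (hΦ : ContMDiff I 𝓘(ℝ, E') ∞ Φ)
    (hspace : ∀ m, f m ∈ space) (hframe : ∀ m, HasTestFrame I τ H f N Φ C m) (m : M)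
    (v : TangentSpace I m) : ‖differential I Φ m v‖
      ≤ 2 * C * √(metric τ (f m) (push I f m v) (push I f m v)) := by
  obtain ⟨e₁, e₂, κ₁, κ₂, h12, -, h⟩ := (hframe m).exists_tangent
    (hf.mdifferentiable (by simp) m) (hN.mdifferentiable (by simp) m)
    (hΦ.mdifferentiable (by simp) m) (hspace m)
  obtain ⟨p1, -, -, b1⟩ := h e₁ κ₁ (.inl ⟨rfl, rfl⟩)
  obtain ⟨p2, -, -, b2⟩ := h e₂ κ₂ (.inr ⟨rfl, rfl⟩)
  obtain ⟨a, b, rfl⟩ := exists_tangent_coords hE h12 p1 p2 v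
  rw [metric_push_push_of_coords a b h12]
  set g₁ := metric τ (f m) (push I f m e₁) (push I f m e₁)
  set g₂ := metric τ (f m) (push I f m e₂) (push I f m e₂)
  have key : ∀ (t g : ℝ) (w : E'), ‖w‖ ≤ C * √g → t ^ 2 * g ≤ a ^ 2 * g₁ + b ^ 2 * g₂ →
      ‖t • w‖ ≤ C * √(a ^ 2 * g₁ + b ^ 2 * g₂) := by
    intro t g w hw ht
    rw [norm_smul, Real.norm_eq_abs]
    calc |t| * ‖w‖ ≤ |t| * (C * √g) := by gcongr
      _ = C * √(t ^ 2 * g) := by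
        rw [Real.sqrt_mul (sq_nonneg t), Real.sqrt_sq_eq_abs]; ring
      _ ≤ _ := by gcongr
  have i1 := mul_nonneg (sq_nonneg a) p1.le
  have i2 := mul_nonneg (sq_nonneg b) p2.le
  rw [map_add, map_smul, map_smul]
  refine (norm_add_le _ _).trans ?_
  have j1 := key a g₁ _ b1 (by linarith)
  have j2 := key b g₂ _ b2 (by linarith)
  linarith

end Frames

/-- Along any admissible curve, the displacement of Φ is at most the integral of the norm of its
derivative, hence at most C times the length of the curve. -/
lemma edist_le_inducedDist (hC : 0 < C) (hf : ContMDiff I 𝓘(ℝ, E3) ∞ f)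
    (hΦ : ContMDiff I 𝓘(ℝ, E') ∞ Φ)
    (hb : ∀ m (v : TangentSpace I m), ‖differential I Φ m v‖
      ≤ C * √(metric τ (f m) (push I f m v) (push I f m v))) (p q : M) :
    edist (Φ p) (Φ q) ≤ ENNReal.ofReal C * inducedDist I τ f p q := by
  rw [inducedDist, ENNReal.mul_iInf_of_ne (by simpa using hC) ENNReal.ofReal_ne_top]
  refine le_iInf fun c => ?_
  rw [ENNReal.mul_iInf' (by simp) (by simp [hC.not_ge])]
  refine le_iInf fun ⟨hc, h0, h1⟩ => ?_
  have hΦc : ContDiff ℝ 1 (Φ ∘ c) := ((hΦ.of_le (by simp)).comp hc).contDiff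
  rw [← h0, ← h1, edist_comm, edist_eq_enorm_sub, curveLength,
    ← lintegral_const_mul' _ _ ENNReal.ofReal_ne_top]
  refine (enorm_sub_le_lintegral_deriv_of_contDiffOn_Icc hΦc.contDiffOn zero_le_one).trans
    (lintegral_mono fun s => ?_)
  have hcs := hc.mdifferentiable (by simp) s
  rw [(hasDerivAt_comp_differential I (hΦ.mdifferentiable (by simp) (c s)) hcs).deriv,
    (hasDerivAt_comp_differential I (hf.mdifferentiable (by simp) (c s)) hcs).deriv,
    ← ENNReal.ofReal_mul hC.le, ← ofReal_norm]
  exact ENNReal.ofReal_le_ofReal (hb _ _)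

/-- A Cauchy sequence for the induced distance has a Cauchy image under Φ. The limit lies in the
closed range of Φ, and convergence pulls back because Φ is inducing. -/
theorem isCompleteSurface_of_norm_differential_le [CompleteSpace E'] (hC : 0 < C)
    (hf : ContMDiff I 𝓘(ℝ, E3) ∞ f) (hΦ : ContMDiff I 𝓘(ℝ, E') ∞ Φ) (hΦ' : IsClosedEmbedding Φ)
    (hb : ∀ m (v : TangentSpace I m), ‖differential I Φ m v‖
      ≤ C * √(metric τ (f m) (push I f m v) (push I f m v))) : IsCompleteSurface I τ f := by
  intro p hp
  have hcauchy : CauchySeq (Φ ∘ p) := by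
    rw [EMetric.cauchySeq_iff]
    intro ε hε
    obtain ⟨n₀, hn⟩ := hp (ε / ENNReal.ofReal C) (ENNReal.div_pos hε.ne' ENNReal.ofReal_ne_top)
    refine ⟨n₀, fun m hm n hn' => ?_⟩
    refine (edist_le_inducedDist hC hf hΦ hb _ _).trans_lt ?_
    have := hn m hm n hn'
    rwa [ENNReal.lt_div_iff_mul_lt (.inl (by simpa using hC)) (.inl ENNReal.ofReal_ne_top),
      mul_comm] at this
  obtain ⟨x, hx⟩ := cauchySeq_tendsto_of_complete hcauchy
  obtain ⟨q, rfl⟩ := hΦ'.isClosed_range.mem_of_tendsto hx (.of_forall fun n => ⟨p n, rfl⟩)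
  exact ⟨q, hΦ'.isInducing.tendsto_nhds_iff.2 hx⟩

theorem isCompleteSurface_of_hasTestFrame [CompleteSpace E'] (hE : Module.finrank ℝ E = 2)
    (hC : 0 < C) (hf : ContMDiff I 𝓘(ℝ, E3) ∞ f) (hN : ContMDiff I 𝓘(ℝ, E3) ∞ N)
    (hΦ : ContMDiff I 𝓘(ℝ, E') ∞ Φ) (hΦ' : IsClosedEmbedding Φ) (hspace : ∀ m, f m ∈ space)
    (hframe : ∀ m, HasTestFrame I τ H f N Φ C m) : IsCompleteSurface I τ f :=
  isCompleteSurface_of_norm_differential_le (by positivity) hf hΦ hΦ'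
    (norm_differential_le_of_hasTestFrame hE hC.le hf hN hΦ hspace hframe)

end Surfaces

/-! ### Polar components -/

/-- The vector with radial, angular and vertical Euclidean components `a`, `b`, `e` at the angle
`φ`. -/
def polar (φ a b e : ℝ) : E3 :=
  !₂[a * Real.cos φ - b * Real.sin φ, a * Real.sin φ + b * Real.cos φ, e]

@[simp] lemma polar_zero (φ a b e : ℝ) : polar φ a b e 0 = a * Real.cos φ - b * Real.sin φ := rfl
@[simp] lemma polar_one (φ a b e : ℝ) : polar φ a b e 1 = a * Real.sin φ + b * Real.cos φ := rfl
@[simp] lemma polar_two (φ a b e : ℝ) : polar φ a b e 2 = e := rfl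

lemma polar_sq_add_sq (φ r b e : ℝ) : polar φ r b e 0 ^ 2 + polar φ r b e 1 ^ 2 = r ^ 2 + b ^ 2 := by
  simp only [polar_zero, polar_one]
  linear_combination (r ^ 2 + b ^ 2) * Real.sin_sq_add_cos_sq φ

lemma hasDerivAt_E3 {γ : ℝ → E3} {v : E3} {t : ℝ} (h0 : HasDerivAt (fun t => γ t 0) (v 0) t)
    (h1 : HasDerivAt (fun t => γ t 1) (v 1) t) (h2 : HasDerivAt (fun t => γ t 2) (v 2) t) :
    HasDerivAt γ v t := by
  rw [hasDerivAt_iff_hasFDerivAt, ← hasFDerivWithinAt_univ, hasFDerivWithinAt_euclidean]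
  intro i
  rw [hasFDerivWithinAt_univ]
  have h : HasDerivAt (fun t => γ t i) (v i) t := by fin_cases i; exacts [h0, h1, h2]
  exact h.hasFDerivAt.congr_fderiv (by ext; simp)

/-- A single formula serves position and normal, and both frame directions: κ is the angular speed
and σ the speed along the profile. Turning the polar frame adds (−κb, κr) to the radial and angular
components. -/
lemma hasDerivAt_polar {r b e : ℝ → ℝ} {r' b' e' s : ℝ} (hr : HasDerivAt r r' s)
    (hb : HasDerivAt b b' s) (he : HasDerivAt e e' s) (φ κ σ : ℝ) :
    HasDerivAt (fun t : ℝ => polar (φ + κ * t) (r (s + σ * t)) (b (s + σ * t)) (e (s + σ * t)))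
      (polar φ (σ * r' - κ * b s) (σ * b' + κ * r s) (σ * e')) 0 := by
  have hlin : ∀ u v : ℝ, HasDerivAt (fun t : ℝ => u + v * t) v 0 := fun u v => by
    simpa using ((hasDerivAt_id (0 : ℝ)).const_mul v).const_add u
  have comp : ∀ {g : ℝ → ℝ} {g' : ℝ}, HasDerivAt g g' s →
      HasDerivAt (fun t => g (s + σ * t)) (σ * g') 0 := fun {g g'} hg => by
    have := HasDerivAt.comp (0 : ℝ) (h₂ := g) (h₂' := g') (by simpa using hg) (hlin s σ)
    rwa [mul_comm] at this
  have hc : HasDerivAt (fun t => Real.cos (φ + κ * t)) (-Real.sin φ * κ) 0 := by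
    simpa using (hlin φ κ).cos
  have hs : HasDerivAt (fun t => Real.sin (φ + κ * t)) (Real.cos φ * κ) 0 := by
    simpa using (hlin φ κ).sin
  refine hasDerivAt_E3 ?_ ?_ ?_
  · refine (((comp hr).mul hc).sub ((comp hb).mul hs)).congr_deriv ?_
    simp; ring
  · refine (((comp hr).mul hs).add ((comp hb).mul hc)).congr_deriv ?_
    simp; ring
  · exact comp he

lemma lam_polar (φ r t : ℝ) : lam (polar φ r 0 t) = 2 / (1 - r ^ 2) := by
  rw [lam, polar_sq_add_sq]; simp

lemma conn_polar (τ φ r t a b e : ℝ) :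
    conn τ (polar φ r 0 t) (polar φ a b e) = e - 2 * τ * (2 / (1 - r ^ 2)) * r * b := by
  rw [conn, lam_polar]
  simp only [polar_zero, polar_one, polar_two]
  linear_combination -2 * τ * (2 / (1 - r ^ 2)) * r * b * Real.sin_sq_add_cos_sq φ

/-- The angle disappears through sin² + cos² = 1, which is the rotational invariance of the metric.
-/
lemma metric_polar (τ φ r t a b e a' b' e' : ℝ) :
    metric τ (polar φ r 0 t) (polar φ a b e) (polar φ a' b' e')
      = (2 / (1 - r ^ 2)) ^ 2 * (a * a' + b * b')
        + (e - 2 * τ * (2 / (1 - r ^ 2)) * r * b) * (e' - 2 * τ * (2 / (1 - r ^ 2)) * r * b') := by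
  rw [metric, lam_polar, conn_polar, conn_polar]
  simp only [polar_zero, polar_one]
  linear_combination (2 / (1 - r ^ 2)) ^ 2 * (a * a' + b * b') * Real.sin_sq_add_cos_sq φ

lemma dmetric_polar (τ φ r t a b e a' b' e' : ℝ) :
    dmetric τ (polar φ r 0 t) (polar φ a b e) (polar φ a b e) (polar φ a' b' e') / 2
      = (2 / (1 - r ^ 2)) ^ 3 * r * a' * (a ^ 2 + b ^ 2)
        + (e - 2 * τ * (2 / (1 - r ^ 2)) * r * b) *
          (2 * τ * (2 / (1 - r ^ 2)) * (b' * a - a' * b)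
            - 2 * τ * (2 / (1 - r ^ 2)) ^ 2 * r ^ 2 * a' * b) := by
  have e1 : polar φ r 0 t 0 * polar φ a' b' e' 0 + polar φ r 0 t 1 * polar φ a' b' e' 1
      = r * a' := by
    simp only [polar_zero, polar_one]
    linear_combination r * a' * Real.sin_sq_add_cos_sq φ
  have e2 : polar φ a b e 0 * polar φ a b e 0 + polar φ a b e 1 * polar φ a b e 1
      = a ^ 2 + b ^ 2 := by rw [← polar_sq_add_sq φ a b e]; ring
  have e3 : polar φ r 0 t 1 * polar φ a b e 0 - polar φ r 0 t 0 * polar φ a b e 1 = - (r * b) := by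
    simp only [polar_zero, polar_one]
    linear_combination -(r * b) * Real.sin_sq_add_cos_sq φ
  have e4 : polar φ a' b' e' 1 * polar φ a b e 0 - polar φ a' b' e' 0 * polar φ a b e 1
      = b' * a - a' * b := by
    simp only [polar_zero, polar_one]
    linear_combination (b' * a - a' * b) * Real.sin_sq_add_cos_sq φ
  rw [dmetric, dconn, lam_polar, conn_polar, e1, e2, e3, e4]
  ring

/-- Along the profile the conformal factor L is cosh ρ + 1 and S = L r is sinh ρ, so later
computations are rational in these quantities. -/
lemma metric_polar_of_lam {L S r : ℝ} (hL : 2 / (1 - r ^ 2) = L) (hS : L * r = S)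
    (τ φ t a b e a' b' e' : ℝ) :
    metric τ (polar φ r 0 t) (polar φ a b e) (polar φ a' b' e')
      = L ^ 2 * (a * a' + b * b') + (e - 2 * τ * S * b) * (e' - 2 * τ * S * b') := by
  rw [metric_polar, hL, ← hS]; ring

lemma dmetric_polar_of_lam {L S r : ℝ} (hL : 2 / (1 - r ^ 2) = L) (hS : L * r = S)
    (τ φ t a b e a' b' e' : ℝ) :
    dmetric τ (polar φ r 0 t) (polar φ a b e) (polar φ a b e) (polar φ a' b' e') / 2
      = L ^ 2 * S * a' * (a ^ 2 + b ^ 2) + (e - 2 * τ * S * b) *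
          (2 * τ * L * (b' * a - a' * b) - 2 * τ * S ^ 2 * a' * b) := by
  rw [dmetric_polar, hL, ← hS]; ring

/-! ### Algebra of the profile curve -/

section Algebra

variable {τ H x S a c y x' x'' : ℝ}

/-- Throughout this section x, S, a, c, y stand for cosh ρ, sinh ρ, √(1 + 4τ² tanh²(ρ/2)), √(4H² −
1) and 2H cosh ρ + d, while x', x'' are derivatives of x in s. Here S/(x + 1) = tanh(ρ/2) is the
Euclidean radius. -/
lemma two_div_one_sub_sq (hx : 1 < x) (hS : S ^ 2 = x ^ 2 - 1) :
    2 / (1 - (S / (x + 1)) ^ 2) = x + 1 := by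
  have h : 1 - (S / (x + 1)) ^ 2 = 2 / (x + 1) := by
    rw [div_pow, hS]; field_simp; ring
  rw [h]; field_simp

lemma profile_conn_normal (hx : 1 < x) (hS0 : 0 < S) (hS : S ^ 2 = x ^ 2 - 1) (ha0 : 0 < a)
    (ha : a ^ 2 * (x + 1) = x + 1 + 4 * τ ^ 2 * (x - 1)) :
    c * x' * a / S - 2 * τ * S * (2 * τ * c * x' / (a * (x + 1) ^ 2)) = c * x' / (S * a) := by
  have : x + 1 ≠ 0 := by linarith
  field_simp
  grind

lemma profile_conn_tangent (hx : 1 < x) (hS0 : 0 < S) (hS : S ^ 2 = x ^ 2 - 1) (ha0 : 0 < a)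
    (hc0 : 0 < c) (ha : a ^ 2 * (x + 1) = x + 1 + 4 * τ ^ 2 * (x - 1)) :
    y * a / (S * c) - 2 * τ * S * (2 * τ * y / ((x + 1) ^ 2 * a * c)) = y / (S * a * c) := by
  have : x + 1 ≠ 0 := by linarith
  field_simp
  grind

lemma profile_tangent_sq (hx : 1 < x) (hS0 : 0 < S) (hS : S ^ 2 = x ^ 2 - 1) (ha0 : 0 < a)
    (hc0 : 0 < c) (ha : a ^ 2 * (x + 1) = x + 1 + 4 * τ ^ 2 * (x - 1))
    (hx' : c ^ 2 * x' ^ 2 = S ^ 2 - y ^ 2) :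
    (x + 1) ^ 2 * ((x' / ((x + 1) * S)) ^ 2 + (2 * τ * y / ((x + 1) ^ 2 * a * c)) ^ 2)
      + (y / (S * a * c)) ^ 2 = 1 / c ^ 2 := by
  have : x + 1 ≠ 0 := by linarith
  field_simp
  grind

lemma profile_normal_sq (hx : 1 < x) (hS0 : 0 < S) (hS : S ^ 2 = x ^ 2 - 1) (ha0 : 0 < a) (ha : a ^ 2 * (x + 1) = x + 1 + 4 * τ ^ 2 * (x - 1))
    (hx' : c ^ 2 * x' ^ 2 = S ^ 2 - y ^ 2) :
    (x + 1) ^ 2 * ((y / ((x + 1) * S)) ^ 2 + (2 * τ * c * x' / (a * (x + 1) ^ 2)) ^ 2)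
      + (c * x' / (S * a)) ^ 2 = 1 := by
  have : x + 1 ≠ 0 := by linarith
  field_simp
  grind

/-- The left side is the metric pairing of the derivative of the normal with the tangent, plus the
Christoffel term; 1/c² is the squared length of the tangent. The term subtracted from 2H is the
normal curvature of the parallel. The force y has derivative 2H x', and this is how H enters; the
relations for x'², x'', a² and S² then reduce the claim to a rational identity. -/
lemma profile_curvature (hx : 1 < x) (hS0 : 0 < S) (hS : S ^ 2 = x ^ 2 - 1) (ha0 : 0 < a)
    (hc0 : 0 < c) (ha : a ^ 2 * (x + 1) = x + 1 + 4 * τ ^ 2 * (x - 1))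
    (hx' : c ^ 2 * x' ^ 2 = S ^ 2 - y ^ 2) (hx'' : c ^ 2 * x'' = x - 2 * H * y)
    {α β α' β' C' a' va vb w : ℝ}
    (hα : α = -y / ((x + 1) * S)) (hβ : β = 2 * τ * c * x' / (a * (x + 1) ^ 2))
    (hva : va = x' / ((x + 1) * S)) (hvb : vb = 2 * τ * y / ((x + 1) ^ 2 * a * c))
    (hw : w = y / (S * a * c))
    (ha' : a' = 4 * τ ^ 2 * x' / (a * (x + 1) ^ 2))
    (hα' : α' = -(2 * H * x') / ((x + 1) * S) + y * x' / ((x + 1) ^ 2 * S)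
      + y * x * x' / ((x + 1) * S ^ 3))
    (hβ' : β' = 2 * τ * c * (x'' / (a * (x + 1) ^ 2) - x' * a' / (a ^ 2 * (x + 1) ^ 2)
      - 2 * x' ^ 2 / (a * (x + 1) ^ 3)))
    (hC' : C' = c * (x'' * a / S + x' * a' / S - x' * a * x * x' / S ^ 3)) :
    (x + 1) ^ 2 * ((α' - vb * (x + 1) / S * β) * va + (β' + vb * (x + 1) / S * α) * vb)
      + (C' - 2 * τ * S * (β' + vb * (x + 1) / S * α)) * w
      + ((x + 1) ^ 2 * S * α * (va ^ 2 + vb ^ 2)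
        + w * (2 * τ * (x + 1) * (β * va - α * vb) - 2 * τ * S ^ 2 * α * vb))
      = -(2 * H - y * (x + 4 * τ ^ 2 * (x - 1)) / (S ^ 2 * a ^ 2)) * (1 / c ^ 2) := by
  have : x + 1 ≠ 0 := by linarith
  have hx'' : x'' = (x - 2 * H * y) / c ^ 2 := by field_simp; linarith
  subst hα hβ hva hvb hw hα' hβ' hC' ha' hx''
  have e1 : x' ^ 2 = (x ^ 2 - 1 - y ^ 2) / c ^ 2 := by field_simp; linarith
  have e2 : a ^ 2 = (x + 1 + 4 * τ ^ 2 * (x - 1)) / (x + 1) := by field_simp; linarith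
  have e3 : x + 1 + 4 * τ ^ 2 * (x - 1) ≠ 0 := by rw [← ha]; positivity
  field_simp
  simp only [e1, e2, hS]
  field_simp
  ring

end Algebra

/-! ### The profile curve -/

/-- Mean of `cosh ρ₁` and `cosh ρ₂`. -/
def center (H d : ℝ) : ℝ := -(2 * d * H) / (4 * H ^ 2 - 1)

/-- Half the difference of `cosh ρ₂` and `cosh ρ₁`. -/
def radius (H d : ℝ) : ℝ := √(1 - 4 * H ^ 2 + d ^ 2) / (4 * H ^ 2 - 1)

/-- `cosh ρ` along the profile curve; the outermost point has parameter `0`. -/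
def coshP (H d s : ℝ) : ℝ := center H d + radius H d * Real.cos s

/-- `2H cosh ρ + d` along the profile curve. -/
def forceP (H d s : ℝ) : ℝ := 2 * H * coshP H d s + d

/-- `sinh ρ` along the profile curve. -/
def sinhP (H d s : ℝ) : ℝ := √(coshP H d s ^ 2 - 1)

/-- `√(1 + 4τ² tanh² (ρ / 2))` along the profile curve. -/
def twistP (τ H d s : ℝ) : ℝ :=
  √(1 + 4 * τ ^ 2 * ((coshP H d s - 1) / (coshP H d s + 1)))

/-- `√(4H² - 1)`. -/
def rootH (H : ℝ) : ℝ := √(4 * H ^ 2 - 1)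

/-- Euclidean distance from the axis along the profile curve. -/
def radP (H d s : ℝ) : ℝ := sinhP H d s / (coshP H d s + 1)

/-- Derivative of the height along the profile curve. -/
def speedP (τ H d s : ℝ) : ℝ := forceP H d s * twistP τ H d s / (sinhP H d s * rootH H)

/-- Radial component of the normal along the profile curve. -/
def normalR (H d s : ℝ) : ℝ := -forceP H d s / ((coshP H d s + 1) * sinhP H d s)

/-- Angular component of the normal along the profile curve. -/
def normalA (τ H d s : ℝ) : ℝ :=
  2 * τ * rootH H * -(radius H d * Real.sin s) / (twistP τ H d s * (coshP H d s + 1) ^ 2)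

/-- Vertical component of the normal along the profile curve. -/
def normalV (τ H d s : ℝ) : ℝ :=
  rootH H * -(radius H d * Real.sin s) * twistP τ H d s / sinhP H d s

section Profile

variable {τ H d s : ℝ}

lemma four_mul_sq_sub_one_pos (hH : 1 / 2 < H) : 0 < 4 * H ^ 2 - 1 := by nlinarith

lemma rootH_pos (hH : 1 / 2 < H) : 0 < rootH H := Real.sqrt_pos.2 (four_mul_sq_sub_one_pos hH)

lemma rootH_sq (hH : 1 / 2 < H) : rootH H ^ 2 = 4 * H ^ 2 - 1 :=
  Real.sq_sqrt (four_mul_sq_sub_one_pos hH).le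

lemma radius_nonneg (hH : 1 / 2 < H) : 0 ≤ radius H d :=
  div_nonneg (Real.sqrt_nonneg _) (four_mul_sq_sub_one_pos hH).le

lemma sinhP_sq (hx : 1 < coshP H d s) : sinhP H d s ^ 2 = coshP H d s ^ 2 - 1 :=
  Real.sq_sqrt (by nlinarith)

lemma sinhP_pos (hx : 1 < coshP H d s) : 0 < sinhP H d s := Real.sqrt_pos.2 (by nlinarith)

lemma one_le_twist_arg (hx : 1 ≤ coshP H d s) :
    1 ≤ 1 + 4 * τ ^ 2 * ((coshP H d s - 1) / (coshP H d s + 1)) := by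
  have : 0 ≤ (coshP H d s - 1) / (coshP H d s + 1) := div_nonneg (by linarith) (by linarith)
  have : 0 ≤ 4 * τ ^ 2 * ((coshP H d s - 1) / (coshP H d s + 1)) := by positivity
  linarith

lemma one_le_twistP (hx : 1 ≤ coshP H d s) : 1 ≤ twistP τ H d s :=
  Real.one_le_sqrt.2 (one_le_twist_arg hx)

lemma twistP_sq (hx : 1 ≤ coshP H d s) : twistP τ H d s ^ 2 * (coshP H d s + 1)
    = coshP H d s + 1 + 4 * τ ^ 2 * (coshP H d s - 1) := by
  rw [twistP, Real.sq_sqrt (zero_le_one.trans (one_le_twist_arg hx))]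
  have : coshP H d s + 1 ≠ 0 := by linarith
  field_simp

/-- The right side is a quadratic in cosh ρ with roots `center` ± `radius` and leading coefficient
−(4H² − 1). Along the profile it becomes (4H² − 1) `radius`² (1 − cos² s), a perfect square. -/
lemma radicand_coshP (hH : 1 / 2 < H) (hd : 4 * H ^ 2 - 1 ≤ d ^ 2) :
    rootH H ^ 2 * (-(radius H d * Real.sin s)) ^ 2
      = coshP H d s ^ 2 - 1 - forceP H d s ^ 2 := by
  have hm := four_mul_sq_sub_one_pos hH
  have hR : ((4 * H ^ 2 - 1) * radius H d) ^ 2 = 1 - 4 * H ^ 2 + d ^ 2 := by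
    rw [radius, mul_div_cancel₀ _ hm.ne', Real.sq_sqrt (by linarith)]
  have hc : (4 * H ^ 2 - 1) * center H d = -(2 * d * H) := by
    rw [center, mul_div_cancel₀ _ hm.ne']
  rw [rootH_sq hH, forceP, coshP]
  have hs := Real.sin_sq_add_cos_sq s
  apply mul_left_cancel₀ hm.ne'
  linear_combination (Real.sin s ^ 2 + Real.cos s ^ 2) * hR + (2 * (4 * H ^ 2 - 1) * radius H d * Real.cos s
    + (4 * H ^ 2 - 1) * center H d + 2 * d * H) * hc + (1 - 4 * H ^ 2 + d ^ 2) * hs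

lemma radicand_sinhP (hH : 1 / 2 < H) (hd : 4 * H ^ 2 - 1 ≤ d ^ 2) (hx : 1 < coshP H d s) :
    rootH H ^ 2 * (-(radius H d * Real.sin s)) ^ 2 = sinhP H d s ^ 2 - forceP H d s ^ 2 := by
  rw [radicand_coshP hH hd, sinhP_sq hx]

/-- Formally this is the derivative of `radicand_coshP` divided by twice the derivative of cosh ρ.
The direct proof also covers the points where that derivative vanishes. -/
lemma accel_coshP (hH : 1 / 2 < H) :
    rootH H ^ 2 * -(radius H d * Real.cos s) = coshP H d s - 2 * H * forceP H d s := by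
  have hm := four_mul_sq_sub_one_pos hH
  have hc : (4 * H ^ 2 - 1) * center H d = -(2 * d * H) := by
    rw [center, mul_div_cancel₀ _ hm.ne']
  rw [rootH_sq hH, forceP, coshP]
  linear_combination hc

lemma hasDerivAt_coshP : HasDerivAt (coshP H d) (-(radius H d * Real.sin s)) s := by
  refine (((Real.hasDerivAt_cos s).const_mul (radius H d)).const_add (center H d)).congr_deriv ?_
  ring

lemma hasDerivAt_forceP :
    HasDerivAt (forceP H d) (2 * H * -(radius H d * Real.sin s)) s :=
  (hasDerivAt_coshP.const_mul (2 * H)).add_const d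

lemma hasDerivAt_sinhP (hx : 1 < coshP H d s) : HasDerivAt (sinhP H d)
    (coshP H d s * -(radius H d * Real.sin s) / sinhP H d s) s := by
  have := ((hasDerivAt_coshP (H := H) (d := d) (s := s)).pow 2 |>.sub_const 1).sqrt
    (by have : 0 < coshP H d s ^ 2 - 1 := by nlinarith
        exact this.ne')
  refine this.congr_deriv ?_
  have := sinhP_pos hx
  change _ / (2 * sinhP H d s) = _
  field_simp
  norm_num
  ring

lemma hasDerivAt_twistP (hx : 1 < coshP H d s) : HasDerivAt (twistP τ H d)
    (4 * τ ^ 2 * -(radius H d * Real.sin s) / (twistP τ H d s * (coshP H d s + 1) ^ 2)) s := by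
  have h1 : coshP H d s + 1 ≠ 0 := by linarith
  have h := hasDerivAt_coshP (H := H) (d := d) (s := s)
  have := ((((h.sub_const 1).div (h.add_const 1) h1).const_mul (4 * τ ^ 2)).const_add 1).sqrt
    (zero_lt_one.trans_le (one_le_twist_arg hx.le)).ne'
  refine this.congr_deriv ?_
  have := zero_lt_one.trans_le (one_le_twistP (τ := τ) hx.le)
  change _ / (2 * twistP τ H d s) = _
  field_simp
  ring

lemma hasDerivAt_radP (hx : 1 < coshP H d s) : HasDerivAt (radP H d)
    (-(radius H d * Real.sin s) / ((coshP H d s + 1) * sinhP H d s)) s := by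
  have h1 : coshP H d s + 1 ≠ 0 := by linarith
  refine ((hasDerivAt_sinhP hx).div (hasDerivAt_coshP.add_const 1) h1).congr_deriv ?_
  have h2 := sinhP_pos hx
  field_simp
  rw [sinhP_sq hx]
  ring

lemma hasDerivAt_normalR (hx : 1 < coshP H d s) : HasDerivAt (normalR H d)
    (-(2 * H * -(radius H d * Real.sin s)) / ((coshP H d s + 1) * sinhP H d s)
      + forceP H d s * -(radius H d * Real.sin s) / ((coshP H d s + 1) ^ 2 * sinhP H d s)
      + forceP H d s * coshP H d s * -(radius H d * Real.sin s)
        / ((coshP H d s + 1) * sinhP H d s ^ 3)) s := by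
  have h1 : coshP H d s + 1 ≠ 0 := by linarith
  have h2 := sinhP_pos hx
  refine (hasDerivAt_forceP.neg.div ((hasDerivAt_coshP.add_const 1).mul (hasDerivAt_sinhP hx))
    (mul_ne_zero h1 h2.ne')).congr_deriv ?_
  simp only [Pi.mul_apply, Pi.neg_apply]
  field_simp
  ring

lemma hasDerivAt_slantP : HasDerivAt (fun s => -(radius H d * Real.sin s))
    (-(radius H d * Real.cos s)) s := ((Real.hasDerivAt_sin s).const_mul _).neg

lemma hasDerivAt_normalA (hx : 1 < coshP H d s) : HasDerivAt (normalA τ H d)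
    (2 * τ * rootH H * (-(radius H d * Real.cos s) / (twistP τ H d s * (coshP H d s + 1) ^ 2)
      - -(radius H d * Real.sin s) *
        (4 * τ ^ 2 * -(radius H d * Real.sin s) / (twistP τ H d s * (coshP H d s + 1) ^ 2))
        / (twistP τ H d s ^ 2 * (coshP H d s + 1) ^ 2)
      - 2 * (-(radius H d * Real.sin s)) ^ 2 / (twistP τ H d s * (coshP H d s + 1) ^ 3))) s := by
  have h1 : coshP H d s + 1 ≠ 0 := by linarith
  have h2 := zero_lt_one.trans_le (one_le_twistP (τ := τ) hx.le)
  refine ((hasDerivAt_slantP.const_mul (2 * τ * rootH H)).div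
    ((hasDerivAt_twistP hx).mul ((hasDerivAt_coshP.add_const 1).pow 2))
    (mul_ne_zero h2.ne' (pow_ne_zero 2 h1))).congr_deriv ?_
  simp only [Pi.mul_apply, Pi.pow_apply]
  field_simp
  ring

lemma hasDerivAt_normalV (hx : 1 < coshP H d s) : HasDerivAt (normalV τ H d)
    (rootH H * (-(radius H d * Real.cos s) * twistP τ H d s / sinhP H d s
      + -(radius H d * Real.sin s) *
        (4 * τ ^ 2 * -(radius H d * Real.sin s) / (twistP τ H d s * (coshP H d s + 1) ^ 2))
        / sinhP H d s
      - -(radius H d * Real.sin s) * twistP τ H d s * coshP H d s * -(radius H d * Real.sin s)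
        / sinhP H d s ^ 3)) s := by
  have h1 : coshP H d s + 1 ≠ 0 := by linarith
  have h2 := zero_lt_one.trans_le (one_le_twistP (τ := τ) hx.le)
  have h3 := sinhP_pos hx
  refine (((hasDerivAt_slantP.const_mul (rootH H)).mul (hasDerivAt_twistP hx)).div
    (hasDerivAt_sinhP hx) h3.ne').congr_deriv ?_
  simp only [Pi.mul_apply]
  field_simp

/-! ### Test frames along rotational surfaces -/

lemma radP_pos (hx : 1 < coshP H d s) : 0 < radP H d s :=
  div_pos (sinhP_pos hx) (by linarith)

lemma radP_sq (hx : 1 < coshP H d s) : radP H d s ^ 2 = (coshP H d s - 1) / (coshP H d s + 1) := by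
  have h1 : coshP H d s + 1 ≠ 0 := by linarith
  rw [radP, div_pow, sinhP_sq hx]
  field_simp
  ring

lemma two_div_one_sub_radP_sq (hx : 1 < coshP H d s) :
    2 / (1 - radP H d s ^ 2) = coshP H d s + 1 := by
  have hS := sinhP_sq hx
  rw [radP]; exact two_div_one_sub_sq hx hS

lemma coshP_add_one_mul_radP (hx : 1 < coshP H d s) :
    (coshP H d s + 1) * radP H d s = sinhP H d s := by
  have h1 : coshP H d s + 1 ≠ 0 := by linarith
  rw [radP]; field_simp

lemma polar_mem_space (hx : 1 < coshP H d s) (φ t : ℝ) : polar φ (radP H d s) 0 t ∈ space := by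
  change polar φ (radP H d s) 0 t 0 ^ 2 + polar φ (radP H d s) 0 t 1 ^ 2 < 1
  rw [polar_sq_add_sq, radP_sq hx]
  have h1 : 0 < coshP H d s + 1 := by linarith
  rw [zero_pow two_ne_zero, add_zero, div_lt_one h1]
  linarith

lemma metric_normal_normal (hH : 1 / 2 < H) (hd : 4 * H ^ 2 - 1 ≤ d ^ 2) (hx : 1 < coshP H d s)
    (φ t : ℝ) : metric τ (polar φ (radP H d s) 0 t)
      (polar φ (normalR H d s) (normalA τ H d s) (normalV τ H d s))
      (polar φ (normalR H d s) (normalA τ H d s) (normalV τ H d s)) = 1 := by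
  have h1 : coshP H d s + 1 ≠ 0 := by linarith
  have ha := zero_lt_one.trans_le (one_le_twistP (τ := τ) hx.le)
  have key := profile_normal_sq hx (sinhP_pos hx) (sinhP_sq hx) ha (twistP_sq hx.le)
    (radicand_sinhP hH hd hx)
  have hn := profile_conn_normal (c := rootH H) (x' := -(radius H d * Real.sin s)) hx
    (sinhP_pos hx) (sinhP_sq hx) ha (twistP_sq hx.le)
  rw [metric_polar_of_lam (two_div_one_sub_radP_sq hx) (coshP_add_one_mul_radP hx)]
  rw [← hn] at key
  refine Eq.trans ?_ key
  rw [normalR, normalA, normalV]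
  ring

end Profile

section Frame

variable {E : Type*} [NormedAddCommGroup E] [NormedSpace ℝ E]
  {A : Type*} [TopologicalSpace A] {I : ModelWithCorners ℝ E A}
  {M : Type*} [TopologicalSpace M] [ChartedSpace A M]
  {E' : Type*} [NormedAddCommGroup E'] [NormedSpace ℝ E']
  {τ H d s φ C : ℝ} {f N : M → E3} {Φ : M → E'}

/-- The rotation speed along the meridian direction orthogonal to the parallels. -/
def driftP (τ H d s : ℝ) : ℝ :=
  2 * τ * forceP H d s / ((coshP H d s + 1) * twistP τ H d s * sinhP H d s * rootH H)

/-- The parametrization Γ is abstract and the profile formulas are assumed only near s, so that the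
annuli and the sphere away from its poles are treated at once. The bounds compare Φ with the lengths
of the two frame vectors, sinh ρ · `twistP` and 1 / `rootH`. -/
theorem hasTestFrame_of_profile (hH : 1 / 2 < H) (hd : 4 * H ^ 2 - 1 ≤ d ^ 2)
    (hx : 1 < coshP H d s) {U : ℝ → ℝ} (hU : HasDerivAt U (speedP τ H d s) s) (Γ : ℝ → ℝ → M)
    (hΓ : ∀ κ σ, MDifferentiableAt 𝓘(ℝ, ℝ) I (fun t : ℝ => Γ (φ + κ * t) (s + σ * t)) 0)
    (hf : ∀ᶠ s' in 𝓝 s, ∀ φ', f (Γ φ' s') = polar φ' (radP H d s') 0 (U s'))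
    (hN : ∀ᶠ s' in 𝓝 s, ∀ φ', N (Γ φ' s')
      = polar φ' (normalR H d s') (normalA τ H d s') (normalV τ H d s'))
    {Φ' : ℝ → ℝ → E'}
    (hΦ : ∀ κ σ, HasDerivAt (fun t : ℝ => Φ (Γ (φ + κ * t) (s + σ * t))) (Φ' κ σ) 0)
    (hb₁ : ‖Φ' 1 0‖ ≤ C * (sinhP H d s * twistP τ H d s))
    (hb₂ : ‖Φ' (driftP τ H d s) 1‖ ≤ C / rootH H) :
    HasTestFrame I τ H f N Φ C (Γ φ s) := by
  have h1 : coshP H d s + 1 ≠ 0 := by linarith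
  have ha := zero_lt_one.trans_le (one_le_twistP (τ := τ) hx.le)
  have hS := sinhP_pos hx
  have hc := rootH_pos hH
  have htend : ∀ σ : ℝ, Tendsto (fun t : ℝ => s + σ * t) (𝓝 0) (𝓝 s) := fun σ => by
    have : Continuous fun t : ℝ => s + σ * t := by fun_prop
    simpa using this.tendsto 0
  set κ := driftP τ H d s with hκ
  -- The angular component that orthogonality to the parallel forces on the second frame vector;
  -- dividing it by the Euclidean radius gives the angular speed κ.
  set vb := 2 * τ * forceP H d s / ((coshP H d s + 1) ^ 2 * twistP τ H d s * rootH H) with hvb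
  have hκ' : κ = vb * (coshP H d s + 1) / sinhP H d s := by
    rw [hκ, hvb, driftP]; field_simp
  have hf0 := hf.self_of_nhds φ
  have hN0 := hN.self_of_nhds φ
  have hS2 := sinhP_sq hx
  have ha2 := twistP_sq (τ := τ) hx.le
  have hlam := two_div_one_sub_radP_sq hx
  have hr := coshP_add_one_mul_radP hx
  have hx' := radicand_sinhP hH hd hx
  have hα := hasDerivAt_normalR hx
  have hβ := hasDerivAt_normalA (τ := τ) hx
  have hC := hasDerivAt_normalV (τ := τ) hx
  set x' := -(radius H d * Real.sin s) with hx'_def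
  have vel : ∀ κ σ, HasDerivAt (f ∘ fun t : ℝ => Γ (φ + κ * t) (s + σ * t)) _ 0 := fun κ σ =>
    (hasDerivAt_polar (hasDerivAt_radP hx) (hasDerivAt_const s (0 : ℝ)) hU φ κ σ
      ).congr_of_eventuallyEq (((htend σ).eventually hf).mono fun t ht => ht _)
  have velN : ∀ κ σ, HasDerivAt (N ∘ fun t : ℝ => Γ (φ + κ * t) (s + σ * t)) _ 0 := fun κ σ =>
    (hasDerivAt_polar hα hβ hC φ κ σ
      ).congr_of_eventuallyEq (((htend σ).eventually hN).mono fun t ht => ht _)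
  have vel₁ : HasDerivAt (f ∘ fun t : ℝ => Γ (φ + 1 * t) (s + 0 * t))
      (polar φ 0 (radP H d s) 0) 0 := (vel 1 0).congr_deriv (by congr 1 <;> ring)
  have vel₂ : HasDerivAt (f ∘ fun t : ℝ => Γ (φ + κ * t) (s + 1 * t))
      (polar φ (x' / ((coshP H d s + 1) * sinhP H d s)) vb (speedP τ H d s)) 0 := by
    refine (vel κ 1).congr_deriv ?_
    congr 1
    · ring
    · rw [hκ', ← hr]
      have := radP_pos hx
      field_simp
      ring
    · ring
  have hw := profile_conn_tangent (y := forceP H d s) hx hS hS2 ha hc ha2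
  rw [← hvb] at hw
  have hw' : speedP τ H d s - 2 * τ * sinhP H d s * vb
      = forceP H d s / (sinhP H d s * twistP τ H d s * rootH H) := hw
  have hn' : normalV τ H d s - 2 * τ * sinhP H d s * normalA τ H d s
      = rootH H * x' / (sinhP H d s * twistP τ H d s) :=
    profile_conn_normal (c := rootH H) (x' := x') hx hS hS2 ha ha2
  have g1 : metric τ (f (Γ φ s)) (polar φ 0 (radP H d s) 0) (polar φ 0 (radP H d s) 0)
      = (sinhP H d s * twistP τ H d s) ^ 2 := by
    rw [hf0, metric_polar_of_lam hlam hr, ← hr]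
    have := radP_sq hx
    have : twistP τ H d s ^ 2 = 1 + 4 * τ ^ 2 * radP H d s ^ 2 := by
      rw [this]; field_simp; linarith
    rw [mul_pow _ (twistP τ H d s), this]
    ring
  have g2 : metric τ (f (Γ φ s))
      (polar φ (x' / ((coshP H d s + 1) * sinhP H d s)) vb (speedP τ H d s))
      (polar φ (x' / ((coshP H d s + 1) * sinhP H d s)) vb (speedP τ H d s))
      = 1 / rootH H ^ 2 := by
    rw [hf0, metric_polar_of_lam hlam hr, hw', ← profile_tangent_sq hx hS hS2 ha hc ha2 hx', ← hvb]
    ring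
  -- The first curvature is that of the parallel and the second is declared to be its complement to
  -- 2H. The sum is then trivial, and the content moves to the curvature goal for the second curve.
  refine ⟨_, _, _, _, forceP H d s * (coshP H d s + 4 * τ ^ 2 * (coshP H d s - 1))
      / (sinhP H d s ^ 2 * twistP τ H d s ^ 2), 2 * H - forceP H d s *
        (coshP H d s + 4 * τ ^ 2 * (coshP H d s - 1)) / (sinhP H d s ^ 2 * twistP τ H d s ^ 2),
    ⟨hΓ 1 0, by simp, vel₁, ?_, ?_, ⟨_, velN 1 0, ?_⟩, ⟨_, hΦ 1 0, ?_⟩⟩,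
    ⟨hΓ κ 1, by simp, vel₂, ?_, ?_, ⟨_, velN _ 1, ?_⟩, ⟨_, hΦ _ 1, ?_⟩⟩,
    ?_, by ring⟩
  · rw [g1]; positivity
  · rw [hf0, hN0, metric_polar_of_lam hlam hr, hn', normalA, ← hx'_def]
    field_simp
    ring
  · rw [g1, hf0, hN0, metric_polar_of_lam hlam hr, dmetric_polar_of_lam hlam hr, normalR, radP]
    field_simp
    rw [hS2]
    ring
  · rw [g1, Real.sqrt_sq (by positivity)]; exact hb₁
  · rw [g2]; positivity
  · rw [hf0, hN0, metric_polar_of_lam hlam hr, hw']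
    rw [hn', normalA, normalR, ← hx'_def, hvb]
    field_simp
    linear_combination -(forceP H d s * x' * (coshP H d s + 1)) * ha2
      + 4 * forceP H d s * x' * τ ^ 2 * hS2
  · rw [g2, hf0, hN0, metric_polar_of_lam hlam hr, dmetric_polar_of_lam hlam hr, hw', hκ']
    have key := profile_curvature (τ := τ) hx hS hS2 ha hc ha2 hx' (accel_coshP (d := d) (s := s) hH)
      rfl rfl rfl hvb rfl rfl rfl rfl rfl
    rw [normalR, normalA, ← hx'_def]
    linear_combination -key
  · rw [g2, Real.sqrt_div zero_le_one, Real.sqrt_one, Real.sqrt_sq hc.le, mul_one_div]; exact hb₂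
  · rw [hf0, metric_polar_of_lam hlam hr, hw', hvb, ← hr]
    have := radP_pos hx
    field_simp
    ring

end Frame

/-! ### Inner and outer radii -/

section Radii

variable {τ H d s : ℝ}

/-- The denominator 1 − 4H² is negative, so the plus sign in front of the square root gives the
smaller radius. -/
lemma rho₁_eq (hH : 1 / 2 < H) : rho₁ H d = Real.arcosh (center H d - radius H d) := by
  have hm := four_mul_sq_sub_one_pos hH
  have hm' : 1 - 4 * H ^ 2 ≠ 0 := by linarith
  rw [rho₁, center, radius]
  congr 1
  rw [show 1 - 4 * H ^ 2 = -(4 * H ^ 2 - 1) by ring, div_neg]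
  ring_nf

lemma rho₂_eq (hH : 1 / 2 < H) : rho₂ H d = Real.arcosh (center H d + radius H d) := by
  have hm := four_mul_sq_sub_one_pos hH
  have hm' : 1 - 4 * H ^ 2 ≠ 0 := by linarith
  rw [rho₂, center, radius]
  congr 1
  rw [show 1 - 4 * H ^ 2 = -(4 * H ^ 2 - 1) by ring, div_neg]
  ring_nf

lemma four_mul_sq_sub_one_le_sq (hd : d ≤ -√(4 * H ^ 2 - 1)) : 4 * H ^ 2 - 1 ≤ d ^ 2 :=
  (Real.sqrt_le_left (by linarith [Real.sqrt_nonneg (4 * H ^ 2 - 1)])).1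
    (by linarith : √(4 * H ^ 2 - 1) ≤ -d) |>.trans_eq (neg_sq d)

lemma four_mul_sq_sub_one_lt_sq (hd : d < -√(4 * H ^ 2 - 1)) : 4 * H ^ 2 - 1 < d ^ 2 :=
  ((Real.sqrt_lt' (by linarith [Real.sqrt_nonneg (4 * H ^ 2 - 1)])).1
    (by linarith : √(4 * H ^ 2 - 1) < -d)).trans_eq (neg_sq d)

lemma sqrt_lt_two_mul (hH : 1 / 2 < H) : √(4 * H ^ 2 - 1) < 2 * H :=
  (Real.sqrt_lt' (by linarith)).2 (by linarith [sq_nonneg H])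

lemma radius_pos (hH : 1 / 2 < H) (hd : d < -√(4 * H ^ 2 - 1)) : 0 < radius H d :=
  div_pos (Real.sqrt_pos.2 (by linarith [four_mul_sq_sub_one_lt_sq hd]))
    (four_mul_sq_sub_one_pos hH)

/-- After clearing the denominator and squaring, the inequality is (4H² − 1)(d + 2H)² ≥ 0. Equality,
where the profile meets the axis, occurs exactly at d = −2H. -/
lemma one_le_center_sub_radius (hH : 1 / 2 < H) (hd : d ≤ -√(4 * H ^ 2 - 1)) :
    1 ≤ center H d - radius H d := by
  have hm := four_mul_sq_sub_one_pos hH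
  rw [center, radius, ← sub_div, le_div_iff₀ hm, one_mul]
  have h := sqrt_lt_two_mul hH
  have h0 : 4 * H ^ 2 - 1 = √(4 * H ^ 2 - 1) ^ 2 := (Real.sq_sqrt hm.le).symm
  have hs := Real.sqrt_pos.2 hm
  have : √(1 - 4 * H ^ 2 + d ^ 2) ≤ -(2 * d * H) - (4 * H ^ 2 - 1) := by
    refine Real.sqrt_le_iff.2 ⟨?_, ?_⟩
    · nlinarith
    · nlinarith [mul_nonneg hm.le (sq_nonneg (d + 2 * H))]
  linarith

lemma one_lt_center_sub_radius (hH : 1 / 2 < H) (hd : d ≤ -√(4 * H ^ 2 - 1))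
    (hd' : d ≠ -(2 * H)) : 1 < center H d - radius H d := by
  have hm := four_mul_sq_sub_one_pos hH
  rw [center, radius, ← sub_div, lt_div_iff₀ hm, one_mul]
  have h := sqrt_lt_two_mul hH
  have h0 : 4 * H ^ 2 - 1 = √(4 * H ^ 2 - 1) ^ 2 := (Real.sq_sqrt hm.le).symm
  have hs := Real.sqrt_pos.2 hm
  have hne : d + 2 * H ≠ 0 := fun h => hd' (by linarith)
  have : √(1 - 4 * H ^ 2 + d ^ 2) < -(2 * d * H) - (4 * H ^ 2 - 1) := by
    refine (Real.sqrt_lt' ?_).2 ?_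
    · nlinarith
    · nlinarith [mul_pos hm (sq_pos_of_ne_zero hne)]
  linarith

lemma coshP_mem_Icc (hH : 1 / 2 < H) (s : ℝ) :
    coshP H d s ∈ Icc (center H d - radius H d) (center H d + radius H d) := by
  have hR := radius_nonneg (d := d) hH
  constructor <;> rw [coshP] <;> nlinarith [Real.neg_one_le_cos s, Real.cos_le_one s]

lemma one_le_coshP (hH : 1 / 2 < H) (hd : d ≤ -√(4 * H ^ 2 - 1)) (s : ℝ) : 1 ≤ coshP H d s :=
  (one_le_center_sub_radius hH hd).trans (coshP_mem_Icc hH s).1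

lemma one_lt_coshP (hH : 1 / 2 < H) (hd : d ≤ -√(4 * H ^ 2 - 1)) (hd' : d ≠ -(2 * H)) (s : ℝ) :
    1 < coshP H d s :=
  (one_lt_center_sub_radius hH hd hd').trans_le (coshP_mem_Icc hH s).1

lemma rho₁_pos (hH : 1 / 2 < H) (hd : d ≤ -√(4 * H ^ 2 - 1)) (hd' : d ≠ -(2 * H)) :
    0 < rho₁ H d := by
  rw [rho₁_eq hH]; exact Real.arcosh_pos (one_lt_center_sub_radius hH hd hd')

lemma rho₁_lt_rho₂ (hH : 1 / 2 < H) (hd : d < -√(4 * H ^ 2 - 1)) : rho₁ H d < rho₂ H d := by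
  have h1 := one_le_center_sub_radius hH hd.le
  have hR := radius_pos hH hd
  rw [rho₁_eq hH, rho₂_eq hH, Real.arcosh_lt_arcosh] <;> linarith

lemma radius_neg_two_mul : radius H (-(2 * H)) = 1 / (4 * H ^ 2 - 1) := by
  rw [radius, show 1 - 4 * H ^ 2 + (-(2 * H)) ^ 2 = 1 by ring, Real.sqrt_one]

lemma center_neg_two_mul (hH : 1 / 2 < H) :
    center H (-(2 * H)) = 1 + radius H (-(2 * H)) := by
  have hm := four_mul_sq_sub_one_pos hH
  rw [radius_neg_two_mul, center, eq_comm, one_add_div hm.ne']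
  ring_nf

lemma rho₁_neg_two_mul (hH : 1 / 2 < H) : rho₁ H (-(2 * H)) = 0 := by
  rw [rho₁_eq hH, center_neg_two_mul hH, add_sub_cancel_right, Real.arcosh_zero]

lemma center_add_radius_neg_two_mul (hH : 1 / 2 < H) :
    center H (-(2 * H)) + radius H (-(2 * H)) = (4 * H ^ 2 + 1) / (4 * H ^ 2 - 1) := by
  have hm := four_mul_sq_sub_one_pos hH
  rw [radius_neg_two_mul, center]
  field_simp
  ring

lemma rho₂_neg_two_mul (hH : 1 / 2 < H) :
    rho₂ H (-(2 * H)) = Real.arcosh ((4 * H ^ 2 + 1) / (4 * H ^ 2 - 1)) := by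
  rw [rho₂_eq hH, center_add_radius_neg_two_mul hH]

lemma radius_neg_sqrt (hH : 1 / 2 < H) : radius H (-√(4 * H ^ 2 - 1)) = 0 := by
  rw [radius, neg_sq, Real.sq_sqrt (four_mul_sq_sub_one_pos hH).le]
  simp

lemma center_neg_sqrt (hH : 1 / 2 < H) :
    center H (-√(4 * H ^ 2 - 1)) = 2 * H / √(4 * H ^ 2 - 1) := by
  have hm := four_mul_sq_sub_one_pos hH
  have hs := Real.sqrt_pos.2 hm
  rw [center, div_eq_div_iff hm.ne' hs.ne']
  linear_combination 2 * H * Real.sq_sqrt hm.le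

lemma one_lt_two_mul_div_sqrt (hH : 1 / 2 < H) : 1 < 2 * H / √(4 * H ^ 2 - 1) := by
  rw [one_lt_div (Real.sqrt_pos.2 (four_mul_sq_sub_one_pos hH))]
  exact sqrt_lt_two_mul hH

lemma two_mul_div_sqrt_mem_Ioo (hH : 1 / 2 < H) (hd : d < -√(4 * H ^ 2 - 1))
    (hd' : -(2 * H) < d) :
    2 * H / √(4 * H ^ 2 - 1) ∈ Ioo (center H d - radius H d) (center H d + radius H d) := by
  have hm := four_mul_sq_sub_one_pos hH
  have hs := Real.sqrt_pos.2 hm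
  have h0 := Real.sq_sqrt hm.le
  set c := √(4 * H ^ 2 - 1)
  have hc : (4 * H ^ 2 - 1) * (2 * H / c) = 2 * H * c := by
    rw [← h0]; field_simp
  -- Both bounds say that 2H(c + d) is smaller in absolute value than √(d² − c²). After squaring, d²
  -- − c² = −(c + d)(c − d) allows the positive factor −(c + d) to be cancelled.
  have key : |2 * H * (c + d)| < √(1 - 4 * H ^ 2 + d ^ 2) := by
    rw [← Real.sqrt_sq_eq_abs]
    refine Real.sqrt_lt_sqrt (sq_nonneg _) ?_
    have h1 : 0 < -(c + d) := by linarith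
    have h2 : 4 * H ^ 2 * -(c + d) < c - d := by
      have h4 : 4 * H ^ 2 = c ^ 2 + 1 := by linarith
      -- Since (2H − c)(2H + c) = 1, the difference 2H − c is less than 1/(2c).
      have h3 : c ^ 2 * (2 * H - c) < 2 * c := by
        have hH2 : (2 * H) ^ 2 = c ^ 2 + 1 := by linarith
        have h5 : (2 * H - c) * (2 * H + c) = 1 := by linarith
        have h6 : c < 2 * H := by nlinarith
        nlinarith
      rw [h4]
      nlinarith [mul_pos hs hs]
    nlinarith [mul_lt_mul_of_pos_left h2 h1]
  rw [abs_lt] at key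
  rw [center, radius, ← sub_div, ← add_div]
  constructor
  · rw [div_lt_iff₀' hm, hc]; linarith
  · rw [lt_div_iff₀' hm, hc]; linarith

/-! ### Limits of the radii -/

lemma continuous_center : Continuous (center H) := by unfold center; fun_prop

lemma continuous_radius : Continuous (radius H) := by unfold radius; fun_prop

lemma tendsto_arcosh {f : ℝ → ℝ} {l : Filter ℝ} {a : ℝ} (ha : 1 ≤ a) (h : Tendsto f l (𝓝 a))
    (hf : ∀ᶠ x in l, 1 ≤ f x) :
    Tendsto (fun x => Real.arcosh (f x)) l (𝓝 (Real.arcosh a)) :=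
  (Real.continuousOn_arcosh a ha).tendsto.comp (tendsto_nhdsWithin_iff.2 ⟨h, hf⟩)

/-- Continuity of arcosh is available only on [1, ∞), hence the condition that d eventually stays in
the admissible range. A general filter covers both one-sided limits at −2H and the left limit at
−√(4H² − 1). -/
lemma tendsto_rho₁ (hH : 1 / 2 < H) {l : Filter ℝ} {d₀ : ℝ} (hl : l ≤ 𝓝 d₀)
    (hd₀ : d₀ ≤ -√(4 * H ^ 2 - 1)) (h : ∀ᶠ d in l, d ≤ -√(4 * H ^ 2 - 1)) :
    Tendsto (rho₁ H) l (𝓝 (rho₁ H d₀)) := by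
  rw [rho₁_eq hH, funext (f := rho₁ H) fun d => rho₁_eq hH]
  exact tendsto_arcosh (one_le_center_sub_radius hH hd₀)
    (((continuous_center.sub continuous_radius).tendsto d₀).mono_left hl)
    (h.mono fun d hd => one_le_center_sub_radius hH hd)

lemma tendsto_rho₂ (hH : 1 / 2 < H) {l : Filter ℝ} {d₀ : ℝ} (hl : l ≤ 𝓝 d₀)
    (hd₀ : d₀ ≤ -√(4 * H ^ 2 - 1)) (h : ∀ᶠ d in l, d ≤ -√(4 * H ^ 2 - 1)) :
    Tendsto (rho₂ H) l (𝓝 (rho₂ H d₀)) := by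
  have key : ∀ d, d ≤ -√(4 * H ^ 2 - 1) → 1 ≤ center H d + radius H d := fun d hd => by
    linarith [one_le_center_sub_radius hH hd, radius_nonneg (d := d) hH]
  rw [rho₂_eq hH, funext (f := rho₂ H) fun d => rho₂_eq hH]
  exact tendsto_arcosh (key d₀ hd₀)
    (((continuous_center.add continuous_radius).tendsto d₀).mono_left hl) (h.mono key)

/-- Bounding the square root by −d leaves −d(2H − 1)/(4H² − 1), and 2H − 1 cancels. -/
lemma neg_div_le_center_sub_radius (hH : 1 / 2 < H) (hd : d ≤ 0) :
    -d / (2 * H + 1) ≤ center H d - radius H d := by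
  have hm := four_mul_sq_sub_one_pos hH
  rw [center, radius, ← sub_div, div_le_div_iff₀ (by linarith) hm]
  have : √(1 - 4 * H ^ 2 + d ^ 2) ≤ -d := by
    refine Real.sqrt_le_iff.2 ⟨by linarith, by linarith⟩
  nlinarith

lemma tendsto_arcosh_atTop : Tendsto Real.arcosh atTop atTop := by
  refine tendsto_atTop_mono' atTop ?_ Real.tendsto_log_atTop
  filter_upwards [eventually_ge_atTop 1] with x hx
  exact Real.log_le_log (by linarith) (by linarith [Real.sqrt_nonneg (x ^ 2 - 1)])

lemma tendsto_center_sub_radius_atBot (hH : 1 / 2 < H) :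
    Tendsto (fun d => center H d - radius H d) atBot atTop := by
  refine tendsto_atTop_mono' atBot ?_
    (tendsto_neg_atBot_atTop.atTop_div_const (by linarith : 0 < 2 * H + 1))
  filter_upwards [eventually_le_atBot 0] with d hd
  exact neg_div_le_center_sub_radius hH hd

lemma tendsto_rho₁_atBot (hH : 1 / 2 < H) : Tendsto (rho₁ H) atBot atTop := by
  rw [funext (f := rho₁ H) fun d => rho₁_eq hH]
  exact tendsto_arcosh_atTop.comp (tendsto_center_sub_radius_atBot hH)

lemma tendsto_rho₂_atBot (hH : 1 / 2 < H) : Tendsto (rho₂ H) atBot atTop := by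
  rw [funext (f := rho₂ H) fun d => rho₂_eq hH]
  refine tendsto_arcosh_atTop.comp (tendsto_atTop_mono (fun d => ?_)
    (tendsto_center_sub_radius_atBot hH))
  linarith [radius_nonneg (d := d) hH]

end Radii

/-! ### Distance from the axis -/

section Rho

variable {p : E3}

lemma sqrt_mem_Ioo (hp : p ∈ space) : √(p 0 ^ 2 + p 1 ^ 2) ∈ Ioo (-1 : ℝ) 1 :=
  ⟨by linarith [Real.sqrt_nonneg (p 0 ^ 2 + p 1 ^ 2)], (Real.sqrt_lt' one_pos).2 ((one_pow (M := ℝ) 2).symm ▸ hp)⟩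

lemma rho_nonneg (p : E3) : 0 ≤ rho p :=
  mul_nonneg zero_le_two (Real.artanh_nonneg (Real.sqrt_nonneg _))

lemma cosh_rho (hp : p ∈ space) :
    Real.cosh (rho p) = (1 + (p 0 ^ 2 + p 1 ^ 2)) / (1 - (p 0 ^ 2 + p 1 ^ 2)) := by
  have hlt : p 0 ^ 2 + p 1 ^ 2 < 1 := hp
  have h := sqrt_mem_Ioo hp
  rw [rho, Real.cosh_two_mul, Real.cosh_artanh h, Real.sinh_artanh h, div_pow, div_pow,
    Real.sq_sqrt (x := p 0 ^ 2 + p 1 ^ 2) (by positivity), Real.sq_sqrt (by linarith)]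
  ring

lemma sq_add_sq_eq_of_cosh_rho (hp : p ∈ space) :
    p 0 ^ 2 + p 1 ^ 2 = (Real.cosh (rho p) - 1) / (Real.cosh (rho p) + 1) := by
  have hlt : p 0 ^ 2 + p 1 ^ 2 < 1 := hp
  have : 1 - (p 0 ^ 2 + p 1 ^ 2) ≠ 0 := by linarith
  have h : Real.cosh (rho p) + 1 ≠ 0 := by linarith [Real.one_le_cosh (rho p)]
  rw [eq_div_iff h, cosh_rho hp]
  field_simp
  ring

lemma mem_space_of_sq_add_sq {x : ℝ} (hx : 1 ≤ x) (h : p 0 ^ 2 + p 1 ^ 2 = (x - 1) / (x + 1)) :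
    p ∈ space := by
  change p 0 ^ 2 + p 1 ^ 2 < 1
  rw [h, div_lt_one (by linarith)]
  linarith

lemma rho_eq_arcosh {x : ℝ} (hx : 1 ≤ x) (h : p 0 ^ 2 + p 1 ^ 2 = (x - 1) / (x + 1)) :
    rho p = Real.arcosh x := by
  have h1 : x + 1 ≠ 0 := by linarith
  have : Real.cosh (rho p) = x := by
    rw [cosh_rho (mem_space_of_sq_add_sq hx h), h]
    field_simp
    ring
  rw [← this, Real.arcosh_cosh (rho_nonneg p)]

lemma exists_polar_eq (p : E3) : ∃ φ, p = polar φ √(p 0 ^ 2 + p 1 ^ 2) 0 (p 2) := by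
  refine ⟨Complex.arg ⟨p 0, p 1⟩, ?_⟩
  have hn : √(p 0 ^ 2 + p 1 ^ 2) = ‖(⟨p 0, p 1⟩ : ℂ)‖ := by
    rw [Complex.norm_def, Complex.normSq_mk]; congr 1; ring
  have h0 := Complex.norm_mul_cos_arg ⟨p 0, p 1⟩
  have h1 := Complex.norm_mul_sin_arg ⟨p 0, p 1⟩
  ext i
  fin_cases i <;> simp [polar, hn, h0, h1]

end Rho

/-! ### The generating function in terms of the height along the profile -/

section Generating

variable {τ H d s : ℝ} {U : ℝ → ℝ}

/-- The function of `ρ` whose graph is the half profile `-π ≤ s ≤ 0` with height `U`. -/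
def graphOf (H d : ℝ) (U : ℝ → ℝ) (r : ℝ) : ℝ :=
  U (-Real.arccos ((Real.cosh r - center H d) / radius H d))

lemma cosh_mem_of_mem_Icc (hH : 1 / 2 < H) (hd : d ≤ -√(4 * H ^ 2 - 1)) {r : ℝ}
    (hr : r ∈ Icc (rho₁ H d) (rho₂ H d)) :
    Real.cosh r ∈ Icc (center H d - radius H d) (center H d + radius H d) := by
  have h1 := one_le_center_sub_radius hH hd
  have hR := radius_nonneg (d := d) hH
  rw [rho₁_eq hH, rho₂_eq hH] at hr
  have h0 := Real.arcosh_nonneg h1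
  have e1 := Real.cosh_arcosh h1
  have e2 := Real.cosh_arcosh (by linarith : 1 ≤ center H d + radius H d)
  constructor
  · rw [← e1]
    exact Real.cosh_le_cosh.2 (abs_le_abs_of_nonneg h0 hr.1)
  · rw [← e2]
    exact Real.cosh_le_cosh.2 (abs_le_abs_of_nonneg (h0.trans hr.1) hr.2)

lemma cosh_mem_of_mem_Ioo (hH : 1 / 2 < H) (hd : d ≤ -√(4 * H ^ 2 - 1)) {r : ℝ}
    (hr : r ∈ Ioo (rho₁ H d) (rho₂ H d)) :
    Real.cosh r ∈ Ioo (center H d - radius H d) (center H d + radius H d) := by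
  have h1 := one_le_center_sub_radius hH hd
  have hR := radius_nonneg (d := d) hH
  rw [rho₁_eq hH, rho₂_eq hH] at hr
  have h0 := Real.arcosh_nonneg h1
  have e1 := Real.cosh_arcosh h1
  have e2 := Real.cosh_arcosh (by linarith : 1 ≤ center H d + radius H d)
  have hr0 := h0.trans_lt hr.1
  constructor
  · rw [← e1]
    exact Real.cosh_lt_cosh.2 (by rw [abs_of_nonneg h0, abs_of_pos hr0]; exact hr.1)
  · rw [← e2]
    exact Real.cosh_lt_cosh.2 (by rw [abs_of_pos hr0, abs_of_pos (hr0.trans hr.2)]; exact hr.2)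

lemma arcosh_coshP_mem (hH : 1 / 2 < H) (hd : d ≤ -√(4 * H ^ 2 - 1)) (s : ℝ) :
    Real.arcosh (coshP H d s) ∈ Icc (rho₁ H d) (rho₂ H d) := by
  have h1 := one_le_center_sub_radius hH hd
  have h := coshP_mem_Icc (d := d) hH s
  have hR := radius_nonneg (d := d) hH
  rw [rho₁_eq hH, rho₂_eq hH]
  exact ⟨(Real.arcosh_le_arcosh (by linarith) (by linarith [h.1])).2 h.1,
    (Real.arcosh_le_arcosh (by linarith [h.1]) (by linarith)).2 h.2⟩

lemma coshP_arccos (hR : 0 < radius H d) {x : ℝ}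
    (hx : x ∈ Icc (center H d - radius H d) (center H d + radius H d)) :
    coshP H d (Real.arccos ((x - center H d) / radius H d)) = x := by
  rw [coshP, Real.cos_arccos]
  · field_simp; ring
  · rw [le_div_iff₀ hR]; linarith [hx.1]
  · rw [div_le_iff₀ hR]; linarith [hx.2]

lemma coshP_neg : coshP H d (-s) = coshP H d s := by rw [coshP, coshP, Real.cos_neg]

lemma graphOf_arcosh_coshP (hH : 1 / 2 < H) (hd : d < -√(4 * H ^ 2 - 1)) (hs : |s| ≤ Real.pi) :
    graphOf H d U (Real.arcosh (coshP H d s)) = U (-|s|) := by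
  have hR := (radius_pos hH hd).ne'
  rw [graphOf, Real.cosh_arcosh (one_le_coshP hH hd.le s), coshP, add_sub_cancel_left,
    mul_div_cancel_left₀ _ hR, ← Real.cos_abs, Real.arccos_cos (abs_nonneg s) hs]

lemma rho₂_eq_arcosh_coshP (hH : 1 / 2 < H) : rho₂ H d = Real.arcosh (coshP H d 0) := by
  rw [rho₂_eq hH, coshP, Real.cos_zero, mul_one]

lemma rho₁_eq_arcosh_coshP (hH : 1 / 2 < H) : rho₁ H d = Real.arcosh (coshP H d Real.pi) := by
  rw [rho₁_eq hH, coshP, Real.cos_pi]; ring_nf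

lemma graphOf_rho₂ (hH : 1 / 2 < H) (hd : d < -√(4 * H ^ 2 - 1)) :
    graphOf H d U (rho₂ H d) = U 0 := by
  rw [rho₂_eq_arcosh_coshP hH, graphOf_arcosh_coshP hH hd (by simp [Real.pi_pos.le])]; simp

lemma graphOf_rho₁ (hH : 1 / 2 < H) (hd : d < -√(4 * H ^ 2 - 1)) :
    graphOf H d U (rho₁ H d) = U (-Real.pi) := by
  rw [rho₁_eq_arcosh_coshP hH, graphOf_arcosh_coshP hH hd] <;> simp [abs_of_pos Real.pi_pos]

lemma tanh_half_sq {r : ℝ} :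
    Real.tanh (r / 2) ^ 2 = (Real.cosh r - 1) / (Real.cosh r + 1) := by
  have h := Real.cosh_two_mul (r / 2)
  have h2 := Real.cosh_sq (r / 2)
  rw [mul_div_cancel₀ _ two_ne_zero] at h
  rw [Real.tanh_eq_sinh_div_cosh, div_pow, h, h2]
  have : Real.sinh (r / 2) ^ 2 + 1 ≠ 0 := by positivity
  field_simp
  ring

/-- On the half s = −arccos v, with v = cos s, the radius increases with s. The chain rule gives
ds/dρ = sinh ρ / (`radius` · √(1 − v²)), whose denominator is √(radicand) / `rootH`. The derivative
of U is required only in the open interval, so the sphere, degenerate at s = −π, is included. -/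
lemma isGeneratingFunction_graphOf (hH : 1 / 2 < H) (hd : d < -√(4 * H ^ 2 - 1))
    (hU : Continuous U) (hU' : ∀ s ∈ Ioo (-Real.pi) 0, HasDerivAt U (speedP τ H d s) s) :
    IsGeneratingFunction τ H d (graphOf H d U) := by
  have hR := radius_pos hH hd
  refine ⟨Continuous.continuousOn ?_, fun r hr => ?_⟩
  · exact hU.comp ((Real.continuous_arccos.comp
      ((Real.continuous_cosh.sub continuous_const).div_const _)).neg)
  · have hx := cosh_mem_of_mem_Ioo hH hd.le hr
    have h1 := one_le_center_sub_radius hH hd.le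
    have hr0 : 0 < r := by
      have : 0 ≤ rho₁ H d := by rw [rho₁_eq hH]; exact Real.arcosh_nonneg h1
      exact this.trans_lt hr.1
    set v := (Real.cosh r - center H d) / radius H d with hv
    have hv1 : -1 < v := by rw [hv, lt_div_iff₀ hR]; linarith [hx.1]
    have hv2 : v < 1 := by rw [hv, div_lt_iff₀ hR]; linarith [hx.2]
    have hs1 : Real.arccos v < Real.pi :=
      (Real.arccos_le_pi v).lt_of_ne (fun h => hv1.not_ge (Real.arccos_eq_pi.1 h))
    have hs0 : 0 < Real.arccos v := Real.arccos_pos.2 hv2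
    have hcoshP : coshP H d (-Real.arccos v) = Real.cosh r := by
      rw [coshP_neg]; exact coshP_arccos hR ⟨hx.1.le, hx.2.le⟩
    have hU1 := hU' (-Real.arccos v) ⟨by linarith, by linarith⟩
    have hv' : HasDerivAt (fun r => (Real.cosh r - center H d) / radius H d)
        (Real.sinh r / radius H d) r := ((Real.hasDerivAt_cosh r).sub_const _).div_const _
    have hacos := ((Real.hasDerivAt_arccos hv1.ne' hv2.ne).comp r hv').neg
    have := HasDerivAt.comp r (h₂ := U) (h := fun r => -Real.arccos ((Real.cosh r - center H d) /
      radius H d)) hU1 hacos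
    refine this.congr_deriv ?_
    have hx1 : 1 < Real.cosh r := Real.one_lt_cosh.2 hr0.ne'
    have hsinh : sinhP H d (-Real.arccos v) = Real.sinh r := by
      rw [sinhP, hcoshP, ← Real.sinh_sq, Real.sqrt_sq (Real.sinh_pos_iff.2 hr0).le]
    have hsin : Real.sin (-Real.arccos v) = -√(1 - v ^ 2) := by
      rw [Real.sin_neg, Real.sin_arccos]
    have hrad := radicand_coshP (s := -Real.arccos v) hH (four_mul_sq_sub_one_le_sq hd.le)
    rw [hsin, forceP, hcoshP] at hrad
    have hc := rootH_pos hH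
    have hsq : √(radicand H d r) = rootH H * (radius H d * √(1 - v ^ 2)) := by
      rw [radicand, Real.sinh_sq, show Real.cosh r ^ 2 - 1 - (d + 2 * H * Real.cosh r) ^ 2
        = (rootH H * (radius H d * √(1 - v ^ 2))) ^ 2 by linear_combination -hrad]
      exact Real.sqrt_sq (by positivity)
    have hpos : 0 < √(1 - v ^ 2) := Real.sqrt_pos.2 (by nlinarith)
    have hsh := Real.sinh_pos_iff.2 hr0
    rw [slope, hsq, speedP, forceP, twistP, hsinh, hcoshP, tanh_half_sq]
    field_simp

lemma radP_sq_of_one_le (hx : 1 ≤ coshP H d s) :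
    radP H d s ^ 2 = (coshP H d s - 1) / (coshP H d s + 1) := by
  have h1 : coshP H d s + 1 ≠ 0 := by linarith
  rw [radP, div_pow, sinhP, Real.sq_sqrt (by nlinarith)]
  field_simp
  ring

lemma radP_nonneg (hx : 1 ≤ coshP H d s) : 0 ≤ radP H d s :=
  div_nonneg (Real.sqrt_nonneg _) (by linarith)

lemma polar_radP_sq_add_sq (hx : 1 ≤ coshP H d s) (φ t : ℝ) :
    polar φ (radP H d s) 0 t 0 ^ 2 + polar φ (radP H d s) 0 t 1 ^ 2
      = (coshP H d s - 1) / (coshP H d s + 1) := by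
  rw [polar_sq_add_sq, ← radP_sq_of_one_le hx]; ring

lemma rho_polar_radP (hx : 1 ≤ coshP H d s) (φ t : ℝ) :
    rho (polar φ (radP H d s) 0 t) = Real.arcosh (coshP H d s) :=
  rho_eq_arcosh hx (polar_radP_sq_add_sq hx φ t)

/-- The signs of s separate the graph of u from its mirror image. Oddness forces U(0) = 0, which is
the normalization that puts the outer end in the plane t = 0. -/
lemma mem_doubledGraph_iff (hH : 1 / 2 < H) (hd : d < -√(4 * H ^ 2 - 1))
    (hodd : ∀ s, U (-s) = -U s) {p : E3} : p ∈ doubledGraph H d (graphOf H d U) ↔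
      ∃ φ, ∃ s ∈ Icc (-Real.pi) Real.pi, p = polar φ (radP H d s) 0 (U s) := by
  have hU0 : U 0 = 0 := by have := hodd 0; rw [neg_zero] at this; linarith
  simp only [doubledGraph, graphOf_rho₂ hH hd, hU0, sub_zero]
  constructor
  · rintro ⟨hp, hρ, h⟩
    obtain ⟨φ, hφ⟩ := exists_polar_eq p
    have hx := coshP_arccos (radius_pos hH hd) (cosh_mem_of_mem_Icc hH hd.le hρ)
    rw [graphOf] at h
    set θ := Real.arccos ((Real.cosh (rho p) - center H d) / radius H d)
    have hθ0 : 0 ≤ θ := Real.arccos_nonneg _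
    have hθ1 : θ ≤ Real.pi := Real.arccos_le_pi _
    have hr : ∀ s, coshP H d s = Real.cosh (rho p) → √(p 0 ^ 2 + p 1 ^ 2) = radP H d s := by
      intro s hs
      have h1 := one_le_coshP hH hd.le s
      rw [sq_add_sq_eq_of_cosh_rho hp, ← hs, ← radP_sq_of_one_le h1, Real.sqrt_sq (radP_nonneg h1)]
    rcases h with h | h
    · refine ⟨φ, -θ, ⟨by linarith, by linarith⟩, ?_⟩
      rw [← hr (-θ) (coshP_neg.trans hx), ← h]; exact hφ
    · refine ⟨φ, θ, ⟨by linarith, by linarith⟩, ?_⟩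
      rw [← hr θ hx, ← neg_neg (U θ), ← hodd, ← h]; exact hφ
  · rintro ⟨φ, s, hs, rfl⟩
    have h1 := one_le_coshP hH hd.le s
    refine ⟨mem_space_of_sq_add_sq h1 (polar_radP_sq_add_sq h1 φ _), ?_, ?_⟩
    · rw [rho_polar_radP h1]; exact arcosh_coshP_mem hH hd.le s
    · rw [rho_polar_radP h1, graphOf_arcosh_coshP hH hd (abs_le.2 hs), polar_two]
      rcases le_total s 0 with h | h
      · left; rw [abs_of_nonpos h, neg_neg]
      · right; rw [abs_of_nonneg h, hodd, neg_neg]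

end Generating

/-! ### The height along the profile curve -/

section Height

variable {τ H d s : ℝ}

/-- The height along the profile curve. -/
def heightP (τ H d s : ℝ) : ℝ := ∫ t in (0 : ℝ)..s, speedP τ H d t

lemma contDiff_coshP : ContDiff ℝ ∞ (coshP H d) :=
  contDiff_const.add (contDiff_const.mul Real.contDiff_cos)

lemma contDiff_forceP : ContDiff ℝ ∞ (forceP H d) :=
  (contDiff_const.mul contDiff_coshP).add contDiff_const

lemma speedP_neg : speedP τ H d (-s) = speedP τ H d s := by
  simp only [speedP, forceP, twistP, sinhP, coshP_neg]

lemma coshP_add_two_pi : coshP H d (s + 2 * Real.pi) = coshP H d s := by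
  rw [coshP, Real.cos_add_two_pi, coshP]

lemma speedP_add_two_pi : speedP τ H d (s + 2 * Real.pi) = speedP τ H d s := by
  simp only [speedP, forceP, twistP, sinhP, coshP_add_two_pi]

lemma heightP_zero : heightP τ H d 0 = 0 := intervalIntegral.integral_same

lemma heightP_neg (s : ℝ) : heightP τ H d (-s) = -heightP τ H d s := by
  have h := intervalIntegral.integral_comp_neg (a := 0) (b := s) (speedP τ H d)
  simp only [speedP_neg, neg_zero] at h
  rw [heightP, heightP, h, intervalIntegral.integral_symm]

section Smooth

variable (hx : ∀ s, 1 < coshP H d s)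
include hx

lemma contDiff_sinhP : ContDiff ℝ ∞ (sinhP H d) :=
  ((contDiff_coshP.pow 2).sub contDiff_const).sqrt fun s => by
    have : 0 < coshP H d s ^ 2 - 1 := by nlinarith [hx s]
    exact this.ne'

lemma contDiff_coshP_add_one_inv : ContDiff ℝ ∞ fun s => (coshP H d s + 1)⁻¹ :=
  (contDiff_coshP.add contDiff_const).inv fun s => by linarith [hx s]

lemma contDiff_sinhP_inv : ContDiff ℝ ∞ fun s => (sinhP H d s)⁻¹ :=
  (contDiff_sinhP hx).inv fun s => (sinhP_pos (hx s)).ne'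

lemma contDiff_twistP : ContDiff ℝ ∞ (twistP τ H d) := by
  unfold twistP
  simp only [div_eq_mul_inv]
  exact (contDiff_const.add (contDiff_const.mul ((contDiff_coshP.sub contDiff_const).mul
    (contDiff_coshP_add_one_inv hx)))).sqrt
    fun s => (zero_lt_one.trans_le (one_le_twist_arg (hx s).le)).ne'

lemma contDiff_twistP_inv : ContDiff ℝ ∞ fun s => (twistP τ H d s)⁻¹ :=
  (contDiff_twistP hx).inv fun s => (zero_lt_one.trans_le (one_le_twistP (hx s).le)).ne'

lemma contDiff_radP : ContDiff ℝ ∞ (radP H d) := by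
  unfold radP
  simp only [div_eq_mul_inv]
  exact (contDiff_sinhP hx).mul (contDiff_coshP_add_one_inv hx)

lemma contDiff_speedP : ContDiff ℝ ∞ (speedP τ H d) := by
  unfold speedP
  simp only [div_eq_mul_inv, mul_inv]
  exact (contDiff_forceP.mul (contDiff_twistP hx)).mul ((contDiff_sinhP_inv hx).mul contDiff_const)

lemma contDiff_normalR : ContDiff ℝ ∞ (normalR H d) := by
  unfold normalR
  simp only [div_eq_mul_inv, mul_inv]
  exact contDiff_forceP.neg.mul ((contDiff_coshP_add_one_inv hx).mul (contDiff_sinhP_inv hx))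

lemma contDiff_normalA : ContDiff ℝ ∞ (normalA τ H d) := by
  unfold normalA
  simp only [div_eq_mul_inv, mul_inv, ← inv_pow]
  exact (contDiff_const.mul (contDiff_const.mul Real.contDiff_sin).neg).mul
    ((contDiff_twistP_inv hx).mul ((contDiff_coshP_add_one_inv hx).pow 2))

lemma contDiff_normalV : ContDiff ℝ ∞ (normalV τ H d) := by
  unfold normalV
  simp only [div_eq_mul_inv]
  exact ((contDiff_const.mul (contDiff_const.mul Real.contDiff_sin).neg).mul
    (contDiff_twistP hx)).mul (contDiff_sinhP_inv hx)

lemma hasDerivAt_heightP (s : ℝ) : HasDerivAt (heightP τ H d) (speedP τ H d s) s :=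
  intervalIntegral.integral_hasDerivAt_right ((contDiff_speedP hx).continuous.intervalIntegrable _ _)
    (contDiff_speedP hx).continuous.stronglyMeasurable.stronglyMeasurableAtFilter
    (contDiff_speedP hx).continuous.continuousAt

lemma contDiff_heightP : ContDiff ℝ ∞ (heightP τ H d) := by
  rw [contDiff_infty_iff_deriv]
  refine ⟨fun s => (hasDerivAt_heightP hx s).differentiableAt, ?_⟩
  rw [funext fun s => (hasDerivAt_heightP (τ := τ) hx s).deriv]
  exact contDiff_speedP hx

/-- The integral of a periodic function over one period does not depend on the starting point; over
[−π, π] it is twice the height at π by oddness. -/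
lemma heightP_add_two_pi (s : ℝ) :
    heightP τ H d (s + 2 * Real.pi) = heightP τ H d s + 2 * heightP τ H d Real.pi := by
  have hi := fun a b => (contDiff_speedP (τ := τ) hx).continuous.intervalIntegrable (μ := volume) a b
  have h := Function.Periodic.intervalIntegral_add_eq (f := speedP τ H d) (T := 2 * Real.pi)
    (fun s => speedP_add_two_pi) s (-Real.pi)
  have h1 := intervalIntegral.integral_add_adjacent_intervals (hi 0 s) (hi s (s + 2 * Real.pi))
  have h2 := intervalIntegral.integral_add_adjacent_intervals (hi 0 (-Real.pi))
    (hi (-Real.pi) (-Real.pi + 2 * Real.pi))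
  have h3 := heightP_neg (τ := τ) (H := H) (d := d) Real.pi
  rw [show -Real.pi + 2 * Real.pi = Real.pi by ring] at h h2
  simp only [heightP] at *
  linarith

lemma heightP_add_int_mul (s : ℝ) (k : ℤ) :
    heightP τ H d (s + k * (2 * Real.pi)) = heightP τ H d s + k * (2 * heightP τ H d Real.pi) := by
  induction k using Int.induction_on with
  | zero => simp
  | succ k ih =>
    have := heightP_add_two_pi (τ := τ) hx (s + k * (2 * Real.pi))
    push_cast at ih ⊢
    rw [show s + ((k : ℝ) + 1) * (2 * Real.pi) = s + k * (2 * Real.pi) + 2 * Real.pi by ring, this,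
      ih]
    ring
  | pred k ih =>
    have := heightP_add_two_pi (τ := τ) hx (s + (-k - 1) * (2 * Real.pi))
    push_cast at ih ⊢
    rw [show s + (-(k : ℝ) - 1) * (2 * Real.pi) + 2 * Real.pi = s + -k * (2 * Real.pi) by ring,
      ih] at this
    linarith

end Smooth

/-! ### Positivity of the vertical period -/

lemma exists_lt_of_hasDerivAt_pos {f : ℝ → ℝ} {f' x b : ℝ} (hf : HasDerivAt f f' x) (h : 0 < f')
    (hb : x < b) : ∃ y ∈ Ioo x b, f x < f y := by
  have h1 := ((hasDerivAt_iff_tendsto_slope.1 hf).mono_left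
    (nhdsWithin_mono x (show Ioi x ⊆ {x}ᶜ from fun y (hy : x < y) => hy.ne'))).eventually (lt_mem_nhds h)
  obtain ⟨y, hy, hy'⟩ := (h1.and (Ioo_mem_nhdsGT hb)).exists
  exact ⟨y, hy', (slope_pos_iff_of_le hy'.1.le).1 hy⟩

lemma exists_lt_of_hasDerivAt_neg {f : ℝ → ℝ} {f' x a : ℝ} (hf : HasDerivAt f f' x) (h : f' < 0)
    (ha : a < x) : ∃ y ∈ Ioo a x, f x < f y := by
  have hf' : HasDerivAt (fun y => f (-y)) (-f') (-x) := by
    have := HasDerivAt.scomp (-x) (h := fun y : ℝ => -y) (g₁ := f) (g₁' := f')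
      (by simpa using hf) (hasDerivAt_neg (-x))
    simpa [Function.comp_def] using this
  obtain ⟨y, hy, hlt⟩ := exists_lt_of_hasDerivAt_pos hf' (neg_pos.2 h) (neg_lt_neg ha)
  exact ⟨-y, ⟨by linarith [hy.2], by linarith [hy.1]⟩, by simpa using hlt⟩

lemma forceP_zero_pos (hH : 1 / 2 < H) (hd : d ≤ -√(4 * H ^ 2 - 1)) : 0 < forceP H d 0 := by
  have hm := four_mul_sq_sub_one_pos hH
  have hs := Real.sqrt_pos.2 hm
  have hR := radius_nonneg (d := d) hH
  have e : forceP H d 0 = -d / (4 * H ^ 2 - 1) + 2 * H * radius H d := by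
    rw [forceP, coshP, center, Real.cos_zero]
    have := hm.ne'
    rw [mul_one, mul_add, add_right_comm]
    congr 1
    rw [mul_div_assoc', div_add' _ _ _ this]
    ring
  have : 0 < -d / (4 * H ^ 2 - 1) := div_pos (by linarith) hm
  rw [e]
  positivity

/-- The period is positive: `2H u' = (4H² - 1) (x' w)' + (x w + q w')` with nonnegative last term,
where `w = √(1 + 4τ² tanh²(ρ/2)) / sinh ρ`. -/
lemma heightP_pi_pos (hH : 1 / 2 < H) (hd : d ≤ -√(4 * H ^ 2 - 1)) (hx : ∀ s, 1 < coshP H d s) :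
    0 < heightP τ H d Real.pi := by
  have hc := rootH_pos hH
  -- `normalV` contains the factor sin s, so it contributes nothing to the increment over [0, π].
  -- Adding it turns the sign-changing derivative of the height into a sum of nonnegative terms.
  have hderiv : ∀ s, HasDerivAt
      (fun s => 2 * H * rootH H * heightP τ H d s + rootH H * normalV τ H d s)
      (rootH H ^ 2 * (-(radius H d * Real.sin s)) ^ 2 *
        (4 * τ ^ 2 / (twistP τ H d s * (coshP H d s + 1) ^ 2 * sinhP H d s))
        + twistP τ H d s * coshP H d s * forceP H d s ^ 2 / sinhP H d s ^ 3) s := by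
    intro s
    refine (((hasDerivAt_heightP hx s).const_mul _).add
      ((hasDerivAt_normalV (hx s)).const_mul _)).congr_deriv ?_
    have h1 := accel_coshP (d := d) (s := s) hH
    have h2 := radicand_sinhP (s := s) hH (four_mul_sq_sub_one_le_sq hd) (hx s)
    have hS := sinhP_pos (hx s)
    have ha := zero_lt_one.trans_le (one_le_twistP (τ := τ) (hx s).le)
    have h3 : coshP H d s + 1 ≠ 0 := by linarith [hx s]
    set x' := -(radius H d * Real.sin s)
    have e1 : -(radius H d * Real.cos s)
        = (coshP H d s - 2 * H * forceP H d s) / rootH H ^ 2 := by field_simp; linarith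
    have e2 : forceP H d s ^ 2 = sinhP H d s ^ 2 - rootH H ^ 2 * x' ^ 2 := by linarith
    rw [e1, speedP, e2]
    field_simp
    ring
  have hnn : ∀ s, 0 ≤ rootH H ^ 2 * (-(radius H d * Real.sin s)) ^ 2 *
        (4 * τ ^ 2 / (twistP τ H d s * (coshP H d s + 1) ^ 2 * sinhP H d s))
        + twistP τ H d s * coshP H d s * forceP H d s ^ 2 / sinhP H d s ^ 3 := by
    intro s
    have hS := sinhP_pos (hx s)
    have ha := zero_lt_one.trans_le (one_le_twistP (τ := τ) (hx s).le)
    have hx0 : 0 < coshP H d s := by linarith [hx s]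
    positivity
  have hmono : Monotone fun s => 2 * H * rootH H * heightP τ H d s + rootH H * normalV τ H d s :=
    monotone_of_hasDerivAt_nonneg hderiv hnn
  have h0 := hderiv 0
  -- At s = 0 the first summand vanishes with sin 0. The second is positive because the force is
  -- positive at the outermost point, and this makes the increment strict.
  have hpos : 0 < rootH H ^ 2 * (-(radius H d * Real.sin 0)) ^ 2 *
        (4 * τ ^ 2 / (twistP τ H d 0 * (coshP H d 0 + 1) ^ 2 * sinhP H d 0))
        + twistP τ H d 0 * coshP H d 0 * forceP H d 0 ^ 2 / sinhP H d 0 ^ 3 := by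
    have hS := sinhP_pos (hx 0)
    have ha := zero_lt_one.trans_le (one_le_twistP (τ := τ) (hx 0).le)
    have hx0 : 0 < coshP H d 0 := by linarith [hx 0]
    have := forceP_zero_pos hH hd
    rw [Real.sin_zero]
    positivity
  obtain ⟨ε, hε, hlt⟩ : ∃ ε ∈ Ioo 0 Real.pi, 2 * H * rootH H * heightP τ H d 0
      + rootH H * normalV τ H d 0 < 2 * H * rootH H * heightP τ H d ε
        + rootH H * normalV τ H d ε :=
    exists_lt_of_hasDerivAt_pos h0 hpos Real.pi_pos
  have h2 := hlt.trans_le (hmono hε.2.le)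
  simp only [heightP_zero, normalV, Real.sin_zero, Real.sin_pi, mul_zero, neg_zero, zero_mul,
    zero_div, add_zero] at h2
  have : 0 < 2 * H * rootH H := by positivity
  exact pos_of_mul_pos_right h2 this.le

end Height

/-! ### The rotational annuli -/

section AnnulusMaps

variable {τ H d s : ℝ}

/-- The rotationally invariant map with polar components `a`, `b`, `e` along the meridian. -/
def annulusField (a b e : ℝ → ℝ) (m : Annulus) : E3 :=
  !₂[a m.2 * (m.1 : ℂ).re - b m.2 * (m.1 : ℂ).im, a m.2 * (m.1 : ℂ).im + b m.2 * (m.1 : ℂ).re, e m.2]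

/-- The inclusion of the annulus in `ℂ × ℝ`. -/
def annulusIncl (m : Annulus) : ℂ × ℝ := (m.1, m.2)

lemma annulusField_exp (a b e : ℝ → ℝ) (φ s : ℝ) :
    annulusField a b e (Circle.exp φ, s) = polar φ (a s) (b s) (e s) := by
  simp only [annulusField, polar, Circle.coe_exp, Complex.exp_ofReal_mul_I_re,
    Complex.exp_ofReal_mul_I_im]

lemma exists_annulus_eq (m : Annulus) : ∃ φ s, m = (Circle.exp φ, s) :=
  ⟨Complex.arg m.1, m.2, by rw [Circle.exp_arg]⟩

lemma contMDiff_annulusIncl : ContMDiff annulusModel 𝓘(ℝ, ℂ × ℝ) ∞ annulusIncl := by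
  have := finrank_real_complex_fact'
  have h : ContMDiff (𝓡 1) 𝓘(ℝ, ℂ) ∞ (fun z : Circle => (z : ℂ)) := contMDiff_coe_sphere
  exact (h.comp contMDiff_fst).prodMk_space contMDiff_snd

lemma contMDiff_annulusField {a b e : ℝ → ℝ} (ha : ContDiff ℝ ∞ a) (hb : ContDiff ℝ ∞ b)
    (he : ContDiff ℝ ∞ e) : ContMDiff annulusModel 𝓘(ℝ, E3) ∞ (annulusField a b e) := by
  have hG : ContDiff ℝ ∞ (fun p : ℂ × ℝ => (!₂[a p.2 * p.1.re - b p.2 * p.1.im,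
      a p.2 * p.1.im + b p.2 * p.1.re, e p.2] : E3)) := by
    have hre : ContDiff ℝ ∞ fun p : ℂ × ℝ => p.1.re := Complex.reCLM.contDiff.comp contDiff_fst
    have him : ContDiff ℝ ∞ fun p : ℂ × ℝ => p.1.im := Complex.imCLM.contDiff.comp contDiff_fst
    have ha' := ha.comp (contDiff_snd (E := ℂ) (F := ℝ))
    have hb' := hb.comp (contDiff_snd (E := ℂ) (F := ℝ))
    have he' := he.comp (contDiff_snd (E := ℂ) (F := ℝ))
    rw [contDiff_euclidean]
    intro i
    fin_cases i
    exacts [(ha'.mul hre).sub (hb'.mul him), (ha'.mul him).add (hb'.mul hre), he']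
  exact hG.contMDiff.comp contMDiff_annulusIncl

lemma isClosedEmbedding_annulusIncl : IsClosedEmbedding annulusIncl := by
  have h : IsClosedEmbedding (fun z : Circle => (z : ℂ)) :=
    Continuous.isClosedEmbedding (by fun_prop) Circle.coe_injective
  exact h.prodMap IsClosedEmbedding.id

lemma mdifferentiableAt_annulus_curve (φ κ s σ : ℝ) : MDifferentiableAt 𝓘(ℝ, ℝ) annulusModel
    (fun t : ℝ => ((Circle.exp (φ + κ * t), s + σ * t) : Annulus)) 0 := by
  have h1 : ContMDiff 𝓘(ℝ, ℝ) 𝓘(ℝ, ℝ) ∞ fun t : ℝ => φ + κ * t :=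
    (contDiff_const.add (contDiff_const.mul contDiff_id)).contMDiff
  have h2 : ContMDiff 𝓘(ℝ, ℝ) 𝓘(ℝ, ℝ) ∞ fun t : ℝ => s + σ * t :=
    (contDiff_const.add (contDiff_const.mul contDiff_id)).contMDiff
  exact ((contMDiff_circleExp.comp h1).prodMk h2).mdifferentiable (by simp) 0

lemma hasDerivAt_annulusIncl_curve (φ κ s σ : ℝ) :
    HasDerivAt (fun t : ℝ => annulusIncl (Circle.exp (φ + κ * t), s + σ * t))
      (Complex.exp (φ * Complex.I) * (κ * Complex.I), σ) 0 := by
  have hlin : ∀ u v : ℝ, HasDerivAt (fun t : ℝ => u + v * t) v 0 := fun u v => by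
    simpa using ((hasDerivAt_id (0 : ℝ)).const_mul v).const_add u
  have h1 := ((hlin φ κ).ofReal_comp.mul_const Complex.I).cexp
  simp only [mul_zero, add_zero] at h1
  refine HasDerivAt.prodMk ?_ (hlin s σ)
  simpa only [Circle.coe_exp] using h1

/-- The rotational annulus with profile `coshP`, `heightP`. -/
def annulusMap (τ H d : ℝ) : Annulus → E3 := annulusField (radP H d) (fun _ => 0) (heightP τ H d)

/-- The unit normal of `annulusMap`. -/
def annulusNormal (τ H d : ℝ) : Annulus → E3 :=
  annulusField (normalR H d) (normalA τ H d) (normalV τ H d)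

lemma annulusMap_exp (φ s : ℝ) :
    annulusMap τ H d (Circle.exp φ, s) = polar φ (radP H d s) 0 (heightP τ H d s) :=
  annulusField_exp _ _ _ φ s

lemma annulusNormal_exp (φ s : ℝ) : annulusNormal τ H d (Circle.exp φ, s)
    = polar φ (normalR H d s) (normalA τ H d s) (normalV τ H d s) :=
  annulusField_exp _ _ _ φ s

/-- By `radicand_sinhP`, sinh² ρ minus the squared force is a product of squares. -/
lemma abs_forceP_le (hH : 1 / 2 < H) (hd : d ≤ -√(4 * H ^ 2 - 1)) (hx : 1 < coshP H d s) :
    |forceP H d s| ≤ sinhP H d s := by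
  refine abs_le_of_sq_le_sq ?_ (sinhP_pos hx).le
  have := radicand_sinhP hH (four_mul_sq_sub_one_le_sq hd) hx
  have : 0 ≤ rootH H ^ 2 * (-(radius H d * Real.sin s)) ^ 2 := by positivity
  linarith

lemma abs_driftP_le (hH : 1 / 2 < H) (hd : d ≤ -√(4 * H ^ 2 - 1)) (hx : 1 < coshP H d s) :
    |driftP τ H d s| ≤ 2 * |τ| / ((coshP H d s + 1) * twistP τ H d s * rootH H) := by
  have hS := sinhP_pos hx
  have ha := zero_lt_one.trans_le (one_le_twistP (τ := τ) hx.le)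
  have hc := rootH_pos hH
  have hx1 : 0 < coshP H d s + 1 := by linarith
  rw [driftP, abs_div, abs_mul, abs_mul, abs_two, abs_of_pos
    (by positivity : 0 < (coshP H d s + 1) * twistP τ H d s * sinhP H d s * rootH H),
    div_le_div_iff₀ (by positivity) (by positivity)]
  have := abs_forceP_le hH hd hx
  have h2 : 0 ≤ 2 * |τ| * ((coshP H d s + 1) * twistP τ H d s * rootH H) := by positivity
  nlinarith [mul_le_mul_of_nonneg_left this h2]

lemma abs_driftP_le' (hH : 1 / 2 < H) (hd : d ≤ -√(4 * H ^ 2 - 1)) (hx : 1 < coshP H d s) :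
    |driftP τ H d s| ≤ |τ| / rootH H := by
  refine (abs_driftP_le hH hd hx).trans ?_
  have ha := one_le_twistP (τ := τ) hx.le
  have hc := rootH_pos hH
  have h : 2 ≤ (coshP H d s + 1) * twistP τ H d s := by nlinarith
  rw [div_le_div_iff₀ (by positivity) hc]
  have : 0 ≤ |τ| * rootH H := by positivity
  nlinarith [mul_le_mul_of_nonneg_left h this]

lemma finrank_annulus : Module.finrank ℝ (EuclideanSpace ℝ (Fin 1) × ℝ) = 2 := by simp

section

variable (hH : 1 / 2 < H) (hd : d ≤ -√(4 * H ^ 2 - 1)) (hd' : d ≠ -(2 * H))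
include hH hd hd'

lemma annulusMap_mem_space (m : Annulus) : annulusMap τ H d m ∈ space := by
  obtain ⟨φ, s, rfl⟩ := exists_annulus_eq m
  rw [annulusMap_exp]
  exact polar_mem_space (one_lt_coshP hH hd hd' s) φ _

lemma metric_annulusNormal (m : Annulus) : metric τ (annulusMap τ H d m)
    (annulusNormal τ H d m) (annulusNormal τ H d m) = 1 := by
  obtain ⟨φ, s, rfl⟩ := exists_annulus_eq m
  rw [annulusMap_exp, annulusNormal_exp]
  exact metric_normal_normal hH (four_mul_sq_sub_one_le_sq hd) (one_lt_coshP hH hd hd' s) φ _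

lemma contMDiff_annulusMap : ContMDiff annulusModel 𝓘(ℝ, E3) ∞ (annulusMap τ H d) :=
  contMDiff_annulusField (contDiff_radP (one_lt_coshP hH hd hd')) contDiff_const
    (contDiff_heightP (one_lt_coshP hH hd hd'))

lemma contMDiff_annulusNormal : ContMDiff annulusModel 𝓘(ℝ, E3) ∞ (annulusNormal τ H d) :=
  contMDiff_annulusField (contDiff_normalR (one_lt_coshP hH hd hd'))
    (contDiff_normalA (one_lt_coshP hH hd hd')) (contDiff_normalV (one_lt_coshP hH hd hd'))

lemma exists_hasTestFrame_annulus : ∃ C, 0 < C ∧ ∀ m, HasTestFrame annulusModel τ H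
    (annulusMap τ H d) (annulusNormal τ H d) annulusIncl C m := by
  have hx := one_lt_coshP hH hd hd'
  have hc := rootH_pos hH
  have h1 := one_lt_center_sub_radius hH hd hd'
  have hm : 0 < √((center H d - radius H d) ^ 2 - 1) := Real.sqrt_pos.2 (by nlinarith)
  -- The first summand serves the parallels, since sinh ρ is at least sinh ρ₁. After division by
  -- `rootH`, the other two dominate the drift and the unit speed in s.
  refine ⟨1 / √((center H d - radius H d) ^ 2 - 1) + |τ| + rootH H, by positivity, fun m => ?_⟩
  obtain ⟨φ, s, rfl⟩ := exists_annulus_eq m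
  refine hasTestFrame_of_profile hH (four_mul_sq_sub_one_le_sq hd) (hx s)
    (hasDerivAt_heightP hx s) (fun φ s => ((Circle.exp φ, s) : Annulus))
    (fun κ σ => mdifferentiableAt_annulus_curve φ κ s σ)
    (.of_forall fun s' φ' => annulusMap_exp φ' s')
    (.of_forall fun s' φ' => annulusNormal_exp φ' s')
    (fun κ σ => hasDerivAt_annulusIncl_curve φ κ s σ) ?_ ?_
  · have hS : √((center H d - radius H d) ^ 2 - 1) ≤ sinhP H d s :=
      Real.sqrt_le_sqrt (by nlinarith [(coshP_mem_Icc (d := d) hH s).1])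
    have ha := one_le_twistP (τ := τ) (hx s).le
    have : 1 ≤ 1 / √((center H d - radius H d) ^ 2 - 1) * (sinhP H d s * twistP τ H d s) := by
      rw [div_mul_eq_mul_div, one_mul, one_le_div hm]
      nlinarith
    have h3 : 0 ≤ (|τ| + rootH H) * (sinhP H d s * twistP τ H d s) := by
      have := sinhP_pos (hx s)
      positivity
    rw [Prod.norm_mk, norm_mul, Complex.norm_exp_ofReal_mul_I, one_mul, norm_mul, Complex.norm_I,
      mul_one, Complex.norm_real, norm_one, norm_zero, max_eq_left zero_le_one]
    linarith
  · have h2 := abs_driftP_le' (τ := τ) hH hd (hx s)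
    rw [Prod.norm_mk, norm_mul, Complex.norm_exp_ofReal_mul_I, one_mul, norm_mul, Complex.norm_I,
      mul_one, Complex.norm_real, norm_one, Real.norm_eq_abs]
    refine max_le (h2.trans ?_) ?_
    · gcongr
      have : 0 < 1 / √((center H d - radius H d) ^ 2 - 1) := by positivity
      linarith
    · rw [one_le_div hc]
      have : 0 < 1 / √((center H d - radius H d) ^ 2 - 1) := by positivity
      linarith [abs_nonneg τ]

lemma isUnitNormal_annulusNormal :
    IsUnitNormal annulusModel τ (annulusMap τ H d) (annulusNormal τ H d) := by
  obtain ⟨C, hC, h⟩ := exists_hasTestFrame_annulus (τ := τ) hH hd hd'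
  exact isUnitNormal_of_hasTestFrame finrank_annulus (contMDiff_annulusMap hH hd hd')
    (contMDiff_annulusNormal hH hd hd') contMDiff_annulusIncl (annulusMap_mem_space hH hd hd')
    (metric_annulusNormal hH hd hd') h

theorem isCompleteRotationalHSurface_annulusMap :
    IsCompleteRotationalHSurface annulusModel τ H (annulusMap τ H d) := by
  obtain ⟨C, hC, h⟩ := exists_hasTestFrame_annulus (τ := τ) hH hd hd'
  refine ⟨?_, ?_, fun α => ⟨(Homeomorph.mulLeft (Circle.exp α)).prodCongr (.refl ℝ), fun m => ?_⟩⟩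
  · exact isHSurface_of_hasTestFrame finrank_annulus (contMDiff_annulusMap hH hd hd')
      (contMDiff_annulusNormal hH hd hd') contMDiff_annulusIncl (annulusMap_mem_space hH hd hd')
      (metric_annulusNormal hH hd hd') h
  · exact isCompleteSurface_of_hasTestFrame finrank_annulus hC (contMDiff_annulusMap hH hd hd')
      (contMDiff_annulusNormal hH hd hd') contMDiff_annulusIncl isClosedEmbedding_annulusIncl
      (annulusMap_mem_space hH hd hd') h
  · obtain ⟨φ, s, rfl⟩ := exists_annulus_eq m
    have : ((Homeomorph.mulLeft (Circle.exp α)).prodCongr (.refl ℝ)) (Circle.exp φ, s)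
        = ((Circle.exp (α + φ), s) : Annulus) := by
      rw [Circle.exp_add]; rfl
    rw [this, annulusMap_exp, annulusMap_exp, rot, polar]
    simp only [polar_zero, polar_one, polar_two, Real.cos_add, Real.sin_add]
    ext i
    fin_cases i <;> simp <;> ring

lemma range_annulusMap_subset :
    Set.range (annulusMap τ H d) ⊆ regionBetween (rho₁ H d) (rho₂ H d) := by
  rintro _ ⟨m, rfl⟩
  refine ⟨annulusMap_mem_space hH hd hd' m, ?_⟩
  obtain ⟨φ, s, rfl⟩ := exists_annulus_eq m
  rw [annulusMap_exp, rho_polar_radP (one_lt_coshP hH hd hd' s).le]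
  exact arcosh_coshP_mem hH hd s

end

/-! ### Image and periodicity of the annuli -/

lemma radP_add_int_mul (s : ℝ) (k : ℤ) : radP H d (s + k * (2 * Real.pi)) = radP H d s := by
  simp only [radP, sinhP, coshP, Real.cos_add_int_mul_two_pi]

lemma vert_polar (c φ a b e : ℝ) : vert c (polar φ a b e) = polar φ a b (e + c) := by
  ext i
  fin_cases i <;> simp [vert, polar]

lemma vert_neg_vert (c : ℝ) (p : E3) : vert (-c) (vert c p) = p := by
  ext i
  fin_cases i <;> simp [vert]

section

variable (hH : 1 / 2 < H) (hd : d < -√(4 * H ^ 2 - 1)) (hd' : d ≠ -(2 * H))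
include hH hd

lemma period_graphOf_heightP :
    period H d (graphOf H d (heightP τ H d)) = 2 * heightP τ H d Real.pi := by
  rw [period, graphOf_rho₂ hH hd, graphOf_rho₁ hH hd, heightP_zero, heightP_neg]
  ring

include hd'

lemma isGeneratingFunction_heightP :
    IsGeneratingFunction τ H d (graphOf H d (heightP τ H d)) := by
  have hx := one_lt_coshP hH hd.le hd'
  exact isGeneratingFunction_graphOf hH hd (contDiff_heightP hx).continuous
    fun s _ => hasDerivAt_heightP hx s

lemma period_heightP_pos : 0 < period H d (graphOf H d (heightP τ H d)) := by
  rw [period_graphOf_heightP hH hd]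
  exact mul_pos two_pos (heightP_pi_pos hH hd.le (one_lt_coshP hH hd.le hd'))

lemma range_annulusMap_eq :
    Set.range (annulusMap τ H d) = periodicSurface H d (graphOf H d (heightP τ H d)) := by
  have hx := one_lt_coshP hH hd.le hd'
  ext p
  simp only [periodicSurface, Set.mem_ofPred_eq, mem_doubledGraph_iff hH hd heightP_neg,
    period_graphOf_heightP hH hd]
  constructor
  · rintro ⟨m, rfl⟩
    obtain ⟨φ, s, rfl⟩ := exists_annulus_eq m
    have h2 : 0 < 2 * Real.pi := by positivity
    -- The integer is the one whose multiple of 2π brings s into [−π, π).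
    refine ⟨-toIcoDiv h2 (-Real.pi) s, φ, s + ((-toIcoDiv h2 (-Real.pi) s : ℤ) : ℝ) * (2 * Real.pi),
      ?_, ?_⟩
    · have := sub_toIcoDiv_zsmul_mem_Ico h2 (-Real.pi) s
      rw [zsmul_eq_mul] at this
      push_cast
      constructor <;> linarith [this.1, this.2]
    · rw [annulusMap_exp, vert_polar, radP_add_int_mul, heightP_add_int_mul hx]
  · rintro ⟨k, φ, s, -, h⟩
    refine ⟨(Circle.exp φ, s + ((-k : ℤ) : ℝ) * (2 * Real.pi)), ?_⟩
    rw [annulusMap_exp, radP_add_int_mul, heightP_add_int_mul hx,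
      ← vert_neg_vert (k * (2 * heightP τ H d Real.pi)) p, h, vert_polar]
    push_cast
    ring_nf

lemma isInvariant_annulusMap_vert :
    IsInvariant (annulusMap τ H d) (vert (period H d (graphOf H d (heightP τ H d)))) := by
  have hx := one_lt_coshP hH hd.le hd'
  refine ⟨(Homeomorph.refl Circle).prodCongr (Homeomorph.addRight (2 * Real.pi)), fun m => ?_⟩
  obtain ⟨φ, s, rfl⟩ := exists_annulus_eq m
  change annulusMap τ H d (Circle.exp φ, s + 2 * Real.pi) = _
  rw [annulusMap_exp, annulusMap_exp, period_graphOf_heightP hH hd, vert_polar,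
    heightP_add_two_pi hx]
  have := radP_add_int_mul (H := H) (d := d) s 1
  rw [Int.cast_one, one_mul] at this
  rw [this]

end

end AnnulusMaps

/-! ### Embedded annuli and self-intersections -/

section Embedding

variable {τ H d s : ℝ}

/-- The height takes the value k times the positive period at s = 2πk, so it is unbounded in both
directions, and the intermediate value theorem applies. Monotonicity plays no role. -/
lemma surjective_heightP (hH : 1 / 2 < H) (hd : d ≤ -√(4 * H ^ 2 - 1)) (hd' : d ≠ -(2 * H)) :
    Function.Surjective (heightP τ H d) := by
  have hx := one_lt_coshP hH hd hd'
  have hT := heightP_pi_pos (τ := τ) hH hd hx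
  have hcont := (contDiff_heightP (τ := τ) hx).continuous
  have hval : ∀ k : ℤ, heightP τ H d (k * (2 * Real.pi)) = k * (2 * heightP τ H d Real.pi) := by
    intro k
    have := heightP_add_int_mul (τ := τ) hx 0 k
    rwa [heightP_zero, zero_add, zero_add] at this
  intro t
  obtain ⟨k, hk⟩ := exists_int_lt (t / (2 * heightP τ H d Real.pi))
  obtain ⟨l, hl⟩ := exists_int_gt (t / (2 * heightP τ H d Real.pi))
  rw [lt_div_iff₀ (by positivity)] at hk
  rw [div_lt_iff₀ (by positivity)] at hl
  exact mem_range_of_exists_le_of_exists_ge hcont ⟨_, (hval k).trans_le hk.le⟩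
    ⟨_, hl.le.trans_eq (hval l).symm⟩

lemma speedP_pos (hH : 1 / 2 < H) (hx : 1 < coshP H d s) (h : 0 < forceP H d s) :
    0 < speedP τ H d s :=
  div_pos (mul_pos h (zero_lt_one.trans_le (one_le_twistP hx.le)))
    (mul_pos (sinhP_pos hx) (rootH_pos hH))

lemma forceP_pos (hH : 1 / 2 < H) (hd : -(2 * H) < d) (hx : 1 < coshP H d s) :
    0 < forceP H d s := by
  rw [forceP]; nlinarith

/-- Here the height is a homeomorphism of ℝ, so s is recovered from the vertical coordinate and the
point of the circle by dividing the horizontal coordinate by the radius at s. This defines a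
continuous map g on all of ℝ³ whose composition with the annulus map is the standard inclusion, and
an embedding that factors through continuous maps has an embedding as its first factor. -/
theorem isEmbedding_annulusMap (hH : 1 / 2 < H) (hd : d ≤ -√(4 * H ^ 2 - 1)) (hd' : -(2 * H) < d) :
    IsEmbedding (annulusMap τ H d) := by
  have hx := one_lt_coshP hH hd hd'.ne'
  have hmono : StrictMono (heightP τ H d) := strictMono_of_hasDerivAt_pos
    (fun s => hasDerivAt_heightP hx s) fun s => speedP_pos hH (hx s) (forceP_pos hH hd' (hx s))
  let e := (hmono.orderIsoOfSurjective _ (surjective_heightP hH hd hd'.ne')).toHomeomorph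
  have he : ∀ s, e.symm (heightP τ H d s) = s := fun s => e.symm_apply_apply s
  have hr : Continuous fun t => radP H d (e.symm t) :=
    (contDiff_radP hx).continuous.comp e.symm.continuous
  have hr0 : ∀ t, ((radP H d (e.symm t) : ℝ) : ℂ) ≠ 0 := fun t =>
    Complex.ofReal_ne_zero.2 (radP_pos (hx _)).ne'
  let g : E3 → ℂ × ℝ := fun p =>
    (((p 0 : ℂ) + (p 1 : ℂ) * Complex.I) / (radP H d (e.symm (p 2)) : ℂ), e.symm (p 2))
  have hp : ∀ i : Fin 3, Continuous fun p : E3 => p i := fun i => by fun_prop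
  have hg : Continuous g := by
    refine Continuous.prodMk (Continuous.div ?_ ?_ fun p => hr0 _) (e.symm.continuous.comp (hp 2))
    · exact (Complex.continuous_ofReal.comp (hp 0)).add
        ((Complex.continuous_ofReal.comp (hp 1)).mul continuous_const)
    · exact Complex.continuous_ofReal.comp (hr.comp (hp 2))
  refine IsEmbedding.of_comp (contMDiff_annulusMap hH hd hd'.ne').continuous hg ?_
  have : g ∘ annulusMap τ H d = annulusIncl := by
    ext1 m
    have h2 : annulusMap τ H d m 2 = heightP τ H d m.2 := rfl
    have h0 : annulusMap τ H d m 0 = radP H d m.2 * (m.1 : ℂ).re - 0 * (m.1 : ℂ).im := rfl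
    have h1 : annulusMap τ H d m 1 = radP H d m.2 * (m.1 : ℂ).im + 0 * (m.1 : ℂ).re := rfl
    have hne := hr0 (heightP τ H d m.2)
    rw [he] at hne
    refine Prod.ext ?_ (he m.2)
    simp only [g, Function.comp, h0, h1, h2, he, annulusIncl]
    rw [div_eq_iff hne]
    conv_rhs => rw [← Complex.re_add_im (m.1 : ℂ)]
    push_cast
    ring
  rw [this]
  exact isClosedEmbedding_annulusIncl.isEmbedding

lemma range_annulusMap_neg_sqrt (hH : 1 / 2 < H) :
    Set.range (annulusMap τ H (-√(4 * H ^ 2 - 1)))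
      = verticalCylinder (Real.arcosh (2 * H / √(4 * H ^ 2 - 1))) := by
  have hd' : -√(4 * H ^ 2 - 1) ≠ -(2 * H) := by
    have := sqrt_lt_two_mul hH
    intro h; linarith
  have hcosh : ∀ s, coshP H (-√(4 * H ^ 2 - 1)) s = 2 * H / √(4 * H ^ 2 - 1) := fun s => by
    rw [coshP, radius_neg_sqrt hH, center_neg_sqrt hH]; ring
  have hone := one_lt_two_mul_div_sqrt hH
  ext p
  constructor
  · rintro ⟨m, rfl⟩
    refine ⟨annulusMap_mem_space hH le_rfl hd' m, ?_⟩
    obtain ⟨φ, s, rfl⟩ := exists_annulus_eq m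
    rw [annulusMap_exp, rho_polar_radP (by rw [hcosh]; exact hone.le), hcosh]
  · rintro ⟨hp, hρ⟩
    obtain ⟨φ, hφ⟩ := exists_polar_eq p
    -- The radius is constant in s, so only the height of p has to be matched.
    obtain ⟨s, hs⟩ := surjective_heightP (τ := τ) hH le_rfl hd' (p 2)
    refine ⟨(Circle.exp φ, s), ?_⟩
    have h1 : 1 ≤ coshP H (-√(4 * H ^ 2 - 1)) s := by rw [hcosh]; exact hone.le
    rw [annulusMap_exp, hs]
    rw [sq_add_sq_eq_of_cosh_rho hp, hρ, Real.cosh_arcosh hone.le, ← hcosh s,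
      ← radP_sq_of_one_le h1, Real.sqrt_sq (radP_nonneg h1)] at hφ
    exact hφ.symm

/-! ### Self-intersection for d < −2H -/

lemma forceP_pi_neg (hH : 1 / 2 < H) (hd : d < -(2 * H)) : forceP H d Real.pi < 0 := by
  have hm := four_mul_sq_sub_one_pos hH
  -- Squared, this is (4H² − 1)(d² − 4H²) > 0.
  have key : -d < 2 * H * √(1 - 4 * H ^ 2 + d ^ 2) := by
    rw [← Real.sqrt_sq (by linarith : 0 ≤ 2 * H), ← Real.sqrt_mul (sq_nonneg _)]
    refine Real.lt_sqrt_of_sq_lt ?_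
    nlinarith [mul_pos hm (by nlinarith : 0 < d ^ 2 - 4 * H ^ 2)]
  have e : (4 * H ^ 2 - 1) * forceP H d Real.pi = -d - 2 * H * √(1 - 4 * H ^ 2 + d ^ 2) := by
    rw [forceP, coshP, center, radius, Real.cos_pi]
    have := hm.ne'
    rw [mul_add, mul_left_comm, mul_add (4 * H ^ 2 - 1), mul_div_cancel₀ _ this,
      ← mul_assoc (4 * H ^ 2 - 1), mul_div_cancel₀ _ this]
    ring
  nlinarith

/-- Two different parameters of the half profile at the height of the inner end. -/
lemma exists_heightP_eq_pi (hH : 1 / 2 < H) (hd : d < -(2 * H)) :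
    ∃ s ∈ Ioo 0 Real.pi, heightP τ H d s = heightP τ H d Real.pi ∧ 0 < forceP H d s := by
  have hd1 : d ≤ -√(4 * H ^ 2 - 1) := by linarith [sqrt_lt_two_mul hH]
  have hx := one_lt_coshP hH hd1 hd.ne
  have hR := radius_pos hH (by linarith [sqrt_lt_two_mul hH] : d < -√(4 * H ^ 2 - 1))
  have hc := rootH_pos hH
  have hneg : ∀ s, forceP H d s < 0 → speedP τ H d s < 0 := fun s hs =>
    div_neg_of_neg_of_pos
      (mul_neg_of_neg_of_pos hs (zero_lt_one.trans_le (one_le_twistP (hx s).le)))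
      (mul_pos (sinhP_pos (hx s)) hc)
  have hcont := (contDiff_heightP (τ := τ) hx).continuous
  -- The height decreases through π, so it exceeds its value at π somewhere before. Since it starts
  -- at 0, below that value, it attains the value earlier as well.
  obtain ⟨s₁, hs₁, hlt⟩ := exists_lt_of_hasDerivAt_neg (hasDerivAt_heightP (τ := τ) hx Real.pi)
    (hneg _ (forceP_pi_neg hH hd)) Real.pi_pos
  obtain ⟨s, hs, hval⟩ := intermediate_value_Ioo hs₁.1.le hcont.continuousOn
    (show heightP τ H d Real.pi ∈ Ioo (heightP τ H d 0) (heightP τ H d s₁) from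
      ⟨by rw [heightP_zero]; exact heightP_pi_pos hH hd1 hx, hlt⟩)
  refine ⟨s, ⟨hs.1, hs.2.trans hs₁.2⟩, hval, ?_⟩
  -- If the force were not positive at s, it would be negative on (s, π), because cosh ρ decreases
  -- there. The height would then be strictly decreasing on [s, π], contrary to the equality of its
  -- end values.
  by_contra hle
  have hanti : StrictAntiOn (heightP τ H d) (Icc s Real.pi) := by
    refine strictAntiOn_of_deriv_neg (convex_Icc _ _) hcont.continuousOn fun t ht => ?_
    rw [interior_Icc] at ht
    rw [(hasDerivAt_heightP hx t).deriv]
    refine hneg t ?_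
    have : Real.cos t < Real.cos s :=
      Real.cos_lt_cos_of_nonneg_of_le_pi hs.1.le ht.2.le ht.1
    have h2 : coshP H d t < coshP H d s := by
      rw [coshP, coshP]; nlinarith
    rw [forceP] at hle ⊢
    nlinarith
  have hsp : s < Real.pi := hs.2.trans hs₁.2
  exact (hanti ⟨le_rfl, hsp.le⟩ ⟨hsp.le, le_rfl⟩ hsp).ne hval.symm

/-- The parameters s and 2π − s have the same radius, and the same height when s has the height of
π. Their normals differ by the sign of the angular and vertical components; a common tangent plane
would make the meridian velocity at s orthogonal to both normals, hence to their common radial part.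
This is impossible, since neither the force nor sin s vanishes there. -/
theorem hasTransversalSelfIntersection_annulusMap (hH : 1 / 2 < H) (hd : d < -(2 * H)) :
    HasTransversalSelfIntersection annulusModel (annulusMap τ H d) := by
  have hd1 : d ≤ -√(4 * H ^ 2 - 1) := by linarith [sqrt_lt_two_mul hH]
  have hx := one_lt_coshP hH hd1 hd.ne
  have hR := radius_pos hH (by linarith [sqrt_lt_two_mul hH] : d < -√(4 * H ^ 2 - 1))
  obtain ⟨s, hs, hval, hpos⟩ := exists_heightP_eq_pi (τ := τ) hH hd
  have hcosh : coshP H d (-s + 2 * Real.pi) = coshP H d s := by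
    rw [coshP_add_two_pi, coshP_neg]
  have hval' : heightP τ H d (-s + 2 * Real.pi) = heightP τ H d s := by
    rw [heightP_add_two_pi hx, heightP_neg, hval]; ring
  have hrad : radP H d (-s + 2 * Real.pi) = radP H d s := by
    rw [radP, sinhP, hcosh]; rfl
  have hsin : Real.sin (-s + 2 * Real.pi) = -Real.sin s := by
    rw [Real.sin_add_two_pi, Real.sin_neg]
  have hmap : annulusMap τ H d (Circle.exp 0, s)
      = annulusMap τ H d (Circle.exp 0, -s + 2 * Real.pi) := by
    rw [annulusMap_exp, annulusMap_exp, hval', hrad]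
  refine ⟨(Circle.exp 0, s), (Circle.exp 0, -s + 2 * Real.pi), fun h => ?_, hmap, fun h => ?_⟩
  · have := congrArg Prod.snd h
    simp only at this
    linarith [hs.2]
  · have hcurve := mdifferentiableAt_annulus_curve 0 0 s 1
    obtain ⟨e, he, -⟩ := exists_tangent_of_curve (E' := E3) annulusModel
      (m := (Circle.exp 0, s)) (by simp) hcurve
    have hvel := hasDerivAt_polar (hasDerivAt_radP (hx s)) (hasDerivAt_const s (0 : ℝ))
      (hasDerivAt_heightP (τ := τ) hx s) 0 0 1
    have hpush := he (annulusMap τ H d) _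
      ((contMDiff_annulusMap hH hd1 hd.ne).mdifferentiable (by simp) _)
      (hvel.congr_of_eventuallyEq (.of_forall fun t => annulusMap_exp _ _))
    have hmem : push annulusModel (annulusMap τ H d) (Circle.exp 0, s) e
        ∈ tangentPlane annulusModel (annulusMap τ H d) (Circle.exp 0, -s + 2 * Real.pi) :=
      h ▸ Set.mem_range_self e
    obtain ⟨e', he'⟩ := hmem
    have n1 := ((isUnitNormal_annulusNormal (τ := τ) hH hd1 hd.ne).2 (Circle.exp 0, s)).2 e
    have n2 := ((isUnitNormal_annulusNormal (τ := τ) hH hd1 hd.ne).2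
      (Circle.exp 0, -s + 2 * Real.pi)).2 e'
    rw [he', ← hmap, hpush, annulusMap_exp, annulusNormal_exp,
      metric_polar_of_lam (two_div_one_sub_radP_sq (hx s)) (coshP_add_one_mul_radP (hx s))] at n2
    rw [hpush, annulusMap_exp, annulusNormal_exp,
      metric_polar_of_lam (two_div_one_sub_radP_sq (hx s)) (coshP_add_one_mul_radP (hx s))] at n1
    have eR : normalR H d (-s + 2 * Real.pi) = normalR H d s := by
      simp only [normalR, forceP, sinhP, hcosh]
    have eA : normalA τ H d (-s + 2 * Real.pi) = -normalA τ H d s := by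
      simp only [normalA, twistP, hcosh, hsin]; ring
    have eV : normalV τ H d (-s + 2 * Real.pi) = -normalV τ H d s := by
      simp only [normalV, twistP, sinhP, hcosh, hsin]; ring
    rw [eR, eA, eV] at n2
    have hS := sinhP_pos (hx s)
    have hx1 : 0 < coshP H d s + 1 := by linarith [hx s]
    -- The angular and vertical contributions cancel in the sum of the two orthogonality relations.
    have hsum : (coshP H d s + 1) ^ 2 * normalR H d s
        * (-(radius H d * Real.sin s) / ((coshP H d s + 1) * sinhP H d s)) = 0 := by
      linear_combination (n1 + n2) / 2
    have hsin0 := Real.sin_pos_of_pos_of_lt_pi hs.1 hs.2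
    have hpos' : 0 < (coshP H d s + 1) ^ 2 * normalR H d s
        * (-(radius H d * Real.sin s) / ((coshP H d s + 1) * sinhP H d s)) := by
      rw [normalR, show (coshP H d s + 1) ^ 2
          * (-forceP H d s / ((coshP H d s + 1) * sinhP H d s))
          * (-(radius H d * Real.sin s) / ((coshP H d s + 1) * sinhP H d s))
        = (coshP H d s + 1) ^ 2 * (forceP H d s / ((coshP H d s + 1) * sinhP H d s))
          * (radius H d * Real.sin s / ((coshP H d s + 1) * sinhP H d s)) by ring]
      positivity
    exact hpos'.ne' hsum

end Embedding

/-! ### The sphere -/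

section SphereMaps

variable {τ H s z : ℝ}

/-- The map that multiplies the horizontal complex coordinate by `a + i b` and replaces the height
by `e`, where `a`, `b`, `e` are evaluated at the height. -/
def axialField (a b e : ℝ → ℝ) (p : E3) : E3 :=
  !₂[a (p 2) * p 0 - b (p 2) * p 1, a (p 2) * p 1 + b (p 2) * p 0, e (p 2)]

lemma axialField_polar (a b e : ℝ → ℝ) (φ u v t : ℝ) : axialField a b e (polar φ u v t)
    = polar φ (a t * u - b t * v) (a t * v + b t * u) (e t) := by
  ext i
  fin_cases i <;> simp [axialField, polar] <;> ring

lemma rot_polar (α φ a b e : ℝ) : rot α (polar φ a b e) = polar (α + φ) a b e := by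
  ext i
  fin_cases i <;> simp [rot, polar, Real.cos_add, Real.sin_add] <;> ring

lemma axialField_rot (a b e : ℝ → ℝ) (α : ℝ) (p : E3) :
    axialField a b e (rot α p) = rot α (axialField a b e p) := by
  obtain ⟨φ, hφ⟩ := exists_polar_eq p
  rw [hφ, rot_polar, axialField_polar, axialField_polar, rot_polar]

lemma contDiffAt_axialField {a b e : ℝ → ℝ} {p : E3} (ha : ContDiffAt ℝ ∞ a (p 2))
    (hb : ContDiffAt ℝ ∞ b (p 2)) (he : ContDiffAt ℝ ∞ e (p 2)) :
    ContDiffAt ℝ ∞ (axialField a b e) p := by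
  have hp : ∀ i : Fin 3, ContDiffAt ℝ ∞ (fun q : E3 => q i) p := fun i =>
    (contDiff_euclidean.1 contDiff_id i).contDiffAt
  have ha' : ContDiffAt ℝ ∞ (fun q : E3 => a (q 2)) p := ha.comp p (hp 2)
  have hb' : ContDiffAt ℝ ∞ (fun q : E3 => b (q 2)) p := hb.comp p (hp 2)
  have he' : ContDiffAt ℝ ∞ (fun q : E3 => e (q 2)) p := he.comp p (hp 2)
  rw [contDiffAt_euclidean]
  intro i
  fin_cases i
  exacts [(ha'.mul (hp 0)).sub (hb'.mul (hp 1)), (ha'.mul (hp 1)).add (hb'.mul (hp 0)), he']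

lemma sphere_height_sq_le (m : Sphere2) : (m : E3) 0 ^ 2 + (m : E3) 1 ^ 2 + (m : E3) 2 ^ 2 = 1 := by
  have h := m.2
  rw [mem_sphere_zero_iff_norm, EuclideanSpace.norm_eq, Real.sqrt_eq_one, Fin.sum_univ_three] at h
  simpa using h

lemma mem_sphere_iff (p : E3) :
    p ∈ Metric.sphere (0 : E3) 1 ↔ p 0 ^ 2 + p 1 ^ 2 + p 2 ^ 2 = 1 := by
  rw [mem_sphere_zero_iff_norm, EuclideanSpace.norm_eq, Real.sqrt_eq_one, Fin.sum_univ_three]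
  simp

lemma sphere_height_mem (m : Sphere2) : (m : E3) 2 ∈ Icc (-1 : ℝ) 1 := by
  have := sphere_height_sq_le m
  have h0 := sq_nonneg ((m : E3) 0)
  have h1 := sq_nonneg ((m : E3) 1)
  exact abs_le.1 ((sq_le_one_iff_abs_le_one _).1 (by linarith))

/-- The point of the sphere at the longitude `φ` and the latitude `s / 2`. -/
def spherePt (φ s : ℝ) : Sphere2 :=
  ⟨polar φ (Real.cos (s / 2)) 0 (Real.sin (s / 2)), by
    rw [mem_sphere_iff, polar_sq_add_sq, polar_two]
    linear_combination Real.sin_sq_add_cos_sq (s / 2)⟩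

lemma exists_spherePt_eq (m : Sphere2) :
    ∃ φ, ∃ s ∈ Icc (-Real.pi) Real.pi, m = spherePt φ s := by
  obtain ⟨φ, hφ⟩ := exists_polar_eq m
  have hz := sphere_height_mem m
  have h1 := Real.neg_pi_div_two_le_arcsin ((m : E3) 2)
  have h2 := Real.arcsin_le_pi_div_two ((m : E3) 2)
  refine ⟨φ, 2 * Real.arcsin ((m : E3) 2), ⟨by linarith, by linarith⟩, Subtype.ext ?_⟩
  rw [spherePt]
  simp only
  rw [mul_div_cancel_left₀ _ two_ne_zero, Real.sin_arcsin hz.1 hz.2, Real.cos_arcsin,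
    show 1 - (m : E3) 2 ^ 2 = (m : E3) 0 ^ 2 + (m : E3) 1 ^ 2 by linarith [sphere_height_sq_le m]]
  exact hφ

/-- `cosh ρ` as a function of the height on the parameter sphere. -/
def sphCosh (H z : ℝ) : ℝ := 1 + 2 * radius H (-(2 * H)) * (1 - z ^ 2)

/-- Ratio of the Euclidean distances to the axis on the surface and on the parameter sphere. -/
def sphScale (H z : ℝ) : ℝ := √(2 * radius H (-(2 * H)) / (sphCosh H z + 1))

/-- `√(1 + 4τ² tanh² (ρ / 2))` as a function of the height on the parameter sphere. -/
def sphTwist (τ H z : ℝ) : ℝ := √(1 + 4 * τ ^ 2 * ((sphCosh H z - 1) / (sphCosh H z + 1)))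

/-- Derivative of the height of the surface. -/
def sphSpeed (τ H z : ℝ) : ℝ :=
  8 * H * radius H (-(2 * H)) * sphTwist τ H z / ((sphCosh H z + 1) * sphScale H z * rootH H)

/-- The height of the surface. -/
def sphHeight (τ H z : ℝ) : ℝ := ∫ t in (0 : ℝ)..z, sphSpeed τ H t

/-- Coefficient of the radial component of the normal. -/
def sphNormalR (H z : ℝ) : ℝ := -(2 * H * sphScale H z) / (sphCosh H z + 1)

/-- Coefficient of the angular component of the normal. -/
def sphNormalA (τ H z : ℝ) : ℝ :=
  -(4 * τ * rootH H * radius H (-(2 * H)) * z) / (sphTwist τ H z * (sphCosh H z + 1) ^ 2)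

/-- Vertical component of the normal. -/
def sphNormalV (τ H z : ℝ) : ℝ :=
  -(2 * rootH H * radius H (-(2 * H)) * z * sphTwist τ H z) / ((sphCosh H z + 1) * sphScale H z)

/-- A neighbourhood of `[-1, 1]` on which the functions above are smooth. -/
def sphDomain (τ H : ℝ) : Set ℝ :=
  {z | 0 < sphCosh H z + 1 ∧ 0 < 1 + 4 * τ ^ 2 * ((sphCosh H z - 1) / (sphCosh H z + 1))}

lemma radius_neg_two_mul_pos (hH : 1 / 2 < H) : 0 < radius H (-(2 * H)) := by
  rw [radius_neg_two_mul]; exact one_div_pos.2 (four_mul_sq_sub_one_pos hH)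

lemma rootH_sq_mul_radius (hH : 1 / 2 < H) : rootH H ^ 2 * radius H (-(2 * H)) = 1 := by
  rw [rootH_sq hH, radius_neg_two_mul]
  exact mul_one_div_cancel (four_mul_sq_sub_one_pos hH).ne'

lemma neg_two_mul_lt_neg_sqrt (hH : 1 / 2 < H) : -(2 * H) < -√(4 * H ^ 2 - 1) :=
  neg_lt_neg (sqrt_lt_two_mul hH)

lemma one_le_sphCosh (hH : 1 / 2 < H) (hz : z ∈ Icc (-1 : ℝ) 1) : 1 ≤ sphCosh H z := by
  have hR := radius_neg_two_mul_pos hH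
  have : 0 ≤ 1 - z ^ 2 := by nlinarith [hz.1, hz.2]
  rw [sphCosh]
  have : 0 ≤ 2 * radius H (-(2 * H)) * (1 - z ^ 2) := by positivity
  linarith

lemma Icc_subset_sphDomain (hH : 1 / 2 < H) : Icc (-1 : ℝ) 1 ⊆ sphDomain τ H := fun z hz => by
  have h := one_le_sphCosh hH hz
  refine ⟨by linarith, ?_⟩
  have : 0 ≤ (sphCosh H z - 1) / (sphCosh H z + 1) := div_nonneg (by linarith) (by linarith)
  positivity

lemma contDiff_sphCosh : ContDiff ℝ ∞ (sphCosh H) :=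
  contDiff_const.add (contDiff_const.mul (contDiff_const.sub (contDiff_id.pow 2)))

/-- `sphCosh` decreases in z², and (x − 1)/(x + 1) increases in x when x + 1 > 0. Hence the domain
contains the whole segment from 0 to each of its points, as the integral defining `sphHeight`
requires. -/
lemma mem_sphDomain_of_sq_le (hH : 1 / 2 < H) {w : ℝ} (hz : z ∈ sphDomain τ H)
    (hw : w ^ 2 ≤ z ^ 2) : w ∈ sphDomain τ H := by
  have hR := radius_neg_two_mul_pos hH
  have hle : sphCosh H z ≤ sphCosh H w := by
    rw [sphCosh, sphCosh]; nlinarith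
  have h1 := hz.1
  have h2 : 0 < sphCosh H w + 1 := by linarith
  refine ⟨h2, hz.2.trans_le ?_⟩
  have : (sphCosh H z - 1) / (sphCosh H z + 1) ≤ (sphCosh H w - 1) / (sphCosh H w + 1) := by
    rw [div_le_div_iff₀ h1 h2]; nlinarith
  gcongr

lemma isOpen_sphDomain : IsOpen (sphDomain τ H) := by
  have hc : Continuous (sphCosh H) := contDiff_sphCosh.continuous
  have h1 : IsOpen {z | 0 < sphCosh H z + 1} := isOpen_lt continuous_const (by fun_prop)
  have h2 : ContinuousOn (fun z => 1 + 4 * τ ^ 2 * ((sphCosh H z - 1) / (sphCosh H z + 1)))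
      {z | 0 < sphCosh H z + 1} :=
    continuousOn_const.add (continuousOn_const.mul
      ((hc.sub continuous_const).continuousOn.div (hc.add continuous_const).continuousOn
        fun z hz => ne_of_gt hz))
  exact h2.isOpen_inter_preimage h1 isOpen_Ioi

section Smooth

variable (hz : z ∈ sphDomain τ H)
include hz

lemma contDiffAt_sphTwist : ContDiffAt ℝ ∞ (sphTwist τ H) z :=
  (contDiffAt_const.add (contDiffAt_const.mul ((contDiff_sphCosh.contDiffAt.sub contDiffAt_const).div
    (contDiff_sphCosh.contDiffAt.add contDiffAt_const) hz.1.ne'))).sqrt hz.2.ne'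

lemma sphTwist_pos : 0 < sphTwist τ H z := Real.sqrt_pos.2 hz.2

variable (hH : 1 / 2 < H)
include hH

lemma contDiffAt_sphScale : ContDiffAt ℝ ∞ (sphScale H) z :=
  (contDiffAt_const.div (contDiff_sphCosh.contDiffAt.add contDiffAt_const) hz.1.ne').sqrt
    (div_pos (mul_pos two_pos (radius_neg_two_mul_pos hH)) hz.1).ne'

lemma sphScale_pos : 0 < sphScale H z :=
  Real.sqrt_pos.2 (div_pos (mul_pos two_pos (radius_neg_two_mul_pos hH)) hz.1)

lemma sphScale_sq : sphScale H z ^ 2 * (sphCosh H z + 1) = 2 * radius H (-(2 * H)) := by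
  rw [sphScale, Real.sq_sqrt (div_pos (mul_pos two_pos (radius_neg_two_mul_pos hH)) hz.1).le,
    div_mul_cancel₀ _ hz.1.ne']

lemma contDiffAt_sphSpeed : ContDiffAt ℝ ∞ (sphSpeed τ H) z :=
  (contDiffAt_const.mul (contDiffAt_sphTwist hz)).div
    (((contDiff_sphCosh.contDiffAt.add contDiffAt_const).mul (contDiffAt_sphScale hz hH)).mul
      contDiffAt_const)
    (mul_pos (mul_pos hz.1 (sphScale_pos hz hH)) (rootH_pos hH)).ne'

lemma sphSpeed_pos : 0 < sphSpeed τ H z := by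
  have h1 := sphScale_pos hz hH
  have h2 := sphTwist_pos hz
  have h3 := rootH_pos hH
  have h4 := radius_neg_two_mul_pos hH
  have h5 := hz.1
  have h6 : 0 < H := by linarith
  rw [sphSpeed]
  positivity

lemma contDiffAt_sphNormalR : ContDiffAt ℝ ∞ (sphNormalR H) z :=
  (contDiffAt_const.mul (contDiffAt_sphScale hz hH)).neg.div
    (contDiff_sphCosh.contDiffAt.add contDiffAt_const) hz.1.ne'

omit hH in
lemma contDiffAt_sphNormalA : ContDiffAt ℝ ∞ (sphNormalA τ H) z :=
  (contDiffAt_const.mul contDiffAt_id).neg.div ((contDiffAt_sphTwist hz).mul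
    ((contDiff_sphCosh.contDiffAt.add contDiffAt_const).pow 2))
    (mul_pos (sphTwist_pos hz) (pow_pos hz.1 2)).ne'

lemma contDiffAt_sphNormalV : ContDiffAt ℝ ∞ (sphNormalV τ H) z :=
  ((contDiffAt_const.mul contDiffAt_id).mul (contDiffAt_sphTwist hz)).neg.div
    ((contDiff_sphCosh.contDiffAt.add contDiffAt_const).mul (contDiffAt_sphScale hz hH))
    (mul_pos hz.1 (sphScale_pos hz hH)).ne'

lemma hasDerivAt_sphHeight : HasDerivAt (sphHeight τ H) (sphSpeed τ H z) z := by
  have hcont : ContinuousOn (sphSpeed τ H) (sphDomain τ H) := fun w hw =>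
    (contDiffAt_sphSpeed hw hH).continuousAt.continuousWithinAt
  refine intervalIntegral.integral_hasDerivAt_right
    (hcont.mono fun w hw => mem_sphDomain_of_sq_le hH hz ?_).intervalIntegrable
    (hcont.stronglyMeasurableAtFilter isOpen_sphDomain z hz)
    (contDiffAt_sphSpeed hz hH).continuousAt
  rcases le_total 0 z with h | h
  · rw [uIcc_of_le h] at hw; nlinarith [hw.1, hw.2]
  · rw [uIcc_of_ge h] at hw; nlinarith [hw.1, hw.2]

lemma contDiffAt_sphHeight : ContDiffAt ℝ ∞ (sphHeight τ H) z := by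
  have h : ContDiffOn ℝ ∞ (sphHeight τ H) (sphDomain τ H) := by
    rw [contDiffOn_infty_iff_deriv_of_isOpen isOpen_sphDomain]
    refine ⟨fun w hw => (hasDerivAt_sphHeight hw hH).differentiableAt.differentiableWithinAt, ?_⟩
    refine ContDiffOn.congr (f := sphSpeed τ H)
      (fun w hw => (contDiffAt_sphSpeed hw hH).contDiffWithinAt)
      fun w hw => (hasDerivAt_sphHeight hw hH).deriv
  exact h.contDiffAt (isOpen_sphDomain.mem_nhds hz)

end Smooth

lemma sphHeight_neg (z : ℝ) : sphHeight τ H (-z) = -sphHeight τ H z := by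
  have h := intervalIntegral.integral_comp_neg (a := 0) (b := z) (sphSpeed τ H)
  have hev : ∀ w, sphSpeed τ H (-w) = sphSpeed τ H w := fun w => by
    simp only [sphSpeed, sphTwist, sphScale, sphCosh, neg_sq]
  simp only [hev, neg_zero] at h
  rw [sphHeight, sphHeight, h, intervalIntegral.integral_symm]

lemma strictMonoOn_sphHeight (hH : 1 / 2 < H) :
    StrictMonoOn (sphHeight τ H) (Icc (-1 : ℝ) 1) := by
  have hsub := Icc_subset_sphDomain (τ := τ) hH
  refine strictMonoOn_of_deriv_pos (convex_Icc _ _)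
    (fun z hz => (hasDerivAt_sphHeight (hsub hz) hH).continuousAt.continuousWithinAt) fun z hz => ?_
  have hz' := hsub (interior_subset hz)
  rw [(hasDerivAt_sphHeight hz' hH).deriv]
  exact sphSpeed_pos hz' hH

end SphereMaps

/-! ### The sphere as a complete surface -/

section SphereSurface

variable {τ H s : ℝ}

/-- The rotational sphere. -/
def sphereMap (τ H : ℝ) (m : Sphere2) : E3 :=
  axialField (sphScale H) (fun _ => 0) (sphHeight τ H) m

/-- The unit normal of `sphereMap`. -/
def sphereNormal (τ H : ℝ) (m : Sphere2) : E3 :=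
  axialField (sphNormalR H) (sphNormalA τ H) (sphNormalV τ H) m

/-- The height of the sphere along the profile curve. -/
def sphereProfile (τ H s : ℝ) : ℝ := sphHeight τ H (Real.sin (s / 2))

lemma coshP_eq_sphCosh (hH : 1 / 2 < H) (s : ℝ) :
    coshP H (-(2 * H)) s = sphCosh H (Real.sin (s / 2)) := by
  have h : Real.cos s = 2 * Real.cos (s / 2) ^ 2 - 1 := by
    rw [← Real.cos_two_mul, mul_div_cancel₀ _ two_ne_zero]
  rw [coshP, center_neg_two_mul hH, sphCosh, h, Real.cos_sq']
  ring

lemma coshP_sub_one (hH : 1 / 2 < H) (s : ℝ) :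
    coshP H (-(2 * H)) s - 1 = 2 * radius H (-(2 * H)) * Real.cos (s / 2) ^ 2 := by
  rw [coshP_eq_sphCosh hH, sphCosh, Real.cos_sq']
  ring

lemma sin_half_mem (s : ℝ) : Real.sin (s / 2) ∈ Icc (-1 : ℝ) 1 :=
  ⟨Real.neg_one_le_sin _, Real.sin_le_one _⟩

lemma cos_half_pos (hs : s ∈ Ioo (-Real.pi) Real.pi) : 0 < Real.cos (s / 2) :=
  Real.cos_pos_of_mem_Ioo ⟨by linarith [hs.1], by linarith [hs.2]⟩

lemma one_lt_coshP_sphere (hH : 1 / 2 < H) (hs : s ∈ Ioo (-Real.pi) Real.pi) :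
    1 < coshP H (-(2 * H)) s := by
  have h := coshP_sub_one hH s
  have := radius_neg_two_mul_pos hH
  have := cos_half_pos hs
  have : 0 < 2 * radius H (-(2 * H)) * Real.cos (s / 2) ^ 2 := by positivity
  linarith

/-- The half-angle formula gives cosh ρ − 1 = 2 `radius` cos²(s/2). The factor cos(s/2) is the
distance to the axis on the parameter sphere, so the remaining ratio is smooth in z and nonzero at
the poles. -/
lemma radP_sphere (hH : 1 / 2 < H) (hs : s ∈ Icc (-Real.pi) Real.pi) :
    radP H (-(2 * H)) s = sphScale H (Real.sin (s / 2)) * Real.cos (s / 2) := by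
  have hz := Icc_subset_sphDomain (τ := 0) hH (sin_half_mem s)
  have h1 := one_le_coshP hH (neg_two_mul_lt_neg_sqrt hH).le s
  have hcos : 0 ≤ Real.cos (s / 2) :=
    Real.cos_nonneg_of_mem_Icc ⟨by linarith [hs.1], by linarith [hs.2]⟩
  refine (pow_left_inj₀ (radP_nonneg h1) (mul_nonneg (sphScale_pos hz hH).le hcos)
    two_ne_zero).1 ?_
  rw [radP_sq_of_one_le h1, coshP_sub_one hH, coshP_eq_sphCosh hH, mul_pow,
    ← sphScale_sq hz hH]
  have := hz.1.ne'
  field_simp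

lemma sphereMap_spherePt (hH : 1 / 2 < H) (hs : s ∈ Icc (-Real.pi) Real.pi) (φ : ℝ) :
    sphereMap τ H (spherePt φ s) = polar φ (radP H (-(2 * H)) s) 0 (sphereProfile τ H s) := by
  rw [sphereMap, spherePt, axialField_polar, radP_sphere hH hs, sphereProfile]
  simp

lemma sinhP_sphere (hH : 1 / 2 < H) (hs : s ∈ Ioo (-Real.pi) Real.pi) :
    sinhP H (-(2 * H)) s = (sphCosh H (Real.sin (s / 2)) + 1) * sphScale H (Real.sin (s / 2))
      * Real.cos (s / 2) := by
  rw [← coshP_add_one_mul_radP (one_lt_coshP_sphere hH hs), radP_sphere hH ⟨hs.1.le, hs.2.le⟩,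
    coshP_eq_sphCosh hH, mul_assoc]

lemma forceP_sphere (hH : 1 / 2 < H) (s : ℝ) :
    forceP H (-(2 * H)) s = 2 * H * (2 * radius H (-(2 * H)) * Real.cos (s / 2) ^ 2) := by
  rw [← coshP_sub_one hH, forceP]; ring

lemma twistP_sphere (hH : 1 / 2 < H) (s : ℝ) :
    twistP τ H (-(2 * H)) s = sphTwist τ H (Real.sin (s / 2)) := by
  rw [twistP, sphTwist, coshP_eq_sphCosh hH]

lemma slantP_sphere (s : ℝ) : -(radius H (-(2 * H)) * Real.sin s)
    = -(2 * radius H (-(2 * H)) * Real.sin (s / 2) * Real.cos (s / 2)) := by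
  have h : Real.sin s = 2 * Real.sin (s / 2) * Real.cos (s / 2) := by
    rw [← Real.sin_two_mul, mul_div_cancel₀ _ two_ne_zero]
  rw [h]; ring

/-- In the profile components a factor cos(s/2) cancels against the one in sinh ρ, or remains as the
horizontal radius. The ends are excluded because the profile formulas divide by sinh ρ. -/
lemma sphereNormal_spherePt (hH : 1 / 2 < H) (hs : s ∈ Ioo (-Real.pi) Real.pi) (φ : ℝ) :
    sphereNormal τ H (spherePt φ s) = polar φ (normalR H (-(2 * H)) s)
      (normalA τ H (-(2 * H)) s) (normalV τ H (-(2 * H)) s) := by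
  have hz := Icc_subset_sphDomain (τ := τ) hH (sin_half_mem s)
  have h1 := hz.1
  have h2 := sphScale_pos hz hH
  have h3 := sphTwist_pos hz
  have h4 := cos_half_pos hs
  have h5 := sphScale_sq hz hH
  rw [sphereNormal, spherePt, axialField_polar]
  congr 1
  · rw [normalR, sphNormalR, sinhP_sphere hH hs, forceP_sphere hH, coshP_eq_sphCosh hH, ← h5]
    field_simp
    ring
  · rw [normalA, sphNormalA, slantP_sphere, twistP_sphere hH, coshP_eq_sphCosh hH]
    field_simp
    ring
  · rw [normalV, sphNormalV, slantP_sphere, twistP_sphere hH, sinhP_sphere hH hs]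
    field_simp

lemma hasDerivAt_sphereProfile (hH : 1 / 2 < H) (hs : s ∈ Ioo (-Real.pi) Real.pi) :
    HasDerivAt (sphereProfile τ H) (speedP τ H (-(2 * H)) s) s := by
  have hz := Icc_subset_sphDomain (τ := τ) hH (sin_half_mem s)
  have hsin : HasDerivAt (fun s : ℝ => Real.sin (s / 2)) (Real.cos (s / 2) * (1 / 2)) s :=
    ((hasDerivAt_id s).div_const 2).sin
  have := HasDerivAt.comp s (h₂ := sphHeight τ H) (h := fun s : ℝ => Real.sin (s / 2))
    (hasDerivAt_sphHeight hz hH) hsin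
  refine this.congr_deriv ?_
  have h1 := hz.1
  have h2 := sphScale_pos hz hH
  have h4 := cos_half_pos hs
  have hc := rootH_pos hH
  rw [sphSpeed, speedP, forceP_sphere hH, twistP_sphere hH, sinhP_sphere hH hs]
  field_simp
  ring

lemma sphereProfile_neg (s : ℝ) : sphereProfile τ H (-s) = -sphereProfile τ H s := by
  rw [sphereProfile, neg_div, Real.sin_neg, sphHeight_neg, sphereProfile]

lemma continuous_sphereProfile (hH : 1 / 2 < H) : Continuous (sphereProfile τ H) :=
  continuous_iff_continuousAt.2 fun s => ContinuousAt.comp (g := sphHeight τ H)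
    (hasDerivAt_sphHeight (Icc_subset_sphDomain hH (sin_half_mem s)) hH).continuousAt
    (by fun_prop)

open EuclideanSpace in
lemma contMDiff_coe_sphere2 : ContMDiff (𝓡 2) 𝓘(ℝ, E3) ∞ (fun m : Sphere2 => (m : E3)) :=
  contMDiff_coe_sphere

lemma contMDiff_sphereMap (hH : 1 / 2 < H) : ContMDiff (𝓡 2) 𝓘(ℝ, E3) ∞ (sphereMap τ H) := by
  intro m
  have hz := Icc_subset_sphDomain (τ := τ) hH (sphere_height_mem m)
  exact (contDiffAt_axialField (contDiffAt_sphScale hz hH) contDiffAt_const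
    (contDiffAt_sphHeight hz hH)).contMDiffAt.comp m (contMDiff_coe_sphere2 m)

lemma contMDiff_sphereNormal (hH : 1 / 2 < H) :
    ContMDiff (𝓡 2) 𝓘(ℝ, E3) ∞ (sphereNormal τ H) := by
  intro m
  have hz := Icc_subset_sphDomain (τ := τ) hH (sphere_height_mem m)
  exact (contDiffAt_axialField (contDiffAt_sphNormalR hz hH) (contDiffAt_sphNormalA hz)
    (contDiffAt_sphNormalV hz hH)).contMDiffAt.comp m (contMDiff_coe_sphere2 m)

lemma sphereMap_mem_space (hH : 1 / 2 < H) (m : Sphere2) : sphereMap τ H m ∈ space := by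
  obtain ⟨φ, s, hs, rfl⟩ := exists_spherePt_eq m
  have h1 := one_le_coshP hH (neg_two_mul_lt_neg_sqrt hH).le s
  rw [sphereMap_spherePt hH hs]
  exact mem_space_of_sq_add_sq h1 (polar_radP_sq_add_sq h1 φ _)

/-- A point of the sphere is a pole or lies strictly between the poles. -/
lemma sphere_cases (m : Sphere2) :
    (∃ ε : ℝ, ε ^ 2 = 1 ∧ (m : E3) = polar 0 0 0 ε) ∨
      ∃ φ, ∃ s ∈ Ioo (-Real.pi) Real.pi, m = spherePt φ s := by
  obtain ⟨φ, s, hs, rfl⟩ := exists_spherePt_eq m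
  by_cases h : Real.cos (s / 2) = 0
  · left
    refine ⟨Real.sin (s / 2), by rw [Real.sin_sq, h]; ring, ?_⟩
    rw [spherePt]
    simp only
    rw [h]
    ext i
    fin_cases i <;> simp [polar]
  · right
    refine ⟨φ, s, ⟨hs.1.lt_of_ne ?_, hs.2.lt_of_ne ?_⟩, rfl⟩
    · rintro rfl; exact h (by rw [neg_div, Real.cos_neg, Real.cos_pi_div_two])
    · rintro rfl; exact h Real.cos_pi_div_two

lemma sphCosh_of_sq_eq_one {ε : ℝ} (hε : ε ^ 2 = 1) : sphCosh H ε = 1 := by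
  rw [sphCosh, hε]; ring

lemma sphTwist_of_sq_eq_one {ε : ℝ} (hε : ε ^ 2 = 1) : sphTwist τ H ε = 1 := by
  rw [sphTwist, sphCosh_of_sq_eq_one hε]; simp

lemma sphScale_sq_of_sq_eq_one (hH : 1 / 2 < H) {ε : ℝ} (hε : ε ^ 2 = 1) :
    sphScale H ε ^ 2 = radius H (-(2 * H)) := by
  have := radius_neg_two_mul_pos hH
  rw [sphScale, sphCosh_of_sq_eq_one hε, Real.sq_sqrt (by positivity)]
  ring

lemma mem_Icc_of_sq_eq_one {ε : ℝ} (hε : ε ^ 2 = 1) : ε ∈ Icc (-1 : ℝ) 1 :=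
  abs_le.1 ((sq_le_one_iff_abs_le_one _).1 hε.le)

lemma metric_sphereNormal (hH : 1 / 2 < H) (m : Sphere2) : metric τ (sphereMap τ H m)
    (sphereNormal τ H m) (sphereNormal τ H m) = 1 := by
  have hd := (neg_two_mul_lt_neg_sqrt hH).le
  rcases sphere_cases m with ⟨ε, hε, hm⟩ | ⟨φ, s, hs, rfl⟩
  · have hk := sphScale_pos (Icc_subset_sphDomain (τ := 0) hH (mem_Icc_of_sq_eq_one hε)) hH
    rw [sphereMap, sphereNormal, hm, axialField_polar, axialField_polar]
    simp only [mul_zero, sub_zero, add_zero]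
    rw [metric_polar, sphNormalV, sphTwist_of_sq_eq_one hε, sphCosh_of_sq_eq_one hε]
    have h1 := sphScale_sq_of_sq_eq_one hH hε
    have h2 := rootH_sq_mul_radius hH
    simp only [mul_zero, sub_zero, add_zero, zero_add]
    field_simp
    rw [← h1] at h2 ⊢
    linear_combination (4 * sphScale H ε ^ 2 * ε ^ 2) * h2 + 4 * sphScale H ε ^ 2 * hε
  · rw [sphereMap_spherePt hH ⟨hs.1.le, hs.2.le⟩, sphereNormal_spherePt hH hs]
    exact metric_normal_normal hH (four_mul_sq_sub_one_le_sq hd) (one_lt_coshP_sphere hH hs) φ _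

open EuclideanSpace in
lemma contMDiff_sphere_curve {γ : ℝ → E3} (hγ : ContDiff ℝ ∞ γ)
    (h : ∀ t, γ t ∈ Metric.sphere (0 : E3) 1) :
    ContMDiff 𝓘(ℝ, ℝ) (𝓡 2) ∞ fun t => (⟨γ t, h t⟩ : Sphere2) :=
  hγ.contMDiff.codRestrict_sphere h

lemma contDiff_polar {φ a b e : ℝ → ℝ} (hφ : ContDiff ℝ ∞ φ) (ha : ContDiff ℝ ∞ a)
    (hb : ContDiff ℝ ∞ b) (he : ContDiff ℝ ∞ e) :
    ContDiff ℝ ∞ fun t => polar (φ t) (a t) (b t) (e t) := by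
  rw [contDiff_euclidean]
  intro i
  fin_cases i
  exacts [(ha.mul hφ.cos).sub (hb.mul hφ.sin), (ha.mul hφ.sin).add (hb.mul hφ.cos), he]

lemma norm_polar_le (φ a b e : ℝ) : ‖polar φ a b e‖ ≤ |a| + |b| + |e| := by
  rw [EuclideanSpace.norm_eq, Fin.sum_univ_three]
  refine Real.sqrt_le_iff.2 ⟨by positivity, ?_⟩
  simp only [Real.norm_eq_abs, sq_abs]
  rw [polar_sq_add_sq, polar_two, ← sq_abs a, ← sq_abs b, ← sq_abs e]
  have := abs_nonneg a
  have := abs_nonneg b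
  have := abs_nonneg e
  nlinarith [mul_nonneg (abs_nonneg a) (abs_nonneg b), mul_nonneg (abs_nonneg a) (abs_nonneg e),
    mul_nonneg (abs_nonneg b) (abs_nonneg e)]

/-- The curve through a pole in the direction `(u, v)`. -/
lemma isTestCurve_pole (hH : 1 / 2 < H) {C ε : ℝ} (hε : ε ^ 2 = 1) {m : Sphere2}
    (hm : (m : E3) = polar 0 0 0 ε) (hC : 1 ≤ C * √(radius H (-(2 * H)))) {u v : ℝ}
    (huv : u ^ 2 + v ^ 2 = 1) (huv' : |u| + |v| ≤ 1) :
    ∃ γ, IsTestCurve (𝓡 2) τ (sphereMap τ H) (sphereNormal τ H) (fun m : Sphere2 => (m : E3)) C m γ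
      (polar 0 (sphScale H ε * u) (sphScale H ε * v) 0) H := by
  have hz := Icc_subset_sphDomain (τ := τ) hH (mem_Icc_of_sq_eq_one hε)
  have hk := sphScale_pos hz hH
  have hk2 := sphScale_sq_of_sq_eq_one hH hε
  have hsphere : ∀ t, polar 0 (u * Real.sin t) (v * Real.sin t) (ε * Real.cos t)
      ∈ Metric.sphere (0 : E3) 1 := fun t => by
    rw [mem_sphere_iff, polar_sq_add_sq, polar_two]
    linear_combination Real.sin_sq_add_cos_sq t + Real.sin t ^ 2 * huv + Real.cos t ^ 2 * hε
  have hγ : ContDiff ℝ ∞ fun t => polar 0 (u * Real.sin t) (v * Real.sin t) (ε * Real.cos t) :=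
    contDiff_polar contDiff_const (contDiff_const.mul Real.contDiff_sin)
      (contDiff_const.mul Real.contDiff_sin) (contDiff_const.mul Real.contDiff_cos)
  have hsin : HasDerivAt Real.sin 1 0 := by simpa using Real.hasDerivAt_sin 0
  have hzt : HasDerivAt (fun t => ε * Real.cos t) 0 0 := by
    simpa using (Real.hasDerivAt_cos 0).const_mul ε
  -- The height on the parameter sphere is critical at a pole, so a function of the height has zero
  -- derivative along the curve. To first order only the horizontal coordinates vary.
  have hcomp : ∀ {g : ℝ → ℝ}, DifferentiableAt ℝ g ε →
      HasDerivAt (fun t => g (ε * Real.cos t)) 0 0 := fun {g} hg => by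
    have := HasDerivAt.comp (0 : ℝ) (h₂ := g) (h₂' := deriv g ε) (h := fun t => ε * Real.cos t)
      (by simpa using hg.hasDerivAt) hzt
    rwa [mul_zero] at this
  have hax : ∀ {a b e : ℝ → ℝ}, DifferentiableAt ℝ a ε → DifferentiableAt ℝ b ε →
      DifferentiableAt ℝ e ε → HasDerivAt (fun t => axialField a b e
        (polar 0 (u * Real.sin t) (v * Real.sin t) (ε * Real.cos t)))
        (polar 0 (a ε * u - b ε * v) (a ε * v + b ε * u) 0) 0 := by
    intro a b e ha hb he
    have h1 := ((hcomp ha).mul (hsin.const_mul u)).sub ((hcomp hb).mul (hsin.const_mul v))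
    have h2 := ((hcomp ha).mul (hsin.const_mul v)).add ((hcomp hb).mul (hsin.const_mul u))
    have := hasDerivAt_polar h1 h2 (hcomp he) 0 0 1
    refine (this.congr_of_eventuallyEq (.of_forall fun t => ?_)).congr_deriv ?_
    · rw [axialField_polar]; simp
    · congr 1 <;> simp
  have hid : HasDerivAt (fun t => polar 0 (u * Real.sin t) (v * Real.sin t) (ε * Real.cos t))
      (polar 0 u v 0) 0 := by
    have := hasDerivAt_polar (hsin.const_mul u) (hsin.const_mul v) hzt 0 0 1
    refine (this.congr_of_eventuallyEq (.of_forall fun t => ?_)).congr_deriv ?_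
    · simp
    · congr 1 <;> simp
  have hf : sphereMap τ H m = polar 0 0 0 (sphHeight τ H ε) := by
    rw [sphereMap, hm, axialField_polar]; simp
  have hN : sphereNormal τ H m = polar 0 0 0 (sphNormalV τ H ε) := by
    rw [sphereNormal, hm, axialField_polar]; simp
  have hg : metric τ (sphereMap τ H m) (polar 0 (sphScale H ε * u) (sphScale H ε * v) 0)
      (polar 0 (sphScale H ε * u) (sphScale H ε * v) 0) = 4 * radius H (-(2 * H)) := by
    rw [hf, metric_polar]
    linear_combination 4 * (u ^ 2 + v ^ 2) * hk2 + 4 * radius H (-(2 * H)) * huv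
  refine ⟨fun t => ⟨_, hsphere t⟩, ⟨(contMDiff_sphere_curve hγ hsphere).mdifferentiable (by simp) 0,
    Subtype.ext ?_, ?_, ?_, ?_, ⟨_, hax (contDiffAt_sphNormalR hz hH |>.differentiableAt (by simp))
      (contDiffAt_sphNormalA hz |>.differentiableAt (by simp))
      (contDiffAt_sphNormalV hz hH |>.differentiableAt (by simp)), ?_⟩, ⟨_, hid, ?_⟩⟩⟩
  · rw [hm]; simp
  · refine (hax (contDiffAt_sphScale hz hH |>.differentiableAt (by simp))
      (differentiableAt_const 0) (contDiffAt_sphHeight hz hH |>.differentiableAt (by simp))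
      ).congr_deriv ?_
    simp
  · rw [hg]; exact mul_pos four_pos (radius_neg_two_mul_pos hH)
  · rw [hf, hN, metric_polar]; simp
  -- At a pole cosh ρ = 1, so the radial coefficient of the normal is −H times the scale: the pole
  -- is umbilic with curvature H.
  · rw [hg, hf, hN, metric_polar, dmetric_polar, sphNormalR, sphCosh_of_sq_eq_one hε]
    linear_combination 4 * H * (u ^ 2 + v ^ 2) * hk2 + 4 * H * radius H (-(2 * H)) * huv
  -- The crude bound by |u| + |v| is enough, because only the two coordinate directions are needed.
  · refine (norm_polar_le _ _ _ _).trans ?_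
    rw [hg, abs_zero, add_zero, Real.sqrt_mul zero_le_four,
      show (4 : ℝ) = 2 ^ 2 by norm_num, Real.sqrt_sq zero_le_two]
    linarith

lemma exists_hasTestFrame_sphere (hH : 1 / 2 < H) : ∃ C, 0 < C ∧ ∀ m, HasTestFrame (𝓡 2) τ H
    (sphereMap τ H) (sphereNormal τ H) (fun m : Sphere2 => (m : E3)) C m := by
  have hd := (neg_two_mul_lt_neg_sqrt hH).le
  have hR := radius_neg_two_mul_pos hH
  have hc := rootH_pos hH
  have hsR := Real.sqrt_pos.2 hR
  refine ⟨1 / √(radius H (-(2 * H))) + |τ| + rootH H, by positivity, fun m => ?_⟩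
  have hC : 1 ≤ (1 / √(radius H (-(2 * H))) + |τ| + rootH H) * √(radius H (-(2 * H))) := by
    rw [add_assoc, add_mul, div_mul_cancel₀ _ hsR.ne']
    have : 0 ≤ (|τ| + rootH H) * √(radius H (-(2 * H))) := by positivity
    linarith
  rcases sphere_cases m with ⟨ε, hε, hm⟩ | ⟨φ, s, hs, rfl⟩
  · obtain ⟨γ₁, h₁⟩ := isTestCurve_pole (τ := τ) hH hε hm hC (u := 1) (v := 0) (by norm_num)
      (by norm_num)
    obtain ⟨γ₂, h₂⟩ := isTestCurve_pole (τ := τ) hH hε hm hC (u := 0) (v := 1) (by norm_num)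
      (by norm_num)
    refine ⟨γ₁, γ₂, _, _, H, H, h₁, h₂, ?_, by ring⟩
    rw [sphereMap, hm, axialField_polar]
    simp only [mul_zero, sub_zero, add_zero]
    rw [metric_polar]
    ring
  · have hx := one_lt_coshP_sphere hH hs
    have hnhds : Ioo (-Real.pi) Real.pi ∈ 𝓝 s := isOpen_Ioo.mem_nhds hs
    have hcos := cos_half_pos hs
    have hd1 : HasDerivAt (fun s : ℝ => Real.cos (s / 2)) (-Real.sin (s / 2) * (1 / 2)) s :=
      ((hasDerivAt_id s).div_const 2).cos
    have hd2 : HasDerivAt (fun s : ℝ => Real.sin (s / 2)) (Real.cos (s / 2) * (1 / 2)) s :=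
      ((hasDerivAt_id s).div_const 2).sin
    refine hasTestFrame_of_profile hH (four_mul_sq_sub_one_le_sq hd) hx
      (hasDerivAt_sphereProfile hH hs) spherePt (fun κ σ => ?_)
      (Filter.eventually_of_mem hnhds fun s' hs' φ' =>
        sphereMap_spherePt hH ⟨hs'.1.le, hs'.2.le⟩ φ')
      (Filter.eventually_of_mem hnhds fun s' hs' φ' => sphereNormal_spherePt hH hs' φ')
      (fun κ σ => hasDerivAt_polar hd1 (hasDerivAt_const s (0 : ℝ)) hd2 φ κ σ) ?_ ?_
    · have hl : ∀ a b : ℝ, ContDiff ℝ ∞ fun t : ℝ => a + b * t := fun a b =>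
        contDiff_const.add (contDiff_const.mul contDiff_id)
      have hh : ContDiff ℝ ∞ fun t : ℝ => (s + σ * t) / 2 := (hl s σ).div_const 2
      exact (contMDiff_sphere_curve (contDiff_polar (hl φ κ) hh.cos contDiff_const hh.sin)
        fun t => (spherePt (φ + κ * t) (s + σ * t)).2).mdifferentiable (by simp) 0
    · refine (norm_polar_le _ _ _ _).trans ?_
      simp only [zero_mul, mul_zero, sub_zero, zero_add, one_mul, abs_zero, add_zero]
      rw [abs_of_pos hcos]
      have hz := Icc_subset_sphDomain (τ := τ) hH (sin_half_mem s)
      have hk := sphScale_pos hz hH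
      have hk2 := sphScale_sq hz hH
      have hx1 := one_le_sphCosh hH (sin_half_mem s)
      have ha := one_le_twistP (τ := τ) hx.le
      -- The square of the right side is 2 `radius` (cosh ρ + 1), which is at least 4 `radius`.
      -- Parallels thus keep a length comparable to that on the round sphere, uniformly up to the
      -- poles.
      have hle : √(radius H (-(2 * H)))
          ≤ (sphCosh H (Real.sin (s / 2)) + 1) * sphScale H (Real.sin (s / 2)) := by
        refine Real.sqrt_le_iff.2 ⟨mul_nonneg hz.1.le hk.le, ?_⟩
        nlinarith
      have hC' := hC.trans (mul_le_mul_of_nonneg_left hle (by positivity))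
      rw [sinhP_sphere hH hs]
      generalize 1 / √(radius H (-(2 * H))) + |τ| + rootH H = K at *
      generalize (sphCosh H (Real.sin (s / 2)) + 1) * sphScale H (Real.sin (s / 2)) = L at *
      have h1 : Real.cos (s / 2) ≤ K * L * Real.cos (s / 2) := by nlinarith
      have h2 : K * L * Real.cos (s / 2) ≤ K * L * Real.cos (s / 2) * twistP τ H (-(2 * H)) s :=
        le_mul_of_one_le_right (hcos.le.trans h1) ha
      linarith
    · refine (norm_polar_le _ _ _ _).trans ?_
      simp only [mul_zero, sub_zero, zero_add, one_mul]
      rw [abs_mul, abs_mul, abs_mul, abs_neg, abs_of_pos (by norm_num : (0 : ℝ) < 1 / 2)]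
      have h1 := abs_driftP_le' (τ := τ) hH hd hx
      have h2 := Real.abs_sin_le_one (s / 2)
      have h3 := Real.abs_cos_le_one (s / 2)
      have h4 : |driftP τ H (-(2 * H)) s| * |Real.cos (s / 2)| ≤ |τ| / rootH H :=
        (mul_le_of_le_one_right (abs_nonneg _) h3).trans h1
      have h5 : |τ| / rootH H + 1 ≤ (1 / √(radius H (-(2 * H))) + |τ| + rootH H) / rootH H := by
        rw [div_add_one hc.ne']
        gcongr
        have : 0 < 1 / √(radius H (-(2 * H))) := by positivity
        linarith
      linarith

lemma finrank_sphere_model : Module.finrank ℝ (EuclideanSpace ℝ (Fin 2)) = 2 := by simp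

lemma rot_neg_rot (α : ℝ) (p : E3) : rot (-α) (rot α p) = p := by
  obtain ⟨φ, hφ⟩ := exists_polar_eq p
  rw [hφ, rot_polar, rot_polar, neg_add_cancel_left]

lemma continuous_rot (α : ℝ) : Continuous (rot α) := by
  refine (PiLp.continuous_toLp 2 _).comp (continuous_pi fun i => ?_)
  fin_cases i <;> simp <;> fun_prop

lemma rot_mem_sphere (α : ℝ) {p : E3} (hp : p ∈ Metric.sphere (0 : E3) 1) :
    rot α p ∈ Metric.sphere (0 : E3) 1 := by
  rw [mem_sphere_iff] at hp ⊢
  simp only [rot, PiLp.toLp_apply, Matrix.cons_val_zero, Matrix.cons_val_one, Matrix.cons_val]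
  linear_combination hp + (p 0 ^ 2 + p 1 ^ 2) * Real.sin_sq_add_cos_sq α

/-- The rotation of the parameter sphere. -/
def rotSphere (α : ℝ) : Sphere2 ≃ₜ Sphere2 where
  toFun m := ⟨rot α m, rot_mem_sphere α m.2⟩
  invFun m := ⟨rot (-α) m, rot_mem_sphere (-α) m.2⟩
  left_inv m := Subtype.ext (rot_neg_rot α m)
  right_inv m := Subtype.ext (by simpa using rot_neg_rot (-α) m)
  continuous_toFun := ((continuous_rot α).comp continuous_subtype_val).subtype_mk _
  continuous_invFun := ((continuous_rot (-α)).comp continuous_subtype_val).subtype_mk _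

theorem isCompleteRotationalHSurface_sphereMap (hH : 1 / 2 < H) :
    IsCompleteRotationalHSurface (𝓡 2) τ H (sphereMap τ H) := by
  obtain ⟨C, hC, h⟩ := exists_hasTestFrame_sphere (τ := τ) hH
  refine ⟨?_, ?_, fun α => ⟨rotSphere α, fun m => axialField_rot _ _ _ α m⟩⟩
  · exact isHSurface_of_hasTestFrame finrank_sphere_model (contMDiff_sphereMap hH)
      (contMDiff_sphereNormal hH) contMDiff_coe_sphere2 (sphereMap_mem_space hH)
      (metric_sphereNormal hH) h
  · exact isCompleteSurface_of_hasTestFrame finrank_sphere_model hC (contMDiff_sphereMap hH)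
      (contMDiff_sphereNormal hH) contMDiff_coe_sphere2
      (Continuous.isClosedEmbedding continuous_subtype_val Subtype.val_injective)
      (sphereMap_mem_space hH) h

/-- The parameter sphere is compact, so injectivity suffices. The height is strictly monotone in z,
and at a fixed height the horizontal part is multiplied by a nonzero scale. -/
theorem isEmbedding_sphereMap (hH : 1 / 2 < H) : IsEmbedding (sphereMap τ H) := by
  refine (Continuous.isClosedEmbedding (contMDiff_sphereMap hH).continuous
    fun m m' h => Subtype.ext ?_).isEmbedding
  have h2 : (m : E3) 2 = (m' : E3) 2 := (strictMonoOn_sphHeight (τ := τ) hH).injOn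
    (sphere_height_mem m) (sphere_height_mem m') (congrArg (fun p : E3 => p 2) h)
  have hk := (sphScale_pos (Icc_subset_sphDomain (τ := 0) hH (sphere_height_mem m')) hH).ne'
  have h0 := congrArg (fun p : E3 => p 0) h
  have h1 := congrArg (fun p : E3 => p 1) h
  simp only [sphereMap, axialField, PiLp.toLp_apply, Matrix.cons_val_zero, Matrix.cons_val_one,
    zero_mul, sub_zero, add_zero, h2] at h0 h1
  ext i
  fin_cases i
  exacts [mul_left_cancel₀ hk h0, mul_left_cancel₀ hk h1, h2]

lemma range_sphereMap (hH : 1 / 2 < H) : Set.range (sphereMap τ H)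
    = doubledGraph H (-(2 * H)) (graphOf H (-(2 * H)) (sphereProfile τ H)) := by
  ext p
  rw [mem_doubledGraph_iff hH (neg_two_mul_lt_neg_sqrt hH) sphereProfile_neg]
  constructor
  · rintro ⟨m, rfl⟩
    obtain ⟨φ, s, hs, rfl⟩ := exists_spherePt_eq m
    exact ⟨φ, s, hs, sphereMap_spherePt hH hs φ⟩
  · rintro ⟨φ, s, hs, rfl⟩
    exact ⟨spherePt φ s, sphereMap_spherePt hH hs φ⟩

/-- The maximum is attained on the equator s = 0, the outermost point of the profile. -/
lemma isGreatest_rho_sphereMap (hH : 1 / 2 < H) :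
    IsGreatest (rho '' Set.range (sphereMap τ H)) (rho₂ H (-(2 * H))) := by
  have hd := (neg_two_mul_lt_neg_sqrt hH).le
  constructor
  · refine ⟨_, ⟨spherePt 0 0, rfl⟩, ?_⟩
    rw [sphereMap_spherePt hH ⟨by linarith [Real.pi_pos], Real.pi_pos.le⟩,
      rho_polar_radP (one_le_coshP hH hd 0), rho₂_eq_arcosh_coshP hH]
  · rintro _ ⟨_, ⟨m, rfl⟩, rfl⟩
    obtain ⟨φ, s, hs, rfl⟩ := exists_spherePt_eq m
    rw [sphereMap_spherePt hH hs, rho_polar_radP (one_le_coshP hH hd s)]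
    exact (arcosh_coshP_mem hH hd s).2

lemma isGeneratingFunction_sphereProfile (hH : 1 / 2 < H) :
    IsGeneratingFunction τ H (-(2 * H)) (graphOf H (-(2 * H)) (sphereProfile τ H)) :=
  isGeneratingFunction_graphOf hH (neg_two_mul_lt_neg_sqrt hH) (continuous_sphereProfile hH)
    fun _ hs => hasDerivAt_sphereProfile hH ⟨hs.1, hs.2.trans Real.pi_pos⟩

end SphereSurface

end PSLTilde

end

/-! ### Assembly of the family -/

theorem theorem7p2 (τ H : ℝ) (hH : 1 / 2 < H) :
    ∃ (D : ℝ → Annulus → E3) (S : Sphere2 → E3),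
      -- (1) nodoid type
      ((∀ d : ℝ, d < -(2 * H) →
          IsCompleteRotationalHSurface annulusModel τ H (D d) ∧
          ¬ IsEmbedding (D d) ∧
          HasTransversalSelfIntersection annulusModel (D d) ∧
          0 < rho₁ H d ∧ rho₁ H d < rho₂ H d ∧
          Set.range (D d) ⊆ regionBetween (rho₁ H d) (rho₂ H d) ∧
          ∃ u : ℝ → ℝ, IsGeneratingFunction τ H d u ∧
            Set.range (D d) = periodicSurface H d u ∧
            0 < period H d u ∧ IsInvariant (D d) (vert (period H d u))) ∧
        Tendsto (rho₁ H) atBot atTop ∧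
        Tendsto (rho₂ H) atBot atTop ∧
        Tendsto (rho₁ H) (𝓝[<] (-(2 * H))) (𝓝 0) ∧
        Tendsto (rho₂ H) (𝓝[<] (-(2 * H)))
          (𝓝 (Real.arcosh ((4 * H ^ 2 + 1) / (4 * H ^ 2 - 1))))) ∧
      -- (2) the sphere, `d = -2H`
      (IsCompleteRotationalHSurface (𝓡 2) τ H S ∧
        IsEmbedding S ∧
        rho₁ H (-(2 * H)) = 0 ∧
        rho₂ H (-(2 * H)) = Real.arcosh ((4 * H ^ 2 + 1) / (4 * H ^ 2 - 1)) ∧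
        IsGreatest (rho '' Set.range S) (Real.arcosh ((4 * H ^ 2 + 1) / (4 * H ^ 2 - 1))) ∧
        ∃ u : ℝ → ℝ, IsGeneratingFunction τ H (-(2 * H)) u ∧
          Set.range S = doubledGraph H (-(2 * H)) u) ∧
      -- (3) unduloid type
      ((∀ d : ℝ, -(2 * H) < d → d < -√(4 * H ^ 2 - 1) →
          IsCompleteRotationalHSurface annulusModel τ H (D d) ∧
          IsEmbedding (D d) ∧
          0 < rho₁ H d ∧
          rho₁ H d < Real.arcosh (2 * H / √(4 * H ^ 2 - 1)) ∧
          Real.arcosh (2 * H / √(4 * H ^ 2 - 1)) < rho₂ H d ∧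
          Set.range (D d) ⊆ regionBetween (rho₁ H d) (rho₂ H d) ∧
          ∃ u : ℝ → ℝ, IsGeneratingFunction τ H d u ∧
            Set.range (D d) = periodicSurface H d u ∧
            0 < period H d u ∧ IsInvariant (D d) (vert (period H d u))) ∧
        Tendsto (rho₁ H) (𝓝[>] (-(2 * H))) (𝓝 0) ∧
        Tendsto (rho₂ H) (𝓝[>] (-(2 * H)))
          (𝓝 (Real.arcosh ((4 * H ^ 2 + 1) / (4 * H ^ 2 - 1)))) ∧
        Tendsto (rho₁ H) (𝓝[<] (-√(4 * H ^ 2 - 1)))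
          (𝓝 (Real.arcosh (2 * H / √(4 * H ^ 2 - 1)))) ∧
        Tendsto (rho₂ H) (𝓝[<] (-√(4 * H ^ 2 - 1)))
          (𝓝 (Real.arcosh (2 * H / √(4 * H ^ 2 - 1))))) ∧
      -- (4) the cylinder, `d = -√(4H² - 1)`
      (IsCompleteRotationalHSurface annulusModel τ H (D (-√(4 * H ^ 2 - 1))) ∧
        IsEmbedding (D (-√(4 * H ^ 2 - 1))) ∧
        Set.range (D (-√(4 * H ^ 2 - 1))) =
          verticalCylinder (Real.arcosh (2 * H / √(4 * H ^ 2 - 1)))) := by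
  have h2 := neg_two_mul_lt_neg_sqrt hH
  have hne : -√(4 * H ^ 2 - 1) ≠ -(2 * H) := h2.ne'
  -- One formula gives all the annuli, including the cylinder. Its value at d = −2H is never used,
  -- the sphere taking its place.
  refine ⟨annulusMap τ H, sphereMap τ H, ⟨fun d hd => ?_, tendsto_rho₁_atBot hH,
    tendsto_rho₂_atBot hH, ?_, ?_⟩, ⟨isCompleteRotationalHSurface_sphereMap hH,
    isEmbedding_sphereMap hH, rho₁_neg_two_mul hH, rho₂_neg_two_mul hH, ?_,
    graphOf H (-(2 * H)) (sphereProfile τ H), isGeneratingFunction_sphereProfile hH,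
    range_sphereMap hH⟩, ⟨fun d hd' hd => ?_, ?_, ?_, ?_, ?_⟩,
    isCompleteRotationalHSurface_annulusMap hH le_rfl hne, isEmbedding_annulusMap hH le_rfl h2,
    range_annulusMap_neg_sqrt hH⟩
  · have hd1 := hd.trans h2
    have hT := hasTransversalSelfIntersection_annulusMap (τ := τ) hH hd
    obtain ⟨m, m', hm, hf, -⟩ := id hT
    exact ⟨isCompleteRotationalHSurface_annulusMap hH hd1.le hd.ne,
      fun he => hm (he.injective hf), hT, rho₁_pos hH hd1.le hd.ne, rho₁_lt_rho₂ hH hd1,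
      range_annulusMap_subset hH hd1.le hd.ne, _, isGeneratingFunction_heightP hH hd1 hd.ne,
      range_annulusMap_eq hH hd1 hd.ne, period_heightP_pos hH hd1 hd.ne,
      isInvariant_annulusMap_vert hH hd1 hd.ne⟩
  · rw [← rho₁_neg_two_mul hH]
    -- Since −2H lies strictly below −√(4H² − 1), every d close to −2H is admissible, on either
    -- side.
    exact tendsto_rho₁ hH nhdsWithin_le_nhds h2.le
      (nhdsWithin_le_nhds (Iic_mem_nhds h2))
  · rw [← rho₂_neg_two_mul hH]
    exact tendsto_rho₂ hH nhdsWithin_le_nhds h2.le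
      (nhdsWithin_le_nhds (Iic_mem_nhds h2))
  · rw [← rho₂_neg_two_mul hH]
    exact isGreatest_rho_sphereMap hH
  · have hm := two_mul_div_sqrt_mem_Ioo hH hd hd'
    have hc := one_lt_center_sub_radius hH hd.le hd'.ne'
    have hs := one_lt_two_mul_div_sqrt hH
    refine ⟨isCompleteRotationalHSurface_annulusMap hH hd.le hd'.ne',
      isEmbedding_annulusMap hH hd.le hd', rho₁_pos hH hd.le hd'.ne', ?_, ?_,
      range_annulusMap_subset hH hd.le hd'.ne', _, isGeneratingFunction_heightP hH hd hd'.ne',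
      range_annulusMap_eq hH hd hd'.ne', period_heightP_pos hH hd hd'.ne',
      isInvariant_annulusMap_vert hH hd hd'.ne'⟩
    · rw [rho₁_eq hH, Real.arcosh_lt_arcosh (by linarith) (by linarith)]
      exact hm.1
    · rw [rho₂_eq hH, Real.arcosh_lt_arcosh (by linarith) (by linarith [hm.2])]
      exact hm.2
  · rw [← rho₁_neg_two_mul hH]
    exact tendsto_rho₁ hH nhdsWithin_le_nhds h2.le
      (nhdsWithin_le_nhds (Iic_mem_nhds h2))
  · rw [← rho₂_neg_two_mul hH]
    exact tendsto_rho₂ hH nhdsWithin_le_nhds h2.le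
      (nhdsWithin_le_nhds (Iic_mem_nhds h2))
  · have h := tendsto_rho₁ hH (nhdsWithin_le_nhds (s := Iio (-√(4 * H ^ 2 - 1)))) le_rfl
      (eventually_nhdsWithin_of_forall fun d hd => le_of_lt hd)
    rwa [rho₁_eq hH, radius_neg_sqrt hH, center_neg_sqrt hH, sub_zero] at h
  · have h := tendsto_rho₂ hH (nhdsWithin_le_nhds (s := Iio (-√(4 * H ^ 2 - 1)))) le_rfl
      (eventually_nhdsWithin_of_forall fun d hd => le_of_lt hd)
    rwa [rho₂_eq hH, radius_neg_sqrt hH, center_neg_sqrt hH, add_zero] at h
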